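/- **Notation.** Write $\Gamma_{\mathbb R}(s)=\pi^{-s/2}\Gamma(s/2)$. For $n\ge 1$ let $X_n(\mathbb R)$ be the group of upper triangular unipotent matrices in $GL_n(\mathbb R)$, let $\alpha[y_1,\dots,y_n]=\mathrm{diag}(y_1\cdots y_n,\,y_2\cdots y_n,\dots,y_n)$ for $y_i>0$, and write the Iwasawa decomposition of $g\in GL_n(\mathbb R)$ as $g=x(g)\,y(g)\,k(g)$ with $x(g)\in X_n(\mathbb R)$, $y(g)=\alpha[y_1,\dots,y_n]$, $k(g)\in O(n)$. Put $\psi(x)=\exp\bigl(2\pi i\sum_{j=1}^{n-1}x_{j,j+1}\bigr)$ for $x\in X_n(\mathbb R)$, and $|a|=a_1+\dots+a_n$ for $a\in\mathbb C^n$. **Class one Whittaker functions.** For $a\in\mathbb C^n$ define $\widehat W_{n,a}(\alpha[y_1,\dots,y_n])=y_n^{|a|}\,\widehat W_{n,a}(\alpha[y_1,\dots,y_{n-1},1])$, where $\widehat W_{1,a}(\alpha[1])=1$, $\widehat W_{2,a}(\alpha[y_1,1])=2y_1^{(a_1+a_2)/2}K_{(a_1-a_2)/2}(2\pi y_1)$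 with the $K$-Bessel function $K_\nu(z)=\frac12\int_0^\infty e^{-\frac z2(t+1/t)}t^{\nu}\frac{dt}{t}$, and for $n\ge 3$ $$\widehat W_{n,a}(\alpha[y_1,\dots,y_{n-1},1])=\int_{(\mathbb R_+)^{n-1}}\widehat W_{n-1,\widetilde a}\Bigl(\alpha\Bigl[y_2\sqrt{\tfrac{t_2}{t_1}},\dots,y_{n-1}\sqrt{\tfrac{t_{n-1}}{t_{n-2}}},1\Bigr]\Bigr)\prod_{j=1}^{n-1}\Bigl[e^{-(\pi y_j)^2t_j-1/t_j}(\pi y_j)^{\frac{(n-j)a_1}{n-1}}t_j^{\frac{na_1}{2(n-1)}}\Bigr](\pi t_{n-1})^{-|a|/2}\prod_{j=1}^{n-1}\frac{dt_j}{t_j},$$ with $\widetilde a_j=a_{j+1}+a_1/(n-1)$ for $1\le j\le n-1$. Let $W_{n,a}(\alpha[y_1,\dots,y_n])=\prod_{j=1}^{n-1}y_j^{j(n-j)/2}\cdot\widehat W_{n,a}(\alpha[y_1,\dots,y_n])$ and extend it to $GL_n(\mathbb R)$ by $W_{n,a}(g)=\psi(x(g))\,W_{n,a}(y(g))$; put $\overline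 W_{n,a}(g)=\psi(x(g))^{-1}W_{n,a}(y(g))$. **Zeta integrals.** Let $dg$ on $X_m(\mathbb R)\backslash GL_m(\mathbb R)$ be the right $GL_m(\mathbb R)$-invariant measure that is the quotient of the Haar measure $\prod_{j=1}^m\Gamma_{\mathbb R}(j)\cdot|\det g|^{-m}\prod_{i,j}dg_{i,j}$ by $\prod_{i<j}dx_{i,j}$; equivalently, for right $O(m)$-invariant $f$, $$\int_{X_m(\mathbb R)\backslash GL_m(\mathbb R)}f(g)\,dg=2^m\int_{(\mathbb R_+)^m}f(\alpha[y_1,\dots,y_m])\prod_{j=1}^m y_j^{-j(m-j)}\frac{dy_j}{y_j}.$$ Let $\Phi(x)=\exp(-\pi\sum_i x_i^2)$ on $\mathbb R^n$ and $e_n=(0,\dots,0,1)$. For $a\in\mathbb C^n$ and $a'\in\mathbb C^m$ put $$I_{n,n-1;a,a'}(s)=\int_{X_{n-1}(\mathbb R)\backslash GL_{n-1}(\mathbb R)}W_{n,a}\begin{pmatrix}g&\\&1\end{pmatrix}\overline W_{n-1,a'}(g)\,|\det g|^{s-1/2}\,dg\qquad(m=n-1),$$ $$I_{n,n;a,a'}(s)=\int_{X_n(\mathbb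 R)\backslash GL_n(\mathbb R)}W_{n,a}(g)\,\overline W_{n,a'}(g)\,\Phi(e_ng)\,|\det g|^{s}\,dg\qquad(m=n).$$ **Theorem.** No condition is imposed on $|a|$ or $|a'|$. (1) Let $n\ge2$, $a\in\mathbb C^n$, $a'\in\mathbb C^{n-1}$, and let $s\in\mathbb C$ satisfy $\mathrm{Re}(s+a_j+a'_k)>0$ for all $j,k$. Then the integral $I_{n,n-1;a,a'}(s)$ converges absolutely and $$I_{n,n-1;a,a'}(s)=\prod_{1\le j\le n,\;1\le k\le n-1}\Gamma_{\mathbb R}(s+a_j+a'_k).$$ (2) Let $n\ge1$, $a,a'\in\mathbb C^n$, and let $s\in\mathbb C$ satisfy $\mathrm{Re}(s+a_j+a'_k)>0$ for all $j,k$. Then the integral $I_{n,n;a,a'}(s)$ converges absolutely and $$I_{n,n;a,a'}(s)=\prod_{1\le j\le n,\;1\le k\le n}\Gamma_{\mathbb R}(s+a_j+a'_k).$$ -/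

import Mathlib

open MeasureTheory Matrix

noncomputable section

namespace RankinSelberg

/-! ### The groups -/

/-- `GL_n(ℝ)`. -/
abbrev GLR (n : ℕ) : Type := GL (Fin n) ℝ

/-- The Borel σ-algebra on `GL_n(ℝ)`. -/
instance instMeasurableSpaceGLR (n : ℕ) : MeasurableSpace (GL (Fin n) ℝ) := borel _

instance instBorelSpaceGLR (n : ℕ) : BorelSpace (GL (Fin n) ℝ) := ⟨rfl⟩

/-- Upper triangular matrices with ones on the diagonal. -/
def IsUnipotentUpper {n : ℕ} (M : Matrix (Fin n) (Fin n) ℝ) : Prop :=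
  (∀ i j, j < i → M i j = 0) ∧ ∀ i, M i i = 1

theorem IsUnipotentUpper.mul {n : ℕ} {M N : Matrix (Fin n) (Fin n) ℝ}
    (hM : IsUnipotentUpper M) (hN : IsUnipotentUpper N) : IsUnipotentUpper (M * N) := by
  refine ⟨fun i j hij => ?_, fun i => ?_⟩
  · rw [Matrix.mul_apply]
    refine Finset.sum_eq_zero fun k _ => ?_
    rcases lt_or_ge k i with h | h
    · rw [hM.1 i k h, zero_mul]
    · rw [hN.1 k j (lt_of_lt_of_le hij h), mul_zero]
  · rw [Matrix.mul_apply, Finset.sum_eq_single i]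
    · rw [hM.2, hN.2, one_mul]
    · intro k _ hk
      rcases lt_or_gt_of_ne hk with h | h
      · rw [hM.1 i k h, zero_mul]
      · rw [hN.1 k i h, mul_zero]
    · simp

theorem IsUnipotentUpper.inv {n : ℕ} {M N : Matrix (Fin n) (Fin n) ℝ}
    (hM : IsUnipotentUpper M) (h : M * N = 1) : IsUnipotentUpper N := by
  have h' : N * M = 1 := mul_eq_one_comm.mp h
  have : Invertible M := ⟨N, h', h⟩
  have hN : N = M⁻¹ := (Matrix.inv_eq_left_inv h').symm
  have hT : Matrix.BlockTriangular N (id : Fin n → Fin n) := by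
    rw [hN]
    exact Matrix.blockTriangular_inv_of_blockTriangular (fun i j hij => hM.1 i j hij)
  refine ⟨fun i j hij => hT hij, fun i => ?_⟩
  have e : (M * N) i i = 1 := by rw [h, Matrix.one_apply_eq]
  rw [Matrix.mul_apply, Finset.sum_eq_single i] at e
  · rwa [hM.2, one_mul] at e
  · intro k _ hk
    rcases lt_or_gt_of_ne hk with h | h
    · rw [hM.1 i k h, zero_mul]
    · rw [hT h, mul_zero]
  · simp

/-- The subgroup `X_n(ℝ)` of upper triangular unipotent matrices in `GL_n(ℝ)`. -/
def unip (n : ℕ) : Subgroup (GLR n) where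
  carrier := {g | IsUnipotentUpper (g : Matrix (Fin n) (Fin n) ℝ)}
  mul_mem' := fun {a b} ha hb => by
    simpa using IsUnipotentUpper.mul ha hb
  one_mem' := by
    refine ⟨fun i j hij => ?_, fun i => ?_⟩
    · simp [Matrix.one_apply_ne hij.ne']
    · simp
  inv_mem' := fun {a} ha => IsUnipotentUpper.inv ha (by rw [← Units.val_mul]; simp)

/-- The Iwasawa decomposition `g = x t k` with `x` upper triangular unipotent,
`t = diag(t_1, …, t_n)`, `t_i > 0`, and `k` orthogonal. -/
def IsIwasawa {n : ℕ} (g : GLR n) (x : Matrix (Fin n) (Fin n) ℝ) (t : Fin n → ℝ)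
    (k : Matrix (Fin n) (Fin n) ℝ) : Prop :=
  IsUnipotentUpper x ∧ (∀ i, 0 < t i) ∧ k ∈ Matrix.orthogonalGroup (Fin n) ℝ ∧
    (g : Matrix (Fin n) (Fin n) ℝ) = x * Matrix.diagonal t * k

theorem exists_isIwasawa {n : ℕ} (g : GLR n) : ∃ x t k, IsIwasawa g x t k := by
  -- Gram-Schmidt orthogonalization of the rows of `g`, from the last row to the first
  let r : (Fin n)ᵒᵈ → EuclideanSpace ℝ (Fin n) :=
    fun i => WithLp.toLp 2 ((g : Matrix (Fin n) (Fin n) ℝ) (OrderDual.ofDual i))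
  have hli : LinearIndependent ℝ r := by
    have h1 : LinearIndependent ℝ (fun i => (g : Matrix (Fin n) (Fin n) ℝ) i) :=
      Matrix.linearIndependent_rows_of_isUnit g.isUnit
    have h2 := h1.map' (WithLp.linearEquiv 2 ℝ (Fin n → ℝ)).symm.toLinearMap
      (LinearEquiv.ker _)
    exact h2.comp OrderDual.ofDual OrderDual.ofDual.injective
  let f : (Fin n)ᵒᵈ → EuclideanSpace ℝ (Fin n) := InnerProductSpace.gramSchmidt ℝ r
  have hf0 : ∀ i, f i ≠ 0 := fun i => InnerProductSpace.gramSchmidt_ne_zero i hli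
  have hpos : ∀ i, 0 < ‖f i‖ := fun i => norm_pos_iff.mpr (hf0 i)
  have horth : ∀ i j, i ≠ j → inner ℝ (f i) (f j) = 0 := fun i j hij =>
    InnerProductSpace.gramSchmidt_orthogonal ℝ r hij
  let c : Fin n → Fin n → ℝ := fun i j =>
    inner ℝ (f (OrderDual.toDual j)) (r (OrderDual.toDual i)) / ‖f (OrderDual.toDual j)‖ ^ 2
  refine ⟨Matrix.of fun i j => if i = j then 1 else if i < j then c i j else 0,
    fun i => ‖f (OrderDual.toDual i)‖,
    Matrix.of fun i j => ‖f (OrderDual.toDual i)‖⁻¹ * f (OrderDual.toDual i) j,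
    ⟨fun i j hij => ?_, fun i => ?_⟩, fun i => hpos _, ?_, ?_⟩
  · simp [hij.ne', hij.le]
  · simp
  · rw [Matrix.mem_orthogonalGroup_iff]
    ext i j
    have hin : inner ℝ (f (OrderDual.toDual i)) (f (OrderDual.toDual j)) =
        ∑ l, f (OrderDual.toDual i) l * f (OrderDual.toDual j) l := by
      simp [PiLp.inner_apply, mul_comm]
    have : ∀ l, ‖f (OrderDual.toDual i)‖⁻¹ * f (OrderDual.toDual i) l *
        (‖f (OrderDual.toDual j)‖⁻¹ * f (OrderDual.toDual j) l) =
        ‖f (OrderDual.toDual i)‖⁻¹ * ‖f (OrderDual.toDual j)‖⁻¹ *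
          (f (OrderDual.toDual i) l * f (OrderDual.toDual j) l) := fun l => by ring
    simp only [Matrix.mul_apply, Matrix.transpose_apply, Matrix.of_apply, this]
    rw [← Finset.mul_sum, ← hin]
    by_cases hij : i = j
    · subst hij
      rw [real_inner_self_eq_norm_sq, Matrix.one_apply_eq]
      have := (hpos (OrderDual.toDual i)).ne'
      field_simp
    · rw [horth _ _ (fun h => hij (OrderDual.toDual_inj.mp h)), Matrix.one_apply_ne hij, mul_zero]
  · ext i l
    have h := congrArg (fun v : EuclideanSpace ℝ (Fin n) => v l)
      (InnerProductSpace.gramSchmidt_def'' ℝ r (OrderDual.toDual i))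
    have hI : Finset.Iio (OrderDual.toDual i) = (Finset.Ioi i).map OrderDual.toDual.toEmbedding := by
      ext z; simp [OrderDual.lt_toDual]
    rw [hI] at h
    simp only [PiLp.add_apply, WithLp.ofLp_sum, Finset.sum_apply, WithLp.ofLp_smul, Pi.smul_apply,
      smul_eq_mul, Finset.sum_map, Equiv.coe_toEmbedding] at h
    rw [Matrix.mul_apply]
    simp only [Matrix.mul_diagonal, Matrix.of_apply]
    have hterm : ∀ j, (if i = j then (1 : ℝ) else if i < j then c i j else 0) *
        ‖f (OrderDual.toDual j)‖ * (‖f (OrderDual.toDual j)‖⁻¹ * f (OrderDual.toDual j) l) =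
        (if i = j then f (OrderDual.toDual j) l else 0) +
          (if j ∈ Finset.Ioi i then c i j * f (OrderDual.toDual j) l else 0) := by
      intro j
      have := (hpos (OrderDual.toDual j)).ne'
      by_cases hij : i = j
      · subst hij; simp; field_simp
      · by_cases hlt : i < j <;> simp [hij, hlt]
        field_simp
    rw [Finset.sum_congr rfl fun j _ => hterm j, Finset.sum_add_distrib,
      Finset.sum_ite_mem, Finset.univ_inter]
    simp only [Finset.sum_ite_eq, Finset.mem_univ, if_true]
    exact h

/-- The unipotent part `x(g)` of the (unique) Iwasawa decomposition. -/
def iwasawaX {n : ℕ} (g : GLR n) : Matrix (Fin n) (Fin n) ℝ := (exists_isIwasawa g).choose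

/-- The diagonal entries `t_1, …, t_n` of the part `y(g) = diag(t_1, …, t_n)` of the (unique)
Iwasawa decomposition. -/
def iwasawaT {n : ℕ} (g : GLR n) : Fin n → ℝ := (exists_isIwasawa g).choose_spec.choose

/-- The coordinates `y_i = t_i / t_{i+1}` for `i < n` and `y_n = t_n` of `y(g)`, that is,
`y(g) = α[y_1, …, y_n] = diag(y_1 ⋯ y_n, y_2 ⋯ y_n, …, y_n)`. -/
def iwasawaY {n : ℕ} (g : GLR n) (i : Fin n) : ℝ :=
  if h : (i : ℕ) + 1 < n then iwasawaT g i / iwasawaT g ⟨(i : ℕ) + 1, h⟩ else iwasawaT g i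

/-! ### Class one Whittaker functions -/

/-- The modified Bessel function
`K_ν(z) = (1/2) ∫_0^∞ exp(-(z/2)(t + 1/t)) t^ν dt/t`, for `z > 0`. -/
def besselK (ν : ℂ) (z : ℝ) : ℂ :=
  (1 / 2 : ℂ) * ∫ t in Set.Ioi (0 : ℝ),
    (Real.exp (-(z / 2) * (t + 1 / t)) : ℂ) * (t : ℂ) ^ ν * (1 / (t : ℂ))

/-- The parameter `ã` of length `n - 1` attached to `a` of length `n = N + 2`:
`ã_j = a_{j+1} + a_1 / (n - 1)`. -/
def tildeParam {N : ℕ} (a : Fin (N + 2) → ℂ) : Fin (N + 1) → ℂ :=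
  fun j => a j.succ + a 0 / ((N : ℂ) + 1)

/-- `whittakerCore N a (y_1, …, y_N)` is `Ŵ_{n,a}(α[y_1, …, y_{n-1}, 1])` for `n = N + 1`. It is
`1` for `n = 1`, a `K`-Bessel function for `n = 2`, and is given by the recursive integral formula
over `t ∈ (ℝ_+)^{n-1}` for `n ≥ 3`. -/
def whittakerCore : (N : ℕ) → (Fin (N + 1) → ℂ) → (Fin N → ℝ) → ℂ
  | 0, _, _ => 1
  | 1, a, y =>
      2 * ((y 0 : ℝ) : ℂ) ^ ((a 0 + a 1) / 2) * besselK ((a 0 - a 1) / 2) (2 * Real.pi * y 0)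
  | N + 2, a, y =>
      -- here `n = N + 3` and `n - 1 = N + 2`; the index `j : Fin (N + 2)` stands for `j + 1`
      ∫ t in {t : Fin (N + 2) → ℝ | ∀ j, 0 < t j},
        whittakerCore (N + 1) (tildeParam a)
            (fun j : Fin (N + 1) => y j.succ * Real.sqrt (t j.succ / t j.castSucc)) *
          (∏ j : Fin (N + 2),
            (Real.exp (-((Real.pi * y j) ^ 2 * t j) - 1 / t j) : ℂ) *
              ((Real.pi * y j : ℝ) : ℂ) ^
                ((((N : ℂ) + 3) - ((j : ℕ) + 1 : ℂ)) * a 0 / ((N : ℂ) + 2)) *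
              ((t j : ℝ) : ℂ) ^ (((N : ℂ) + 3) * a 0 / (2 * ((N : ℂ) + 2)))) *
          ((Real.pi * t (Fin.last (N + 1)) : ℝ) : ℂ) ^ (-(∑ i, a i) / 2) *
          ∏ j : Fin (N + 2), (1 / ((t j : ℝ) : ℂ))

/-- `Ŵ_{n,a}(α[y_1, …, y_n]) = y_n^{|a|} Ŵ_{n,a}(α[y_1, …, y_{n-1}, 1])`, where
`|a| = a_1 + ⋯ + a_n`. -/
def whittakerHat : (n : ℕ) → (Fin n → ℂ) → (Fin n → ℝ) → ℂ
  | 0, _, _ => 1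
  | N + 1, a, y =>
      ((y (Fin.last N) : ℝ) : ℂ) ^ (∑ i, a i) * whittakerCore N a (fun j => y j.castSucc)

/-- The radial part `W_{n,a}(α[y_1, …, y_n]) = y^ρ Ŵ_{n,a}(α[y_1, …, y_n])`, where
`y^ρ = ∏_j y_j^{j(n-j)/2}`. -/
def whittakerRadial (n : ℕ) (a : Fin n → ℂ) (y : Fin n → ℝ) : ℂ :=
  ((∏ j : Fin n, y j ^ ((((j : ℕ) : ℝ) + 1) * ((n : ℝ) - (((j : ℕ) : ℝ) + 1)) / 2) : ℝ) : ℂ) *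
    whittakerHat n a y

/-- The character `ψ(x) = exp(2πi (x_{1,2} + x_{2,3} + ⋯ + x_{n-1,n}))`. -/
def psi {n : ℕ} (x : Matrix (Fin n) (Fin n) ℝ) : ℂ :=
  Complex.exp (2 * Real.pi * Complex.I *
    ((∑ i : Fin n, ∑ j : Fin n, if (i : ℕ) + 1 = j then x i j else 0 : ℝ) : ℂ))

/-- The class one `ψ`-Whittaker function `W_{n,a}(g) = ψ(x(g)) W_{n,a}(y(g))` on `GL_n(ℝ)`. -/
def whittaker (n : ℕ) (a : Fin n → ℂ) (g : GLR n) : ℂ :=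
  psi (iwasawaX g) * whittakerRadial n a (iwasawaY g)

/-- The class one `ψ⁻¹`-Whittaker function `ψ⁻¹(x(g)) W_{n,a}(y(g))` on `GL_n(ℝ)`. -/
def whittakerBar (n : ℕ) (a : Fin n → ℂ) (g : GLR n) : ℂ :=
  (psi (iwasawaX g))⁻¹ * whittakerRadial n a (iwasawaY g)

/-! ### Invariant integration on `X_n(ℝ) \ GL_n(ℝ)` -/

/-- The matrix entries of `g`, as a point of `ℝ^{n × n}` (which carries Lebesgue measure). -/
def entries (n : ℕ) (g : GLR n) : Fin n → Fin n → ℝ := fun i j => (g : Matrix _ _ ℝ) i j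

/-- The Haar measure `c_n |det g|^{-n} ∏_{i,j} dg_{i,j}` on `GL_n(ℝ)`, where
`c_n = ∏_{j=1}^n π^{-j/2} Γ(j/2)`. In Iwasawa coordinates `g = x α[y_1, …, y_n] k` it is
`2^n ∏_{i<j} dx_{i,j} ∏_j y_j^{-j(n-j)} dy_j/y_j dk`, with `dk` the Haar measure of total mass one
on the orthogonal group. -/
def haarGL (n : ℕ) : Measure (GLR n) :=
  ENNReal.ofReal (∏ j ∈ Finset.Icc 1 n, Real.pi ^ (-(j : ℝ) / 2) * Real.Gamma ((j : ℝ) / 2)) •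
    (Measure.comap (entries n) volume).withDensity
      (fun g => ENNReal.ofReal ((|(g : Matrix (Fin n) (Fin n) ℝ).det| ^ n)⁻¹))

/-- The space `X_n(ℝ) \ GL_n(ℝ)` of cosets `X_n(ℝ) g`. -/
abbrev UnipQuotient (n : ℕ) : Type := Quotient (QuotientGroup.rightRel (unip n))

/-- The right invariant measure on `X_n(ℝ) \ GL_n(ℝ)`: the quotient of the Haar measure on
`GL_n(ℝ)` by the Haar measure `dx = ∏_{i<j} dx_{i,j}` on `X_n(ℝ)`. As
`{x | 0 ≤ x_{i,j} < 1 for i < j}` and its right translates have `dx`-volume one, it is the image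
of the restriction of the Haar measure to `{g | 0 ≤ x(g)_{i,j} < 1 for i < j}`, a set that meets
each coset in a subset of `dx`-volume one. -/
def quotientMeasure (n : ℕ) : Measure (UnipQuotient n) :=
  Measure.map (Quotient.mk (QuotientGroup.rightRel (unip n)))
    ((haarGL n).restrict {g | ∀ i j, i < j → 0 ≤ iwasawaX g i j ∧ iwasawaX g i j < 1})

/-- A function on `GL_n(ℝ)` that is left invariant under `X_n(ℝ)`, as a function on
`X_n(ℝ) \ GL_n(ℝ)`. -/
def descend {n : ℕ} (f : GLR n → ℂ) : UnipQuotient n → ℂ := fun q => f q.out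

/-! ### The archimedean zeta integrals -/

/-- The Schwartz function `Φ(x) = exp(-π (x_1² + ⋯ + x_n²))` on `ℝ^n`. -/
def gaussian {n : ℕ} (x : Fin n → ℝ) : ℂ := (Real.exp (-Real.pi * ∑ i, x i ^ 2) : ℂ)

/-- The row vector `e_n = (0, …, 0, 1)`. -/
def lastVec (n : ℕ) : Fin n → ℝ := fun i => if (i : ℕ) + 1 = n then 1 else 0

/-- The embedding `g ↦ diag(g, 1_k)` of `GL_m(ℝ)` in `GL_{m+k}(ℝ)`. -/
def blockEmbed {m : ℕ} (k : ℕ) (g : GLR m) : GLR (m + k) :=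
  Matrix.GeneralLinearGroup.mkOfDetNeZero
    (Matrix.reindex finSumFinEquiv finSumFinEquiv
      (Matrix.fromBlocks (g : Matrix (Fin m) (Fin m) ℝ) 0 0 (1 : Matrix (Fin k) (Fin k) ℝ)))
    (by
      rw [Matrix.det_reindex_self, Matrix.det_fromBlocks_zero₂₁, Matrix.det_one, mul_one]
      exact (Matrix.isUnits_det_units g).ne_zero)

/-- The integrand `W(g) W'(g) Φ(e_n g) |det g|^s` of the zeta integral on `GL_n × GL_n`. -/
def integrandEq {n : ℕ} (s : ℂ) (W W' : GLR n → ℂ) (g : GLR n) : ℂ :=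
  W g * W' g * gaussian (lastVec n ᵥ* (g : Matrix (Fin n) (Fin n) ℝ)) *
    ((|(g : Matrix (Fin n) (Fin n) ℝ).det| : ℝ) : ℂ) ^ s

/-- The integrand `W(diag(g, 1_{n-m})) W'(g) |det g|^{s-(n-m)/2}` of the zeta integral on
`GL_n × GL_m`, `n = m + k` with `k ≥ 1`. -/
def integrandLt {m k : ℕ} (s : ℂ) (W : GLR (m + k) → ℂ) (W' : GLR m → ℂ) (g : GLR m) : ℂ :=
  W (blockEmbed k g) * W' g *
    ((|(g : Matrix (Fin m) (Fin m) ℝ).det| : ℝ) : ℂ) ^ (s - (k : ℂ) / 2)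

/-- The zeta integral `Z(s, W, W')` on `GL_n × GL_n`. -/
def zetaEq {n : ℕ} (s : ℂ) (W W' : GLR n → ℂ) : ℂ :=
  ∫ q, descend (integrandEq s W W') q ∂(quotientMeasure n)

/-- Absolute convergence of the zeta integral on `GL_n × GL_n`. -/
def ZetaEqConverges {n : ℕ} (s : ℂ) (W W' : GLR n → ℂ) : Prop :=
  Integrable (descend (integrandEq s W W')) (quotientMeasure n)

/-- The zeta integral `Z(s, W, W')` on `GL_n × GL_m`, `n = m + k` with `k ≥ 1`. -/
def zetaLt {m k : ℕ} (s : ℂ) (W : GLR (m + k) → ℂ) (W' : GLR m → ℂ) : ℂ :=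
  ∫ q, descend (integrandLt s W W') q ∂(quotientMeasure m)

/-- Absolute convergence of the zeta integral on `GL_n × GL_m`, `n = m + k` with `k ≥ 1`. -/
def ZetaLtConverges {m k : ℕ} (s : ℂ) (W : GLR (m + k) → ℂ) (W' : GLR m → ℂ) : Prop :=
  Integrable (descend (integrandLt s W W')) (quotientMeasure m)

end RankinSelberg

end

noncomputable section

namespace RankinSelberg

/-! ### Integration over `Fin n → ℝ` -/

/-! Write the torus part of the Iwasawa decomposition as `diag(e^{x_1}, …, e^{x_n})`. Without the
factor `y^ρ`, the radial Whittaker function becomes `whit`, which satisfies a Givental-type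
recursion: rank `n + 1` is obtained from rank `n` by integrating against `exp(-π todaE x w + a_1 (∑
x - ∑ w))`. The integral formula that defines `whittakerCore` is this recursion after an exponential
substitution and a shift of the parameters (`whit_eq_whittakerCore`).

The Baxter operator with spectral parameter `l` has kernel `exp(-π baxterE z w + l (∑ z - ∑ w))`.
Composed with the kernel of the recursion, it equals a gamma factor times the recursion kernel
composed with the Baxter operator of one rank less; a reflection of the integration variables proves
this (`exists_exchange`, `integral_exchange`). By induction on the rank, `whit` is an eigenfunction
with eigenvalue `∏ Γ_ℝ(l + a_j)`, once the operator is scaled by a power of `2` (`integral_baxter`).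

The zeta integrals are then evaluated by removing one parameter at a time. In equal rank, unfold the
Whittaker function of `a'` once: the recursion kernel and the Gaussian combine to a Baxter kernel at
a point with last coordinate `0`. The eigenvalue gives all factors with `a'_1` and leaves the
integral on `GL_{m+1} × GL_m` without `a'_1` (`integral_rsEq`). In unequal rank, unfold the
Whittaker function of `a`: its last coordinate is `0`, so its kernel splits into a Baxter kernel and
a Gaussian, which gives all factors with `a_1` and leaves an equal rank integral
(`integral_rsLt_succ`). Alternating the two steps ends at the trivial integral over a point.

Absolute convergence uses the same identities with values in `ℝ≥0∞`, for the majorants `lwhit` built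
from real parts. There Tonelli's theorem needs no integrability, and finiteness reduces to that of
the gamma integrals. This also justifies each use of Fubini in the complex computation.

On the group, the two characters cancel, so each integrand depends only on the torus part.
Orthogonalizing the rows one by one gives the image of Haar measure under the logarithmic torus
coordinates (`lintegral_gsSet`, `map_logT`); its density cancels the product of the two factors
`y^ρ`, in unequal rank with the help of the shift by `1/2` (`integral_descend`). -/

theorem measurePreserving_consTail (n : ℕ) :
    MeasurePreserving (fun z : Fin (n + 1) → ℝ => (z 0, fun i : Fin n => z i.succ))
      volume (volume.prod volume) := by
  have h := volume_preserving_piFinSuccAbove (fun _ : Fin (n + 1) => ℝ) 0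
  exact h

theorem integral_head_mul_tail {n : ℕ} (f : ℝ → ℂ) (g : (Fin n → ℝ) → ℂ) :
    ∫ z : Fin (n + 1) → ℝ, f (z 0) * g (fun i => z i.succ) = (∫ x, f x) * ∫ y, g y := by
  have h := volume_preserving_piFinSuccAbove (fun _ : Fin (n + 1) => ℝ) 0
  rw [← integral_prod_mul f g]
  exact h.integral_comp' (g := fun p : ℝ × (Fin n → ℝ) => f p.1 * g p.2)

theorem lintegral_head_mul_tail {n : ℕ} {f : ℝ → ENNReal} {g : (Fin n → ℝ) → ENNReal}
    (hf : Measurable f) (hg : Measurable g) :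
    ∫⁻ z : Fin (n + 1) → ℝ, f (z 0) * g (fun i => z i.succ) = (∫⁻ x, f x) * ∫⁻ y, g y := by
  rw [← lintegral_prod_mul hf.aemeasurable hg.aemeasurable,
    ← (measurePreserving_consTail n).lintegral_comp (by fun_prop)]

theorem lintegral_const_sub {n : ℕ} (c : Fin n → ℝ) {f : (Fin n → ℝ) → ENNReal} :
    ∫⁻ x, f (c - x) = ∫⁻ x, f x := lintegral_sub_left_eq_self f c

/-! ### Exponents -/

/-- The exponent of the kernel that raises the rank of a Whittaker function by one. -/
def todaE {n : ℕ} (x : Fin (n + 1) → ℝ) (w : Fin n → ℝ) : ℝ :=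
  ∑ j : Fin n, (Real.exp (2 * (w j - x j.succ)) + Real.exp (2 * (x j.castSucc - w j)))

/-- The exponent of the kernel of the Baxter operator. -/
def baxterE {n : ℕ} (z w : Fin (n + 1) → ℝ) : ℝ :=
  ∑ j, Real.exp (2 * (z j - w j)) + ∑ j : Fin n, Real.exp (2 * (w j.castSucc - z j.succ))

@[fun_prop]
theorem measurable_todaE {α : Type*} [MeasurableSpace α] {n : ℕ} {f : α → Fin (n + 1) → ℝ}
    {g : α → Fin n → ℝ} (hf : Measurable f) (hg : Measurable g) :
    Measurable fun p => todaE (f p) (g p) := by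
  unfold RankinSelberg.todaE
  fun_prop

@[fun_prop]
theorem measurable_baxterE {α : Type*} [MeasurableSpace α] {n : ℕ} {f g : α → Fin (n + 1) → ℝ}
    (hf : Measurable f) (hg : Measurable g) :
    Measurable fun p => baxterE (f p) (g p) := by
  unfold RankinSelberg.baxterE
  fun_prop

theorem exp_two_mul_half_log_sub {A B : ℝ} (hA : 0 < A) (hB : 0 < B) (x : ℝ) :
    Real.exp (2 * ((Real.log B - Real.log A) / 2 - x)) = B / A * Real.exp (-(2 * x)) := by
  rw [show 2 * ((Real.log B - Real.log A) / 2 - x) = Real.log B - Real.log A + -(2 * x) by ring,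
    Real.exp_add, Real.exp_sub, Real.exp_log hA, Real.exp_log hB]

/-- The substitution behind the commutation of the Baxter operators with the kernels that raise
the rank. -/
theorem exists_exchange {m : ℕ} (w : Fin (m + 2) → ℝ) (v : Fin (m + 1) → ℝ) :
    ∃ (c₀ : ℝ) (c : Fin (m + 1) → ℝ), c₀ + ∑ j, c j = ∑ j, w j + ∑ j, v j ∧
      ∀ z : Fin (m + 2) → ℝ, baxterE z w + todaE z v = Real.exp (2 * (z 0 - c₀)) +
        (todaE w (c - fun i => z i.succ) + baxterE v (c - fun i => z i.succ)) := by
  -- In both exponents a variable `u` at place `j` enters only through `e^{2u} A_j + e^{-2u} B_j`,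
  -- with the same `A` and `B`. The reflection `u = c_j - z_{j+1}` with `e^{2 c_j} = B_j / A_j`
  -- exchanges the two terms.
  let α : Fin (m + 1) → ℝ :=
    fun j => Real.log (Real.exp (-(2 * w j.castSucc)) + Real.exp (-(2 * v j))) / 2
  -- The appended `0` records that the last variable has no further neighbour among the `v`.
  let A : Fin (m + 1) → ℝ := fun j => Real.exp (-(2 * w j.succ)) +
    (Fin.snoc (fun i : Fin m => Real.exp (-(2 * v i.succ))) 0 : Fin (m + 1) → ℝ) j
  let B : Fin (m + 1) → ℝ := fun j => Real.exp (2 * w j.castSucc) + Real.exp (2 * v j)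
  have hAc : ∀ i : Fin m, A i.castSucc = Real.exp (-(2 * w i.castSucc.succ)) +
      Real.exp (-(2 * v i.succ)) := fun i => by simp [A]
  have hAl : A (Fin.last m) = Real.exp (-(2 * w (Fin.last (m + 1)))) := by simp [A]
  have hA : ∀ j, 0 < A j := fun j => by
    refine Fin.lastCases ?_ (fun i => ?_) j
    · rw [hAl]; positivity
    · rw [hAc]; positivity
  have hB : ∀ j, 0 < B j := fun j => by positivity
  -- Since `log (A j) / 2` is `α (j + 1)` below the last index, the sum of the `c_j` telescopes and
  -- leaves `α 0`, which `c₀ = -α 0` cancels.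
  have hlogB : ∀ j, Real.log (B j) / 2 = α j + w j.castSucc + v j := fun j => by
    have : B j = (Real.exp (-(2 * w j.castSucc)) + Real.exp (-(2 * v j))) *
        Real.exp (2 * w j.castSucc + 2 * v j) := by
      simp only [B, add_mul, ← Real.exp_add]
      rw [add_comm]
      congr 2 <;> ring
    rw [this, Real.log_mul (by positivity) (by positivity), Real.log_exp]
    simp only [α]; ring
  refine ⟨-α 0, fun j => (Real.log (B j) - Real.log (A j)) / 2, ?_, fun z => ?_⟩
  · have h1 : ∑ j, Real.log (A j) / 2 = ∑ i : Fin m, α i.succ - w (Fin.last (m + 1)) := by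
      rw [Fin.sum_univ_castSucc, hAl, Real.log_exp]
      simp only [hAc, α, Fin.castSucc_succ]
      ring
    simp only [sub_div, Finset.sum_sub_distrib, h1, hlogB, Finset.sum_add_distrib]
    rw [Fin.sum_univ_succ α, Fin.sum_univ_castSucc w]
    ring
  · have e0 : Real.exp (2 * (z 0 - -α 0)) =
        Real.exp (2 * (z 0 - w 0)) + Real.exp (2 * (z 0 - v 0)) := by
      rw [show 2 * (z 0 - -α 0) = 2 * z 0 + 2 * α 0 by ring, Real.exp_add]
      simp only [α, mul_div_cancel₀ _ (two_ne_zero' ℝ)]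
      rw [Real.exp_log (by positivity), mul_add, ← Real.exp_add, ← Real.exp_add]
      simp only [Fin.castSucc_zero]
      ring_nf
    have e1 : ∀ j, Real.exp (2 * ((Real.log (B j) - Real.log (A j)) / 2 - z j.succ)) * A j =
        B j * Real.exp (-(2 * z j.succ)) := fun j => by
      rw [exp_two_mul_half_log_sub (hA j) (hB j)]; have := (hA j).ne'; field_simp
    have e2 : ∀ j, Real.exp (-(2 * ((Real.log (B j) - Real.log (A j)) / 2 - z j.succ))) * B j =
        A j * Real.exp (2 * z j.succ) := fun j => by
      rw [Real.exp_neg, exp_two_mul_half_log_sub (hA j) (hB j), Real.exp_neg]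
      have := (hA j).ne'; have := (hB j).ne'; field_simp
    have hr : ∀ u : Fin (m + 1) → ℝ, todaE w u + baxterE v u =
        ∑ j, (Real.exp (2 * u j) * A j + Real.exp (-(2 * u j)) * B j) := fun u => by
      have h2 : ∑ i : Fin m, Real.exp (2 * (u i.castSucc - v i.succ)) =
          ∑ j, Real.exp (2 * u j) *
            (Fin.snoc (fun i : Fin m => Real.exp (-(2 * v i.succ))) 0 : Fin (m + 1) → ℝ) j := by
        rw [Fin.sum_univ_castSucc (n := m)]
        simp only [Fin.snoc_castSucc, Fin.snoc_last, mul_zero, add_zero, ← Real.exp_add]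
        refine Finset.sum_congr rfl fun i _ => by ring_nf
      rw [todaE, baxterE, h2, ← Finset.sum_add_distrib, ← Finset.sum_add_distrib]
      refine Finset.sum_congr rfl fun j _ => ?_
      simp only [A, B, mul_add, ← Real.exp_add]
      ring_nf
    have hl : baxterE z w + todaE z v = Real.exp (2 * (z 0 - w 0)) + Real.exp (2 * (z 0 - v 0)) +
        ∑ j : Fin (m + 1), (Real.exp (2 * z j.succ) * A j + Real.exp (-(2 * z j.succ)) * B j) := by
      have h2 : ∑ i : Fin m, Real.exp (2 * (z i.castSucc.succ - v i.succ)) =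
          ∑ j : Fin (m + 1), Real.exp (2 * z j.succ) *
            (Fin.snoc (fun i : Fin m => Real.exp (-(2 * v i.succ))) 0 : Fin (m + 1) → ℝ) j := by
        rw [Fin.sum_univ_castSucc (n := m)]
        simp only [Fin.snoc_castSucc, Fin.snoc_last, mul_zero, add_zero, ← Real.exp_add]
        refine Finset.sum_congr rfl fun i _ => by ring_nf
      have h3 : ∑ j : Fin (m + 1), (Real.exp (2 * z j.succ) * A j +
          Real.exp (-(2 * z j.succ)) * B j) =
          ∑ j : Fin (m + 1), Real.exp (2 * (z j.succ - w j.succ)) +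
          ∑ i : Fin m, Real.exp (2 * (z i.castSucc.succ - v i.succ)) +
          (∑ j : Fin (m + 1), Real.exp (2 * (w j.castSucc - z j.succ)) +
            ∑ j : Fin (m + 1), Real.exp (2 * (v j - z j.succ))) := by
        rw [h2, ← Finset.sum_add_distrib, ← Finset.sum_add_distrib, ← Finset.sum_add_distrib]
        refine Finset.sum_congr rfl fun j _ => ?_
        simp only [A, B, mul_add, ← Real.exp_add]
        ring_nf
      rw [h3, baxterE, todaE, Finset.sum_add_distrib, Fin.sum_univ_succ,
        Fin.sum_univ_succ (fun j : Fin (m + 1) => Real.exp (2 * (z j.castSucc - v j)))]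
      simp only [Fin.castSucc_zero, Fin.castSucc_succ]
      ring
    rw [hl, hr, e0]
    congr 1
    refine Finset.sum_congr rfl fun j _ => ?_
    simp only [Pi.sub_apply, e1, e2]
    ring

/-! ### The positive majorants of the Whittaker functions -/

/-- The real exponential with values in `ℝ≥0∞`. -/
def eexp (t : ℝ) : ENNReal := ENNReal.ofReal (Real.exp t)

theorem eexp_add (s t : ℝ) : eexp (s + t) = eexp s * eexp t := by
  rw [eexp, Real.exp_add, ENNReal.ofReal_mul (Real.exp_pos s).le, eexp, eexp]

@[simp] theorem eexp_zero : eexp 0 = 1 := by simp [eexp]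

theorem eexp_ne_top (t : ℝ) : eexp t ≠ ⊤ := ENNReal.ofReal_ne_top

theorem measurable_eexp : Measurable eexp := by unfold eexp; fun_prop

@[fun_prop]
theorem measurable_eexp_comp {α : Type*} [MeasurableSpace α] {f : α → ℝ} (hf : Measurable f) :
    Measurable fun x => eexp (f x) := measurable_eexp.comp hf

theorem enorm_cexp (z : ℂ) : ‖Complex.exp z‖ₑ = eexp z.re := by
  rw [← ofReal_norm, Complex.norm_exp, eexp]

/-- `lwhit n a x` majorizes the Whittaker function on `GL_n(ℝ)`, in logarithmic coordinates. -/
def lwhit : (n : ℕ) → (Fin n → ℝ) → (Fin n → ℝ) → ENNReal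
  | 0, _, _ => 1
  | n + 1, a, x => 2 ^ n * ∫⁻ w : Fin n → ℝ,
      eexp (-Real.pi * todaE x w + a 0 * (∑ i, x i - ∑ i, w i)) *
        lwhit n (fun i => a i.succ) w

@[fun_prop]
theorem measurable_lwhit : ∀ (n : ℕ) (a : Fin n → ℝ), Measurable (lwhit n a)
  | 0, _ => measurable_const
  | n + 1, a => by
    have := measurable_lwhit n (fun i => a i.succ)
    change Measurable fun x => lwhit (n + 1) a x
    simp only [lwhit]
    refine Measurable.const_mul ?_ (2 ^ n)
    exact Measurable.lintegral_prod_right' (f := fun p : (Fin (n + 1) → ℝ) × (Fin n → ℝ) =>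
      eexp (-Real.pi * todaE p.1 p.2 + a 0 * (∑ i, p.1 i - ∑ i, p.2 i)) *
        lwhit n (fun i => a i.succ) p.2) (by fun_prop)

/-- The `ℝ≥0∞`-valued form of the integral defining `Γ_ℝ`. -/
def lgamma (μ : ℝ) : ENNReal := 2 * ∫⁻ x : ℝ, eexp (-Real.pi * Real.exp (2 * x) + μ * x)

theorem two_mul_lintegral_eexp_shift (μ c : ℝ) :
    2 * ∫⁻ x : ℝ, eexp (-Real.pi * Real.exp (2 * (x - c)) + μ * x) = lgamma μ * eexp (μ * c) := by
  rw [← lintegral_add_right_eq_self _ c, lgamma, mul_assoc,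
    ← lintegral_mul_const _ (by fun_prop)]
  congr 1
  refine lintegral_congr fun x => ?_
  rw [← eexp_add]; congr 1; ring_nf

/-- The coordinate `z 0` separates and integrates to the gamma factor times `e^{μ c₀}`; the others
are reflected, which preserves Lebesgue measure. The relation `c₀ + ∑ c = ∑ w + ∑ v` then gives the
linear term on the right. -/
theorem lintegral_exchange {m : ℕ} (w : Fin (m + 2) → ℝ) (v : Fin (m + 1) → ℝ) (μ : ℝ) :
    2 * ∫⁻ z, eexp (-Real.pi * (baxterE z w + todaE z v) + μ * ∑ i, z i) =
      lgamma μ * ∫⁻ u, eexp (-Real.pi * (todaE w u + baxterE v u) +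
        μ * (∑ i, w i + ∑ i, v i - ∑ i, u i)) := by
  obtain ⟨c₀, c, hc, h⟩ := exists_exchange w v
  have h1 : ∀ z : Fin (m + 2) → ℝ, eexp (-Real.pi * (baxterE z w + todaE z v) + μ * ∑ i, z i) =
      eexp (-Real.pi * Real.exp (2 * (z 0 - c₀)) + μ * z 0) *
        (fun y : Fin (m + 1) → ℝ => eexp (-Real.pi * (todaE w (c - y) + baxterE v (c - y)) +
          μ * ∑ i, y i)) (fun i => z i.succ) := fun z => by
    rw [h z, ← eexp_add, Fin.sum_univ_succ]
    congr 1; ring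
  rw [lintegral_congr h1, lintegral_head_mul_tail
    (f := fun x => eexp (-Real.pi * Real.exp (2 * (x - c₀)) + μ * x))
    (g := fun y : Fin (m + 1) → ℝ => eexp (-Real.pi * (todaE w (c - y) + baxterE v (c - y)) +
      μ * ∑ i, y i))
    (by fun_prop) (by fun_prop), ← mul_assoc, two_mul_lintegral_eexp_shift, mul_assoc,
    ← lintegral_const_mul _ (by fun_prop), ← lintegral_const_sub c]
  congr 1
  refine lintegral_congr fun u => ?_
  rw [← eexp_add, ← hc]
  congr 1
  simp only [sub_sub_cancel, Pi.sub_apply, Finset.sum_sub_distrib]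
  ring

theorem volume_univ_fin_zero : volume (Set.univ : Set (Fin 0 → ℝ)) = 1 := by
  simp [volume_pi]

theorem lwhit_one (a x : Fin 1 → ℝ) : lwhit 1 a x = eexp (a 0 * x 0) := by
  simp [lwhit, todaE, volume_univ_fin_zero]

/-- The majorants of the Whittaker functions are eigenfunctions of the Baxter operators. -/
theorem lintegral_baxter : ∀ (m : ℕ) (a : Fin (m + 1) → ℝ) (l : ℝ) (w : Fin (m + 1) → ℝ),
    2 ^ (m + 1) * ∫⁻ z, eexp (-Real.pi * baxterE z w + l * (∑ i, z i - ∑ i, w i)) *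
      lwhit (m + 1) a z = (∏ j, lgamma (l + a j)) * lwhit (m + 1) a w
  | 0, a, l, w => by
    have hb : ∀ x, lwhit (0 + 1) a x = eexp (a 0 * x 0) := lwhit_one a
    simp only [hb, baxterE]
    have h : ∀ z : Fin 1 → ℝ, eexp (-Real.pi * (∑ j, Real.exp (2 * (z j - w j)) +
        ∑ j : Fin 0, Real.exp (2 * (w j.castSucc - z j.succ))) + l * (∑ i, z i - ∑ i, w i)) *
        eexp (a 0 * z 0) = eexp (-Real.pi * Real.exp (2 * (z 0 - w 0)) + (l + a 0) * z 0) *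
          (fun _ => eexp (-l * w 0)) (fun i : Fin 0 => z i.succ) := fun z => by
      rw [← eexp_add, ← eexp_add]; congr 1; simp; ring
    rw [lintegral_congr h, lintegral_head_mul_tail
      (f := fun x => eexp (-Real.pi * Real.exp (2 * (x - w 0)) + (l + a 0) * x))
      (g := fun _ => eexp (-l * w 0))
      (by fun_prop) (by fun_prop), pow_one, ← mul_assoc, two_mul_lintegral_eexp_shift]
    simp only [lintegral_const, volume_univ_fin_zero, mul_one, mul_assoc, ← eexp_add]
    congr 1
    · simp
    · congr 1; ring
  | m + 1, a, l, w => by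
    -- Unfolding one level of the recursion collects `∑ z` under the single parameter `l + a 0`,
    -- ready for `lintegral_exchange`.
    have e1 : ∀ z, eexp (-Real.pi * baxterE z w + l * (∑ i, z i - ∑ i, w i)) *
        lwhit (m + 2) a z = 2 ^ (m + 1) * ∫⁻ v,
          eexp (-Real.pi * (baxterE z w + todaE z v) + (l + a 0) * ∑ i, z i) *
          (eexp (-l * ∑ i, w i - a 0 * ∑ i, v i) * lwhit (m + 1) (fun i => a i.succ) v) := by
      intro z
      rw [lwhit, mul_left_comm, ← lintegral_const_mul _ (by fun_prop)]
      congr 1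
      refine lintegral_congr fun v => ?_
      rw [← mul_assoc, ← mul_assoc, ← eexp_add, ← eexp_add]
      congr 2; ring
    have e2 : ∀ v, 2 * ∫⁻ z, eexp (-Real.pi * (baxterE z w + todaE z v) + (l + a 0) * ∑ i, z i) *
          (eexp (-l * ∑ i, w i - a 0 * ∑ i, v i) * lwhit (m + 1) (fun i => a i.succ) v) =
        lgamma (l + a 0) * ∫⁻ u, eexp (-Real.pi * todaE w u + a 0 * (∑ i, w i - ∑ i, u i)) *
          (eexp (-Real.pi * baxterE v u + l * (∑ i, v i - ∑ i, u i)) *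
            lwhit (m + 1) (fun i => a i.succ) v) := by
      intro v
      rw [lintegral_mul_const _ (by fun_prop), ← mul_assoc, lintegral_exchange, mul_assoc,
        ← lintegral_mul_const _ (by fun_prop)]
      congr 1
      refine lintegral_congr fun u => ?_
      rw [← mul_assoc, ← mul_assoc, ← eexp_add, ← eexp_add]
      congr 2; ring
    calc _ = 2 ^ (m + 1) * (2 ^ (m + 1) * ∫⁻ v, 2 * ∫⁻ z,
          eexp (-Real.pi * (baxterE z w + todaE z v) + (l + a 0) * ∑ i, z i) *
          (eexp (-l * ∑ i, w i - a 0 * ∑ i, v i) *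
            lwhit (m + 1) (fun i => a i.succ) v)) := by
          simp only [e1]
          rw [lintegral_const_mul _ (Measurable.lintegral_prod_right' (f := fun p :
              (Fin (m + 2) → ℝ) × (Fin (m + 1) → ℝ) => eexp (-Real.pi * (baxterE p.1 w +
              todaE p.1 p.2) + (l + a 0) * ∑ i, p.1 i) * (eexp (-l * ∑ i, w i - a 0 * ∑ i, p.2 i) *
                lwhit (m + 1) (fun i => a i.succ) p.2)) (by fun_prop)),
            lintegral_lintegral_swap (by fun_prop), lintegral_const_mul' _ _ (by simp)]
          ring
      _ = lgamma (l + a 0) * (2 ^ (m + 1) * ∫⁻ u,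
          eexp (-Real.pi * todaE w u + a 0 * (∑ i, w i - ∑ i, u i)) * (2 ^ (m + 1) * ∫⁻ v,
          eexp (-Real.pi * baxterE v u + l * (∑ i, v i - ∑ i, u i)) *
            lwhit (m + 1) (fun i => a i.succ) v)) := by
          simp only [e2]
          rw [lintegral_const_mul _ (Measurable.lintegral_prod_right' (f := fun p :
              (Fin (m + 1) → ℝ) × (Fin (m + 1) → ℝ) => eexp (-Real.pi * todaE w p.2 +
              a 0 * (∑ i, w i - ∑ i, p.2 i)) * (eexp (-Real.pi * baxterE p.1 p.2 +
              l * (∑ i, p.1 i - ∑ i, p.2 i)) * lwhit (m + 1) (fun i => a i.succ) p.1))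
              (by fun_prop)),
            lintegral_lintegral_swap (by fun_prop), mul_left_comm _ (lgamma _),
            mul_left_comm _ (lgamma _), ← lintegral_const_mul' _ _ (by simp)]
          congr 2
          refine lintegral_congr fun u => ?_
          dsimp only
          rw [lintegral_const_mul _ (by fun_prop), mul_left_comm]
      -- The integral over `v` is now the Baxter operator of one rank less, evaluated at `u`; after
      -- the induction hypothesis the integral over `u` is the recursion for the full rank.
      _ = _ := by
          simp only [lintegral_baxter m (fun i => a i.succ) l,
            mul_left_comm _ (∏ j : Fin (m + 1), lgamma (l + a j.succ))]
          rw [lintegral_const_mul _ (by fun_prop), Fin.prod_univ_succ (fun j => lgamma (l + a j)),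
            lwhit]
          ring

/-- With `Y = e^{2y}`, `e^{-πY} ≤ e^{-Y} ≤ k! / Y^k`. This trades double exponential decay for a
linear exponent of any chosen slope. -/
theorem eexp_neg_pi_exp_le (k : ℕ) (y : ℝ) :
    eexp (-Real.pi * Real.exp (2 * y)) ≤ (k.factorial : ENNReal) * eexp (-(2 * k * y)) := by
  have h : Real.exp (-Real.pi * Real.exp (2 * y)) ≤ k.factorial * Real.exp (-(2 * k * y)) := by
    have h1 := Real.pow_div_factorial_le_exp _ (Real.exp_pos (2 * y)).le k
    rw [← Real.exp_nat_mul, div_le_iff₀ (by positivity)] at h1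
    have h2 : Real.exp (-Real.pi * Real.exp (2 * y)) ≤ Real.exp (-Real.exp (2 * y)) := by
      apply Real.exp_le_exp.mpr
      have := Real.exp_pos (2 * y); have := Real.pi_gt_three
      nlinarith
    refine h2.trans ?_
    rw [Real.exp_neg, Real.exp_neg, inv_le_iff_one_le_mul₀ (by positivity), mul_right_comm,
      ← div_eq_mul_inv, le_div_iff₀ (by positivity), one_mul]
    convert h1 using 1
    · congr 1; ring
    · ring
  rw [eexp, eexp, ← ENNReal.ofReal_natCast, ← ENNReal.ofReal_mul (by positivity)]
  exact ENNReal.ofReal_le_ofReal h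

/-- Euler's integral for `Γ(μ/2)` under `t = π e^{2x}`; from `dt/t = 2 dx` comes the factor `2`,
from `t^{μ/2}` the power of `π`. -/
theorem gamma_integral {μ : ℂ} (hμ : 0 < μ.re) :
    Integrable (fun x : ℝ => Complex.exp (-Real.pi * Real.exp (2 * x) + μ * x)) ∧
      2 * ∫ x : ℝ, Complex.exp (-Real.pi * Real.exp (2 * x) + μ * x) = Complex.Gammaℝ μ := by
  let f : ℝ → ℝ := fun x => Real.pi * Real.exp (2 * x)
  let f' : ℝ → ℝ := fun x => Real.pi * (Real.exp (2 * x) * 2)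
  let g : ℝ → ℂ := fun t => ((-t).exp : ℂ) * (t : ℂ) ^ (μ / 2 - 1)
  have hf : ∀ x ∈ Set.univ, HasDerivWithinAt f (f' x) Set.univ x := fun x _ => by
    refine HasDerivAt.hasDerivWithinAt ?_
    have := ((hasDerivAt_id x).const_mul 2).exp.const_mul Real.pi
    simpa [f, f'] using this
  have hinj : Set.InjOn f Set.univ := fun x _ y _ h => by
    have := Real.exp_injective (mul_left_cancel₀ Real.pi_ne_zero h)
    linarith
  have himg : f '' Set.univ = Set.Ioi 0 := by
    ext t
    simp only [Set.mem_image, Set.mem_univ, true_and, Set.mem_Ioi]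
    refine ⟨fun ⟨x, hx⟩ => hx ▸ by positivity, fun ht => ⟨Real.log (t / Real.pi) / 2, ?_⟩⟩
    simp only [f]
    rw [mul_div_cancel₀ _ two_ne_zero, Real.exp_log (by positivity)]
    field_simp
  have hg : ∀ x, |f' x| • g (f x) = 2 * (Real.pi : ℂ) ^ (μ / 2) *
      Complex.exp (-Real.pi * Real.exp (2 * x) + μ * x) := fun x => by
    have h1 : ((f x : ℝ) : ℂ) ≠ 0 := by exact_mod_cast (by positivity : (0 : ℝ) < f x).ne'
    have h2 : ((f x : ℝ) : ℂ) ^ (μ / 2) = (Real.pi : ℂ) ^ (μ / 2) * Complex.exp (μ * x) := by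
      simp only [f]
      rw [Complex.ofReal_mul, Complex.mul_cpow_ofReal_nonneg Real.pi_pos.le (Real.exp_pos _).le]
      congr 1
      rw [Complex.cpow_def_of_ne_zero (by simp [Complex.exp_ne_zero]), ← Complex.ofReal_log
        (Real.exp_pos _).le, Real.log_exp]
      congr 1; push_cast; ring
    have h3 : |f' x| = 2 * f x := by
      rw [abs_of_pos (by positivity)]; simp only [f, f']; ring
    rw [h3, Complex.real_smul]
    simp only [g]
    rw [Complex.cpow_sub _ _ h1, Complex.cpow_one, h2, Complex.exp_add]
    push_cast
    field_simp
    simp [f]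
  have hconst : 2 * (Real.pi : ℂ) ^ (μ / 2) ≠ 0 := by
    simp [Complex.cpow_eq_zero_iff, Real.pi_ne_zero]
  have hre : 0 < (μ / 2).re := by simpa using hμ
  have hG : IntegrableOn g (Set.Ioi 0) := Complex.GammaIntegral_convergent hre
  constructor
  · rw [← himg, integrableOn_image_iff_integrableOn_abs_deriv_smul MeasurableSet.univ hf hinj,
      integrableOn_univ] at hG
    simp only [hg] at hG
    refine (hG.const_mul (2 * (Real.pi : ℂ) ^ (μ / 2))⁻¹).congr ?_
    filter_upwards with x
    rw [inv_mul_cancel_left₀ hconst]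
  · have h := integral_image_eq_integral_abs_deriv_smul MeasurableSet.univ hf hinj g
    rw [himg, Measure.restrict_univ] at h
    simp only [hg] at h
    rw [integral_const_mul] at h
    rw [Complex.Gammaℝ, Complex.Gamma_eq_integral hre, Complex.GammaIntegral, h, neg_div,
      Complex.cpow_neg]
    have := (mul_ne_zero_iff.mp hconst).2
    field_simp

theorem ne_top_of_mul_ne_top {c x : ENNReal} (hc : c ≠ 0) (h : c * x ≠ ⊤) : x ≠ ⊤ :=
  fun hx => h (by rw [hx, ENNReal.mul_top hc])

theorem lgamma_ne_top {μ : ℝ} (hμ : 0 < μ) : lgamma μ ≠ ⊤ := by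
  have h := (gamma_integral (μ := μ) (by simpa using hμ)).1.2
  rw [HasFiniteIntegral] at h
  refine ENNReal.mul_ne_top (by simp) (ne_of_lt (lt_of_le_of_lt (le_of_eq ?_) h))
  refine lintegral_congr fun x => ?_
  rw [enorm_cexp]
  rw [← Complex.ofReal_re (-Real.pi * Real.exp (2 * x) + μ * x)]
  congr 2
  push_cast; rfl

theorem eexp_sum {ι : Type*} (s : Finset ι) (f : ι → ℝ) :
    eexp (∑ i ∈ s, f i) = ∏ i ∈ s, eexp (f i) := by
  rw [eexp, Real.exp_sum, ENNReal.ofReal_prod_of_nonneg fun i _ => (Real.exp_pos _).le]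
  rfl

theorem lintegral_pi_gamma_ne_top : ∀ {n : ℕ} {q : Fin n → ℝ}, (∀ i, 0 < q i) →
    ∫⁻ w : Fin n → ℝ, eexp (-Real.pi * ∑ i, Real.exp (2 * w i) + ∑ i, q i * w i) ≠ ⊤
  | 0, _, _ => by simp [volume_univ_fin_zero]
  | n + 1, q, hq => by
    have h : ∀ w : Fin (n + 1) → ℝ,
        eexp (-Real.pi * ∑ i, Real.exp (2 * w i) + ∑ i, q i * w i) =
        eexp (-Real.pi * Real.exp (2 * w 0) + q 0 * w 0) *
          eexp (-Real.pi * ∑ i : Fin n, Real.exp (2 * w i.succ) +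
            ∑ i : Fin n, q i.succ * w i.succ) := fun w => by
      rw [← eexp_add, Fin.sum_univ_succ, Fin.sum_univ_succ]; congr 1; ring
    rw [lintegral_congr h, lintegral_head_mul_tail
      (f := fun x => eexp (-Real.pi * Real.exp (2 * x) + q 0 * x))
      (g := fun w => eexp (-Real.pi * ∑ i : Fin n, Real.exp (2 * w i) +
            ∑ i : Fin n, q i.succ * w i)) (by fun_prop) (by fun_prop)]
    have h0 := lgamma_ne_top (hq 0)
    rw [lgamma] at h0
    exact ENNReal.mul_ne_top (ne_top_of_mul_ne_top (by simp) h0)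
      (lintegral_pi_gamma_ne_top fun i => hq i.succ)

/-- In each kernel the factors with `e^{2(x_j - w_j)}` are replaced by linear exponents of slope
`2k`. Together with the inductive bound this leaves a product of gamma integrals in `w`, centred at
the coordinates `x_{j+1}`. -/
theorem exists_lwhit_le : ∀ (n : ℕ) (a : Fin n → ℝ), ∃ (C : ENNReal) (p : Fin n → ℝ), C ≠ ⊤ ∧
    ∀ x, lwhit n a x ≤ C * eexp (∑ i, p i * x i)
  | 0, _ => ⟨1, fun _ => 0, by simp, fun _ => by simp [lwhit]⟩
  | n + 1, a => by
    obtain ⟨C, p, hC, h⟩ := exists_lwhit_le n (fun i => a i.succ)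
    -- `q i` is the total linear coefficient of `w i` after the replacement; this size of `k` makes
    -- it positive, as the gamma integrals require.
    obtain ⟨k, hk⟩ := exists_nat_gt (|a 0| + ∑ i, |p i|)
    let q : Fin n → ℝ := fun i => 2 * k - a 0 + p i
    have hq : ∀ i, 0 < q i := fun i => by
      have h1 : |p i| ≤ ∑ i, |p i| :=
        Finset.single_le_sum (f := fun i => |p i|) (fun _ _ => abs_nonneg _) (Finset.mem_univ i)
      have h2 := le_abs_self (a 0)
      have h3 := neg_abs_le (p i)
      have h4 : (0 : ℝ) ≤ k := k.cast_nonneg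
      simp only [q]; linarith
    let D := ∫⁻ w : Fin n → ℝ, eexp (-Real.pi * ∑ i, Real.exp (2 * w i) + ∑ i, q i * w i)
    have hD : D ≠ ⊤ := lintegral_pi_gamma_ne_top hq
    -- The exponent of `x i` has three sources: `a 0` from the linear term, `-2k` from the replaced
    -- factor (absent for the last index), and `q` from translating `w` by `x ∘ succ` (absent for
    -- the first).
    refine ⟨2 ^ n * (k.factorial ^ n * C * D), fun i => a 0 +
      (Fin.snoc (fun _ => -(2 * k)) 0 : Fin (n + 1) → ℝ) i + (Fin.cons 0 q : Fin (n + 1) → ℝ) i,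
      by finiteness, fun x => ?_⟩
    have hp : ∑ i, (a 0 + (Fin.snoc (fun _ => -(2 * (k : ℝ))) 0 : Fin (n + 1) → ℝ) i +
        (Fin.cons 0 q : Fin (n + 1) → ℝ) i) * x i =
        a 0 * ∑ i, x i - 2 * k * ∑ i : Fin n, x i.castSucc + ∑ i, q i * x i.succ := by
      simp only [add_mul, Finset.sum_add_distrib]
      rw [Fin.sum_univ_castSucc (fun i =>
        (Fin.snoc (fun _ => -(2 * (k : ℝ))) 0 : Fin (n + 1) → ℝ) i * x i),
        Fin.sum_univ_succ (fun i => (Fin.cons 0 q : Fin (n + 1) → ℝ) i * x i)]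
      simp [Finset.mul_sum, sub_eq_add_neg]
    rw [lwhit, mul_assoc, hp]
    gcongr
    have hb : ∀ w : Fin n → ℝ, eexp (-Real.pi * todaE x w + a 0 * (∑ i, x i - ∑ i, w i)) *
        lwhit n (fun i => a i.succ) w ≤ k.factorial ^ n * C *
        eexp (a 0 * ∑ i, x i - 2 * k * ∑ i : Fin n, x i.castSucc) *
        eexp (-Real.pi * ∑ i, Real.exp (2 * (w i - x i.succ)) + ∑ i, q i * w i) := fun w => by
      have h1 : eexp (-Real.pi * ∑ i : Fin n, Real.exp (2 * (x i.castSucc - w i))) ≤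
          k.factorial ^ n * eexp (∑ i, -(2 * k * (x i.castSucc - w i))) := by
        rw [Finset.mul_sum, eexp_sum, eexp_sum, ← Fin.prod_const, ← Finset.prod_mul_distrib]
        exact Finset.prod_le_prod' fun i _ => eexp_neg_pi_exp_le k _
      have e1 : -Real.pi * todaE x w + a 0 * (∑ i, x i - ∑ i, w i) =
          -Real.pi * ∑ i : Fin n, Real.exp (2 * (x i.castSucc - w i)) +
          (-Real.pi * ∑ i, Real.exp (2 * (w i - x i.succ)) +
            a 0 * (∑ i, x i - ∑ i, w i)) := by
        rw [todaE, Finset.sum_add_distrib]; ring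
      rw [e1, eexp_add]
      refine (mul_le_mul' (mul_le_mul_left h1 _) (h w)).trans (le_of_eq ?_)
      have e2 : ∑ i, -(2 * k * (x i.castSucc - w i)) +
          (-Real.pi * ∑ i, Real.exp (2 * (w i - x i.succ)) + a 0 * (∑ i, x i - ∑ i, w i)) +
          ∑ i, p i * w i = a 0 * ∑ i, x i - 2 * k * ∑ i : Fin n, x i.castSucc +
          (-Real.pi * ∑ i, Real.exp (2 * (w i - x i.succ)) + ∑ i, q i * w i) := by
        simp only [q, add_mul, sub_mul, Finset.sum_add_distrib, Finset.sum_sub_distrib,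
          Finset.sum_neg_distrib, ← Finset.mul_sum]
        ring
      calc _ = k.factorial ^ n * C * (eexp (∑ i, -(2 * k * (x i.castSucc - w i))) *
          eexp (-Real.pi * ∑ i, Real.exp (2 * (w i - x i.succ)) + a 0 * (∑ i, x i - ∑ i, w i)) *
          eexp (∑ i, p i * w i)) := by ring
        _ = _ := by rw [← eexp_add, ← eexp_add, e2, eexp_add]; ring
    refine (lintegral_mono hb).trans (le_of_eq ?_)
    rw [lintegral_const_mul _ (by fun_prop),
      ← lintegral_add_right_eq_self _ (fun i : Fin n => x i.succ)]
    have hs : ∀ w : Fin n → ℝ, eexp (-Real.pi * ∑ i : Fin n, Real.exp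
        (2 * ((w + fun i : Fin n => x i.succ) i - x i.succ)) +
        ∑ i, q i * (w + fun i : Fin n => x i.succ) i) =
        eexp (-Real.pi * ∑ i, Real.exp (2 * w i) + ∑ i, q i * w i) *
          eexp (∑ i, q i * x i.succ) := fun w => by
      rw [← eexp_add]
      simp only [Pi.add_apply, add_sub_cancel_right, mul_add, Finset.sum_add_distrib]
      congr 1; ring
    rw [lintegral_congr hs, lintegral_mul_const _ (by fun_prop), eexp_add]
    ring

theorem lwhit_ne_top (n : ℕ) (a x : Fin n → ℝ) : lwhit n a x ≠ ⊤ := by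
  obtain ⟨C, p, hC, h⟩ := exists_lwhit_le n a
  exact ne_top_of_le_ne_top (ENNReal.mul_ne_top hC (eexp_ne_top _)) (h x)

/-! ### Whittaker functions in logarithmic coordinates -/

/-- The Whittaker function on `GL_n(ℝ)` in logarithmic coordinates `x_i = log t_i` on the torus,
by recursion on the rank. -/
def whit : (n : ℕ) → (Fin n → ℂ) → (Fin n → ℝ) → ℂ
  | 0, _, _ => 1
  | n + 1, a, x => 2 ^ n * ∫ w : Fin n → ℝ,
      Complex.exp (-Real.pi * (todaE x w : ℝ) + a 0 * (∑ i, x i - ∑ i, w i : ℝ)) *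
        whit n (fun i => a i.succ) w

theorem measurable_integral_of_measurable {α β : Type*} [MeasurableSpace α] [MeasurableSpace β]
    {ν : Measure β} [SFinite ν] {f : α × β → ℂ} (hf : Measurable f) :
    Measurable fun x => ∫ y, f (x, y) ∂ν :=
  (StronglyMeasurable.integral_prod_right (f := fun x y => f (x, y))
    hf.stronglyMeasurable).measurable

@[fun_prop]
theorem measurable_whit : ∀ (n : ℕ) (a : Fin n → ℂ), Measurable (whit n a)
  | 0, _ => measurable_const
  | n + 1, a => by
    have := measurable_whit n (fun i => a i.succ)
    change Measurable fun x => whit (n + 1) a x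
    simp only [whit]
    refine Measurable.const_mul ?_ (2 ^ n)
    exact measurable_integral_of_measurable (f := fun p : (Fin (n + 1) → ℝ) × (Fin n → ℝ) =>
      Complex.exp (-Real.pi * (todaE p.1 p.2 : ℝ) + a 0 * (∑ i, p.1 i - ∑ i, p.2 i : ℝ)) *
        whit n (fun i => a i.succ) p.2) (by fun_prop)

theorem enorm_cexp_kernel (t r : ℝ) (μ : ℂ) :
    ‖Complex.exp (-Real.pi * (t : ℝ) + μ * (r : ℝ))‖ₑ = eexp (-Real.pi * t + μ.re * r) := by
  rw [enorm_cexp]; congr 1; simp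

theorem enorm_two_pow (n : ℕ) : ‖(2 : ℂ) ^ n‖ₑ = 2 ^ n := by
  rw [enorm_pow]
  congr 1
  rw [← ofReal_norm, Complex.norm_two]; simp

theorem enorm_whit_le : ∀ (n : ℕ) (a : Fin n → ℂ) (x : Fin n → ℝ),
    ‖whit n a x‖ₑ ≤ lwhit n (fun i => (a i).re) x
  | 0, _, _ => by simp [whit, lwhit]
  | n + 1, a, x => by
    rw [whit, lwhit, enorm_mul, enorm_two_pow]
    gcongr
    refine (enorm_integral_le_lintegral_enorm _).trans (lintegral_mono fun w => ?_)
    rw [enorm_mul, enorm_cexp_kernel]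
    gcongr
    exact enorm_whit_le n _ w

/-- The form in which Fubini is justified throughout: the iterated integral of a majorant is known
from an identity between integrals in `ℝ≥0∞`. -/
theorem integrable_prod_of_lintegral_ne_top {α β : Type*} [MeasurableSpace α] [MeasurableSpace β]
    {μ : Measure α} {ν : Measure β} [SFinite μ] [SFinite ν] {f : α → β → ℂ}
    {g : α → β → ENNReal} (hf : Measurable (Function.uncurry f)) (h : ∀ x y, ‖f x y‖ₑ ≤ g x y)
    (hg : ∫⁻ x, ∫⁻ y, g x y ∂ν ∂μ ≠ ⊤) : Integrable (Function.uncurry f) (μ.prod ν) := by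
  refine ⟨hf.aestronglyMeasurable, ?_⟩
  rw [HasFiniteIntegral, lintegral_prod _ hf.enorm.aemeasurable]
  exact lt_of_le_of_lt (lintegral_mono fun x => lintegral_mono fun y => h x y) hg.lt_top

theorem two_mul_integral_cexp_shift {μ : ℂ} (hμ : 0 < μ.re) (c : ℝ) :
    2 * ∫ x : ℝ, Complex.exp (-Real.pi * (Real.exp (2 * (x - c)) : ℝ) + μ * x) =
      Complex.Gammaℝ μ * Complex.exp (μ * c) := by
  rw [← integral_add_right_eq_self _ c, ← (gamma_integral hμ).2, mul_assoc, ← integral_mul_const]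
  congr 2
  ext x
  rw [← Complex.exp_add]; congr 1; rw [add_sub_cancel_right]; push_cast; ring

theorem integral_exchange {m : ℕ} (w : Fin (m + 2) → ℝ) (v : Fin (m + 1) → ℝ) {μ : ℂ}
    (hμ : 0 < μ.re) :
    2 * ∫ z : Fin (m + 2) → ℝ,
        Complex.exp (-Real.pi * (baxterE z w + todaE z v : ℝ) + μ * (∑ i, z i : ℝ)) =
      Complex.Gammaℝ μ * ∫ u : Fin (m + 1) → ℝ,
        Complex.exp (-Real.pi * (todaE w u + baxterE v u : ℝ) +
          μ * (∑ i, w i + ∑ i, v i - ∑ i, u i : ℝ)) := by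
  obtain ⟨c₀, c, hc, h⟩ := exists_exchange w v
  have h1 : ∀ z : Fin (m + 2) → ℝ,
      Complex.exp (-Real.pi * (baxterE z w + todaE z v : ℝ) + μ * (∑ i, z i : ℝ)) =
      Complex.exp (-Real.pi * (Real.exp (2 * (z 0 - c₀)) : ℝ) + μ * z 0) *
        (fun y : Fin (m + 1) → ℝ => Complex.exp (-Real.pi *
          (todaE w (c - y) + baxterE v (c - y) : ℝ) + μ * (∑ i, y i : ℝ)))
          (fun i => z i.succ) := fun z => by
    rw [h z, ← Complex.exp_add, Fin.sum_univ_succ]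
    congr 1; push_cast; ring
  rw [integral_congr_ae (Filter.Eventually.of_forall h1), integral_head_mul_tail
    (f := fun x => Complex.exp (-Real.pi * (Real.exp (2 * (x - c₀)) : ℝ) + μ * x))
    (g := fun y : Fin (m + 1) → ℝ => Complex.exp (-Real.pi *
          (todaE w (c - y) + baxterE v (c - y) : ℝ) + μ * (∑ i, y i : ℝ))),
    ← mul_assoc, two_mul_integral_cexp_shift hμ, mul_assoc, ← integral_const_mul,
    ← integral_sub_left_eq_self _ volume c]
  congr 2
  ext u
  rw [← Complex.exp_add, ← hc]
  congr 1
  simp only [sub_sub_cancel, Pi.sub_apply, Finset.sum_sub_distrib]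
  push_cast; ring

theorem whit_one (a : Fin 1 → ℂ) (x : Fin 1 → ℝ) : whit 1 a x = Complex.exp (a 0 * x 0) := by
  simp [whit, todaE, measureReal_def, volume_univ_fin_zero]

theorem two_pow_ne_zero (n : ℕ) : (2 : ENNReal) ^ n ≠ 0 := by simp

/-- The Whittaker functions are eigenfunctions of the Baxter operators. -/
theorem integral_baxter : ∀ (m : ℕ) (a : Fin (m + 1) → ℂ) (l : ℂ) (w : Fin (m + 1) → ℝ),
    (∀ j, 0 < (l + a j).re) →
    2 ^ (m + 1) * ∫ z : Fin (m + 1) → ℝ,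
      Complex.exp (-Real.pi * (baxterE z w : ℝ) + l * (∑ i, z i - ∑ i, w i : ℝ)) *
      whit (m + 1) a z = (∏ j, Complex.Gammaℝ (l + a j)) * whit (m + 1) a w
  | 0, a, l, w, hl => by
    have hb : ∀ x, whit (0 + 1) a x = Complex.exp (a 0 * x 0) := whit_one a
    simp only [hb, baxterE]
    have h : ∀ z : Fin 1 → ℝ, Complex.exp (-Real.pi * (∑ j, Real.exp (2 * (z j - w j)) +
        ∑ j : Fin 0, Real.exp (2 * (w j.castSucc - z j.succ)) : ℝ) +
          l * (∑ i, z i - ∑ i, w i : ℝ)) * Complex.exp (a 0 * z 0) =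
        Complex.exp (-Real.pi * (Real.exp (2 * (z 0 - w 0)) : ℝ) + (l + a 0) * z 0) *
          (fun _ => Complex.exp (-l * w 0)) (fun i : Fin 0 => z i.succ) := fun z => by
      rw [← Complex.exp_add, ← Complex.exp_add]; congr 1; simp; ring
    rw [integral_congr_ae (Filter.Eventually.of_forall h), integral_head_mul_tail
      (f := fun x => Complex.exp (-Real.pi * (Real.exp (2 * (x - w 0)) : ℝ) + (l + a 0) * x))
      (g := fun _ => Complex.exp (-l * w 0)), pow_one, ← mul_assoc,
      two_mul_integral_cexp_shift (hl 0)]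
    simp only [integral_const, measureReal_def, volume_univ_fin_zero, ENNReal.toReal_one, one_smul,
      mul_assoc, ← Complex.exp_add]
    congr 1
    · simp
    · congr 1; ring
  | m + 1, a, l, w, hl => by
    -- The eigenvalue identity for the majorants supplies the finiteness behind the first
    -- interchange of integrals.
    have hfin : (∏ j, lgamma (l.re + (a j).re)) * lwhit (m + 2) (fun i => (a i).re) w ≠ ⊤ :=
      ENNReal.mul_ne_top (ENNReal.prod_ne_top fun j _ => lgamma_ne_top (hl j))
        (lwhit_ne_top _ _ _)
    have hL := lintegral_baxter (m + 1) (fun i => (a i).re) l.re w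
    rw [← hL] at hfin
    replace hfin := ne_top_of_mul_ne_top (two_pow_ne_zero _) hfin
    have e1 : ∀ z, Complex.exp (-Real.pi * (baxterE z w : ℝ) + l * (∑ i, z i - ∑ i, w i : ℝ)) *
        whit (m + 2) a z = 2 ^ (m + 1) * ∫ v : Fin (m + 1) → ℝ,
          Complex.exp (-Real.pi * (baxterE z w + todaE z v : ℝ) + (l + a 0) * (∑ i, z i : ℝ)) *
          (Complex.exp (-l * (∑ i, w i : ℝ) - a 0 * (∑ i, v i : ℝ)) *
            whit (m + 1) (fun i => a i.succ) v) := by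
      intro z
      rw [whit, mul_left_comm, ← integral_const_mul]
      congr 2
      ext v
      rw [← mul_assoc, ← mul_assoc, ← Complex.exp_add, ← Complex.exp_add]
      congr 2; push_cast; ring
    have e2 : ∀ v, 2 * ∫ z : Fin (m + 2) → ℝ,
        Complex.exp (-Real.pi * (baxterE z w + todaE z v : ℝ) + (l + a 0) * (∑ i, z i : ℝ)) *
          (Complex.exp (-l * (∑ i, w i : ℝ) - a 0 * (∑ i, v i : ℝ)) *
            whit (m + 1) (fun i => a i.succ) v) =
        Complex.Gammaℝ (l + a 0) * ∫ u : Fin (m + 1) → ℝ,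
          Complex.exp (-Real.pi * (todaE w u : ℝ) + a 0 * (∑ i, w i - ∑ i, u i : ℝ)) *
          (Complex.exp (-Real.pi * (baxterE v u : ℝ) + l * (∑ i, v i - ∑ i, u i : ℝ)) *
            whit (m + 1) (fun i => a i.succ) v) := by
      intro v
      rw [integral_mul_const, ← mul_assoc, integral_exchange _ _ (hl 0), mul_assoc,
        ← integral_mul_const]
      congr 2
      ext u
      rw [← mul_assoc, ← mul_assoc, ← Complex.exp_add, ← Complex.exp_add]
      congr 2; push_cast; ring
    have i1 : Integrable (Function.uncurry fun (z : Fin (m + 2) → ℝ) (v : Fin (m + 1) → ℝ) =>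
        Complex.exp (-Real.pi * (baxterE z w + todaE z v : ℝ) + (l + a 0) * (∑ i, z i : ℝ)) *
          (Complex.exp (-l * (∑ i, w i : ℝ) - a 0 * (∑ i, v i : ℝ)) *
            whit (m + 1) (fun i => a i.succ) v)) (volume.prod volume) := by
      refine integrable_prod_of_lintegral_ne_top (g := fun z v =>
        eexp (-Real.pi * baxterE z w + l.re * (∑ i, z i - ∑ i, w i)) *
        (eexp (-Real.pi * todaE z v + (a 0).re * (∑ i, z i - ∑ i, v i)) *
          lwhit (m + 1) (fun i => (a i.succ).re) v)) (by unfold Function.uncurry; fun_prop)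
        (fun z v => ?_) ?_
      · rw [enorm_mul, enorm_mul, enorm_cexp, enorm_cexp, ← mul_assoc, ← mul_assoc, ← eexp_add,
          ← eexp_add]
        refine mul_le_mul' (le_of_eq ?_) (enorm_whit_le _ _ _)
        congr 1; simp; ring
      · refine ne_top_of_mul_ne_top (two_pow_ne_zero (m + 1)) ?_
        rw [← lintegral_const_mul' _ _ (by simp)]
        convert hfin using 3 with z
        rw [lwhit, lintegral_const_mul _ (by fun_prop), mul_left_comm]
    -- The inner integral of the majorant is an eigenvalue times `lwhit` at `u`; the outer one is
    -- then the integral defining `lwhit` at `w`.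
    have i2 : Integrable (Function.uncurry fun (u v : Fin (m + 1) → ℝ) =>
          Complex.exp (-Real.pi * (todaE w u : ℝ) + a 0 * (∑ i, w i - ∑ i, u i : ℝ)) *
          (Complex.exp (-Real.pi * (baxterE v u : ℝ) + l * (∑ i, v i - ∑ i, u i : ℝ)) *
            whit (m + 1) (fun i => a i.succ) v)) (volume.prod volume) := by
      refine integrable_prod_of_lintegral_ne_top (g := fun u v =>
        eexp (-Real.pi * todaE w u + (a 0).re * (∑ i, w i - ∑ i, u i)) *
        (eexp (-Real.pi * baxterE v u + l.re * (∑ i, v i - ∑ i, u i)) *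
          lwhit (m + 1) (fun i => (a i.succ).re) v)) (by unfold Function.uncurry; fun_prop)
        (fun u v => ?_) ?_
      · rw [enorm_mul, enorm_mul, enorm_cexp_kernel, enorm_cexp_kernel]
        gcongr
        exact enorm_whit_le _ _ _
      · refine ne_top_of_mul_ne_top (two_pow_ne_zero (m + 1)) ?_
        rw [← lintegral_const_mul' _ _ (by simp)]
        have hb : ∀ u : Fin (m + 1) → ℝ, 2 ^ (m + 1) * ∫⁻ v,
            eexp (-Real.pi * todaE w u + (a 0).re * (∑ i, w i - ∑ i, u i)) *
            (eexp (-Real.pi * baxterE v u + l.re * (∑ i, v i - ∑ i, u i)) *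
              lwhit (m + 1) (fun i => (a i.succ).re) v) =
            (∏ j : Fin (m + 1), lgamma (l.re + (a j.succ).re)) *
            (eexp (-Real.pi * todaE w u + (a 0).re * (∑ i, w i - ∑ i, u i)) *
              lwhit (m + 1) (fun i => (a i.succ).re) u) := fun u => by
          rw [lintegral_const_mul _ (by fun_prop), mul_left_comm, lintegral_baxter, mul_left_comm]
        rw [lintegral_congr hb, lintegral_const_mul _ (by fun_prop)]
        refine ENNReal.mul_ne_top (ENNReal.prod_ne_top fun j _ => lgamma_ne_top (hl j.succ)) ?_
        exact ne_top_of_mul_ne_top (two_pow_ne_zero (m + 1))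
          (lwhit_ne_top (m + 2) (fun i => (a i).re) w)
    calc _ = 2 ^ (m + 1) * (2 ^ (m + 1) * ∫ v : Fin (m + 1) → ℝ, 2 * ∫ z : Fin (m + 2) → ℝ,
          Complex.exp (-Real.pi * (baxterE z w + todaE z v : ℝ) + (l + a 0) * (∑ i, z i : ℝ)) *
          (Complex.exp (-l * (∑ i, w i : ℝ) - a 0 * (∑ i, v i : ℝ)) *
            whit (m + 1) (fun i => a i.succ) v)) := by
          simp only [e1]
          rw [integral_const_mul, integral_integral_swap i1, integral_const_mul]
          ring
      _ = Complex.Gammaℝ (l + a 0) * (2 ^ (m + 1) * ∫ u : Fin (m + 1) → ℝ,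
          Complex.exp (-Real.pi * (todaE w u : ℝ) + a 0 * (∑ i, w i - ∑ i, u i : ℝ)) *
          (2 ^ (m + 1) * ∫ v : Fin (m + 1) → ℝ,
          Complex.exp (-Real.pi * (baxterE v u : ℝ) + l * (∑ i, v i - ∑ i, u i : ℝ)) *
            whit (m + 1) (fun i => a i.succ) v)) := by
          simp only [e2]
          rw [integral_const_mul, ← integral_integral_swap i2, mul_left_comm _ (Complex.Gammaℝ _),
            mul_left_comm _ (Complex.Gammaℝ _), ← integral_const_mul]
          congr 2
          refine integral_congr_ae (Filter.Eventually.of_forall fun u => ?_)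
          dsimp only
          rw [integral_const_mul, mul_left_comm]
      _ = _ := by
          simp only [integral_baxter m (fun i => a i.succ) l _ (fun j => hl j.succ),
            mul_left_comm _ (∏ j : Fin (m + 1), Complex.Gammaℝ (l + a j.succ))]
          rw [integral_const_mul, Fin.prod_univ_succ (fun j => Complex.Gammaℝ (l + a j)),
            whit]
          ring

/-! ### Radial zeta integrals in logarithmic coordinates -/

/-- The term in which the last `z` meets the appended `0` is the exponent of the Gaussian. Hence the
equal rank integral contains a Baxter operator. -/
theorem baxterE_snoc {m : ℕ} (z : Fin (m + 1) → ℝ) (v : Fin m → ℝ) :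
    baxterE z (Fin.snoc v 0 : Fin (m + 1) → ℝ) = todaE z v + Real.exp (2 * z (Fin.last m)) := by
  simp only [baxterE, todaE, Fin.sum_univ_castSucc (n := m), Fin.snoc_castSucc, Fin.snoc_last,
    sub_zero, Finset.sum_add_distrib]
  ring

/-- The appended `0` comes from the last diagonal entry `1` of `diag(g, 1)`. The last `v` meets it,
which produces the Gaussian of an equal rank integral in `v`. -/
theorem todaE_snoc {m : ℕ} (z v : Fin (m + 1) → ℝ) :
    todaE (Fin.snoc z 0 : Fin (m + 2) → ℝ) v = baxterE z v + Real.exp (2 * v (Fin.last m)) := by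
  simp only [baxterE, todaE, Finset.sum_add_distrib, Fin.snoc_castSucc]
  rw [Fin.sum_univ_castSucc (n := m)]
  simp only [Fin.succ_castSucc, Fin.snoc_castSucc, Fin.succ_last, Fin.snoc_last, sub_zero]
  ring

theorem sum_snoc_zero {m : ℕ} (v : Fin m → ℝ) :
    ∑ i, (Fin.snoc v 0 : Fin (m + 1) → ℝ) i = ∑ i, v i := by
  simp [Fin.sum_univ_castSucc]

@[fun_prop]
theorem measurable_snoc {m : ℕ} :
    Measurable fun v : Fin m → ℝ => (Fin.snoc v 0 : Fin (m + 1) → ℝ) := by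
  refine measurable_pi_iff.mpr fun i => ?_
  refine Fin.lastCases ?_ (fun i => ?_) i
  · simp
  · simp only [Fin.snoc_castSucc]; fun_prop

@[fun_prop]
theorem measurable_snoc_comp {α : Type*} [MeasurableSpace α] {m : ℕ} {f : α → Fin m → ℝ}
    (hf : Measurable f) : Measurable fun x => (Fin.snoc (f x) 0 : Fin (m + 1) → ℝ) :=
  measurable_snoc.comp hf

/-- The majorant of the radial zeta integral on `GL_{m+1} × GL_m`. -/
def lrsLt (m : ℕ) (a : Fin (m + 1) → ℝ) (a' : Fin m → ℝ) (s : ℝ) : ENNReal :=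
  2 ^ m * ∫⁻ z : Fin m → ℝ, lwhit (m + 1) a (Fin.snoc z 0 : Fin (m + 1) → ℝ) *
    (lwhit m a' z * eexp (s * ∑ i, z i))

/-- The majorant of the radial zeta integral on `GL_{m+1} × GL_{m+1}`. -/
def lrsEq (m : ℕ) (a a' : Fin (m + 1) → ℝ) (s : ℝ) : ENNReal :=
  2 ^ (m + 1) * ∫⁻ z : Fin (m + 1) → ℝ, lwhit (m + 1) a' z *
    (lwhit (m + 1) a z * eexp (-Real.pi * Real.exp (2 * z (Fin.last m)) + s * ∑ i, z i))

/-- Unfold the factor of `a'` and integrate over `z` first: by `baxterE_snoc` this is the Baxter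
operator with parameter `s + a' 0` on the factor of `a`, evaluated at `(v, 0)`. -/
theorem lrsEq_eq (m : ℕ) (a a' : Fin (m + 1) → ℝ) (s : ℝ) :
    lrsEq m a a' s = (∏ j, lgamma (s + a' 0 + a j)) * lrsLt m a (fun i => a' i.succ) s := by
  have e1 : ∀ z : Fin (m + 1) → ℝ, lwhit (m + 1) a' z *
      (lwhit (m + 1) a z * eexp (-Real.pi * Real.exp (2 * z (Fin.last m)) + s * ∑ i, z i)) =
      2 ^ m * ∫⁻ v : Fin m → ℝ, lwhit m (fun i => a' i.succ) v * eexp (s * ∑ i, v i) *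
        (eexp (-Real.pi * baxterE z (Fin.snoc v 0 : Fin (m + 1) → ℝ) +
          (s + a' 0) * (∑ i, z i - ∑ i, (Fin.snoc v 0 : Fin (m + 1) → ℝ) i)) *
          lwhit (m + 1) a z) := fun z => by
    rw [lwhit, mul_assoc, ← lintegral_mul_const _ (by fun_prop)]
    congr 1
    refine lintegral_congr fun v => ?_
    rw [baxterE_snoc, sum_snoc_zero]
    have : eexp (s * ∑ i, v i) * eexp (-Real.pi * (todaE z v + Real.exp (2 * z (Fin.last m))) +
        (s + a' 0) * (∑ i, z i - ∑ i, v i)) =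
        eexp (-Real.pi * todaE z v + a' 0 * (∑ i, z i - ∑ i, v i)) *
        eexp (-Real.pi * Real.exp (2 * z (Fin.last m)) + s * ∑ i, z i) := by
      rw [← eexp_add, ← eexp_add]; congr 1; ring
    rw [mul_assoc (lwhit m _ v), ← mul_assoc (eexp (s * ∑ i, v i)), this]
    ring
  rw [lrsEq, lrsLt, lintegral_congr e1, lintegral_const_mul' _ _ (by simp),
    lintegral_lintegral_swap (by fun_prop), mul_left_comm, mul_left_comm (∏ _, _)]
  congr 1
  rw [← lintegral_const_mul' _ _ (by simp), ← lintegral_const_mul _ (by fun_prop)]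
  refine lintegral_congr fun v => ?_
  rw [lintegral_const_mul _ (by fun_prop), mul_left_comm, lintegral_baxter]
  ring

/-- Here the factor of `a` is unfolded, and by `todaE_snoc` the integral over `z` is the Baxter
operator with parameter `s + a 0` on the factor of `a'`. -/
theorem lrsLt_succ (m : ℕ) (a : Fin (m + 2) → ℝ) (a' : Fin (m + 1) → ℝ) (s : ℝ) :
    lrsLt (m + 1) a a' s =
      (∏ k, lgamma (s + a 0 + a' k)) * lrsEq m (fun i => a i.succ) a' s := by
  have e1 : ∀ z : Fin (m + 1) → ℝ, lwhit (m + 2) a (Fin.snoc z 0 : Fin (m + 2) → ℝ) *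
      (lwhit (m + 1) a' z * eexp (s * ∑ i, z i)) =
      2 ^ (m + 1) * ∫⁻ v : Fin (m + 1) → ℝ, lwhit (m + 1) (fun i => a i.succ) v *
        eexp (-Real.pi * Real.exp (2 * v (Fin.last m)) + s * ∑ i, v i) *
        (eexp (-Real.pi * baxterE z v + (s + a 0) * (∑ i, z i - ∑ i, v i)) *
          lwhit (m + 1) a' z) := fun z => by
    rw [lwhit, mul_assoc, ← lintegral_mul_const _ (by fun_prop)]
    congr 1
    refine lintegral_congr fun v => ?_
    rw [todaE_snoc, sum_snoc_zero]
    have : eexp (-Real.pi * Real.exp (2 * v (Fin.last m)) + s * ∑ i, v i) *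
        eexp (-Real.pi * baxterE z v + (s + a 0) * (∑ i, z i - ∑ i, v i)) =
        eexp (-Real.pi * (baxterE z v + Real.exp (2 * v (Fin.last m))) +
          a 0 * (∑ i, z i - ∑ i, v i)) * eexp (s * ∑ i, z i) := by
      rw [← eexp_add, ← eexp_add]; congr 1; ring
    rw [mul_assoc (lwhit _ _ _), ← mul_assoc (eexp _) (eexp _) (lwhit _ _ _), this]
    ring
  rw [lrsEq, lrsLt, lintegral_congr e1, lintegral_const_mul' _ _ (by simp),
    lintegral_lintegral_swap (by fun_prop), mul_left_comm (∏ _, _)]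
  congr 1
  rw [← lintegral_const_mul' _ _ (by simp), ← lintegral_const_mul _ (by fun_prop)]
  refine lintegral_congr fun v => ?_
  rw [lintegral_const_mul _ (by fun_prop), mul_left_comm, lintegral_baxter]
  ring

theorem lrsEq_ne_top_of_lrsLt {m : ℕ} {a a' : Fin (m + 1) → ℝ} {s : ℝ}
    (h : ∀ j k, 0 < s + a j + a' k) (hlt : lrsLt m a (fun i => a' i.succ) s ≠ ⊤) :
    lrsEq m a a' s ≠ ⊤ := by
  rw [lrsEq_eq]
  exact ENNReal.mul_ne_top (ENNReal.prod_ne_top fun j _ => lgamma_ne_top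
    (by rw [add_right_comm]; exact h j 0)) hlt

/-- The two reductions hold in `ℝ≥0∞` unconditionally, so positivity enters only through the
finiteness of the gamma factors. -/
theorem lrsLt_ne_top : ∀ (m : ℕ) (a : Fin (m + 1) → ℝ) (a' : Fin m → ℝ) (s : ℝ),
    (∀ j k, 0 < s + a j + a' k) → lrsLt m a a' s ≠ ⊤
  | 0, a, a', s, _ => by
    have h : ∀ x, lwhit (0 + 1) a x = eexp (a 0 * x 0) := lwhit_one a
    -- The rank one function is evaluated at the appended coordinate `0`, where it is `1`.
    have h0 : ∀ x : Fin 0 → ℝ, (Fin.snoc x 0 : Fin (0 + 1) → ℝ) 0 = 0 := fun x => rfl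
    simp only [lrsLt, h, h0]
    simp [lwhit, volume_univ_fin_zero]
  | m + 1, a, a', s, h => by
    rw [lrsLt_succ]
    exact ENNReal.mul_ne_top (ENNReal.prod_ne_top fun k _ => lgamma_ne_top (h 0 k))
      (lrsEq_ne_top_of_lrsLt (fun j k => h j.succ k)
        (lrsLt_ne_top m _ _ s fun j k => h j.succ k.succ))

theorem lrsEq_ne_top (m : ℕ) (a a' : Fin (m + 1) → ℝ) (s : ℝ)
    (h : ∀ j k, 0 < s + a j + a' k) : lrsEq m a a' s ≠ ⊤ :=
  lrsEq_ne_top_of_lrsLt h (lrsLt_ne_top m _ _ s fun j k => h j k.succ)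

/-- The integrand of the radial zeta integral on `GL_{m+1} × GL_m`. -/
def rsLt (m : ℕ) (a : Fin (m + 1) → ℂ) (a' : Fin m → ℂ) (s : ℂ) (z : Fin m → ℝ) : ℂ :=
  whit (m + 1) a (Fin.snoc z 0 : Fin (m + 1) → ℝ) *
    (whit m a' z * Complex.exp (s * (∑ i, z i : ℝ)))

/-- The integrand of the radial zeta integral on `GL_{m+1} × GL_{m+1}`. -/
def rsEq (m : ℕ) (a a' : Fin (m + 1) → ℂ) (s : ℂ) (z : Fin (m + 1) → ℝ) : ℂ :=
  whit (m + 1) a' z * (whit (m + 1) a z *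
    Complex.exp (-Real.pi * (Real.exp (2 * z (Fin.last m)) : ℝ) + s * (∑ i, z i : ℝ)))

@[fun_prop]
theorem measurable_rsLt (m : ℕ) (a : Fin (m + 1) → ℂ) (a' : Fin m → ℂ) (s : ℂ) :
    Measurable (rsLt m a a' s) := by unfold rsLt; fun_prop

@[fun_prop]
theorem measurable_rsEq (m : ℕ) (a a' : Fin (m + 1) → ℂ) (s : ℂ) :
    Measurable (rsEq m a a' s) := by unfold rsEq; fun_prop

theorem integrable_of_enorm_le {α : Type*} [MeasurableSpace α] {μ : Measure α} {f : α → ℂ}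
    {g : α → ENNReal} (hf : Measurable f) (h : ∀ x, ‖f x‖ₑ ≤ g x) (hg : ∫⁻ x, g x ∂μ ≠ ⊤) :
    Integrable f μ :=
  ⟨hf.aestronglyMeasurable, lt_of_le_of_lt (lintegral_mono h) hg.lt_top⟩

theorem integrable_rsLt {m : ℕ} {a : Fin (m + 1) → ℂ} {a' : Fin m → ℂ} {s : ℂ}
    (h : ∀ j k, 0 < (s + a j + a' k).re) : Integrable (rsLt m a a' s) := by
  refine integrable_of_enorm_le (by fun_prop) (fun z => ?_)
    (ne_top_of_mul_ne_top (two_pow_ne_zero m) (lrsLt_ne_top m (fun i => (a i).re)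
      (fun i => (a' i).re) s.re h))
  rw [rsLt, enorm_mul, enorm_mul, enorm_cexp]
  refine mul_le_mul' (enorm_whit_le _ _ _) (mul_le_mul' (enorm_whit_le _ _ _) (le_of_eq ?_))
  congr 1; simp

theorem integrable_rsEq {m : ℕ} {a a' : Fin (m + 1) → ℂ} {s : ℂ}
    (h : ∀ j k, 0 < (s + a j + a' k).re) : Integrable (rsEq m a a' s) := by
  refine integrable_of_enorm_le (by fun_prop) (fun z => ?_)
    (ne_top_of_mul_ne_top (two_pow_ne_zero (m + 1)) (lrsEq_ne_top m (fun i => (a i).re)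
      (fun i => (a' i).re) s.re h))
  rw [rsEq, enorm_mul, enorm_mul, enorm_cexp_kernel]
  exact mul_le_mul' (enorm_whit_le _ _ _) (mul_le_mul' (enorm_whit_le _ _ _) le_rfl)

/-- The complex form of `lrsEq_eq`; the finiteness of `lrsEq` permits the interchange of integrals.
-/
theorem integral_rsEq (m : ℕ) (a a' : Fin (m + 1) → ℂ) (s : ℂ)
    (hpos : ∀ j k, 0 < (s + a j + a' k).re) :
    2 ^ (m + 1) * ∫ z, rsEq m a a' s z =
      (∏ j, Complex.Gammaℝ (s + a j + a' 0)) *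
        (2 ^ m * ∫ z, rsLt m a (fun i => a' i.succ) s z) := by
  have e0 : ∀ (z : Fin (m + 1) → ℝ) (v : Fin m → ℝ),
      Complex.exp (-Real.pi * (todaE z v : ℝ) + a' 0 * (∑ i, z i - ∑ i, v i : ℝ)) *
        whit m (fun i => a' i.succ) v * (whit (m + 1) a z *
        Complex.exp (-Real.pi * (Real.exp (2 * z (Fin.last m)) : ℝ) + s * (∑ i, z i : ℝ))) =
      whit m (fun i => a' i.succ) v * Complex.exp (s * (∑ i, v i : ℝ)) *
        (Complex.exp (-Real.pi * (baxterE z (Fin.snoc v 0 : Fin (m + 1) → ℝ) : ℝ) +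
          (s + a' 0) * (∑ i, z i - ∑ i, (Fin.snoc v 0 : Fin (m + 1) → ℝ) i : ℝ)) *
          whit (m + 1) a z) := fun z v => by
    rw [baxterE_snoc, sum_snoc_zero]
    have : Complex.exp (s * (∑ i, v i : ℝ)) *
        Complex.exp (-Real.pi * (todaE z v + Real.exp (2 * z (Fin.last m)) : ℝ) +
        (s + a' 0) * (∑ i, z i - ∑ i, v i : ℝ)) =
        Complex.exp (-Real.pi * (todaE z v : ℝ) + a' 0 * (∑ i, z i - ∑ i, v i : ℝ)) *
        Complex.exp (-Real.pi * (Real.exp (2 * z (Fin.last m)) : ℝ) + s * (∑ i, z i : ℝ)) := by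
      rw [← Complex.exp_add, ← Complex.exp_add]; congr 1; push_cast; ring
    rw [mul_assoc (whit _ _ _), ← mul_assoc (Complex.exp (s * _)), this]
    ring
  have i1 : Integrable (Function.uncurry fun (z : Fin (m + 1) → ℝ) (v : Fin m → ℝ) =>
      Complex.exp (-Real.pi * (todaE z v : ℝ) + a' 0 * (∑ i, z i - ∑ i, v i : ℝ)) *
        whit m (fun i => a' i.succ) v * (whit (m + 1) a z *
        Complex.exp (-Real.pi * (Real.exp (2 * z (Fin.last m)) : ℝ) + s * (∑ i, z i : ℝ))))
      (volume.prod volume) := by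
    refine integrable_prod_of_lintegral_ne_top (g := fun z v =>
      eexp (-Real.pi * todaE z v + (a' 0).re * (∑ i, z i - ∑ i, v i)) *
        lwhit m (fun i => (a' i.succ).re) v * (lwhit (m + 1) (fun i => (a i).re) z *
        eexp (-Real.pi * Real.exp (2 * z (Fin.last m)) + s.re * ∑ i, z i)))
      (by unfold Function.uncurry; fun_prop) (fun z v => ?_) ?_
    · rw [enorm_mul, enorm_mul, enorm_mul, enorm_cexp_kernel, enorm_cexp_kernel]
      exact mul_le_mul' (mul_le_mul' le_rfl (enorm_whit_le _ _ _))
        (mul_le_mul' (enorm_whit_le _ _ _) le_rfl)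
    · have hfin := ne_top_of_mul_ne_top (two_pow_ne_zero (m + 1)) (lrsEq_ne_top m
        (fun i => (a i).re) (fun i => (a' i).re) s.re hpos)
      refine ne_top_of_mul_ne_top (two_pow_ne_zero m) ?_
      rw [← lintegral_const_mul' _ _ (by simp)]
      convert hfin using 3 with z
      conv_rhs => arg 1; rw [lwhit]
      rw [lintegral_mul_const _ (by fun_prop), mul_assoc]
  have e1 : ∀ z, rsEq m a a' s z = 2 ^ m * ∫ v : Fin m → ℝ,
      Complex.exp (-Real.pi * (todaE z v : ℝ) + a' 0 * (∑ i, z i - ∑ i, v i : ℝ)) *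
        whit m (fun i => a' i.succ) v * (whit (m + 1) a z *
        Complex.exp (-Real.pi * (Real.exp (2 * z (Fin.last m)) : ℝ) + s * (∑ i, z i : ℝ))) :=
    fun z => by rw [rsEq, whit, mul_assoc, integral_mul_const]
  simp only [e1]
  rw [integral_const_mul, integral_integral_swap i1]
  simp only [e0]
  rw [mul_left_comm, mul_left_comm (∏ _, _)]
  congr 1
  rw [← integral_const_mul, ← integral_const_mul]
  refine integral_congr_ae (Filter.Eventually.of_forall fun v => ?_)
  dsimp only
  rw [integral_const_mul, mul_left_comm, integral_baxter _ _ _ _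
    (fun j => by rw [add_right_comm]; exact hpos j 0), rsLt]
  simp only [add_right_comm s (a' 0)]
  ring

theorem integral_rsLt_succ (m : ℕ) (a : Fin (m + 2) → ℂ) (a' : Fin (m + 1) → ℂ) (s : ℂ)
    (hpos : ∀ j k, 0 < (s + a j + a' k).re) :
    2 ^ (m + 1) * ∫ z, rsLt (m + 1) a a' s z =
      (∏ k, Complex.Gammaℝ (s + a 0 + a' k)) *
        (2 ^ (m + 1) * ∫ z, rsEq m (fun i => a i.succ) a' s z) := by
  have e0 : ∀ z v : Fin (m + 1) → ℝ,
      Complex.exp (-Real.pi * (todaE (Fin.snoc z 0 : Fin (m + 2) → ℝ) v : ℝ) +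
        a 0 * (∑ i, (Fin.snoc z 0 : Fin (m + 2) → ℝ) i - ∑ i, v i : ℝ)) *
        whit (m + 1) (fun i => a i.succ) v *
        (whit (m + 1) a' z * Complex.exp (s * (∑ i, z i : ℝ))) =
      whit (m + 1) (fun i => a i.succ) v *
        Complex.exp (-Real.pi * (Real.exp (2 * v (Fin.last m)) : ℝ) + s * (∑ i, v i : ℝ)) *
        (Complex.exp (-Real.pi * (baxterE z v : ℝ) + (s + a 0) * (∑ i, z i - ∑ i, v i : ℝ)) *
          whit (m + 1) a' z) := fun z v => by
    rw [todaE_snoc, sum_snoc_zero]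
    have : Complex.exp (-Real.pi * (Real.exp (2 * v (Fin.last m)) : ℝ) + s * (∑ i, v i : ℝ)) *
        Complex.exp (-Real.pi * (baxterE z v : ℝ) + (s + a 0) * (∑ i, z i - ∑ i, v i : ℝ)) =
        Complex.exp (-Real.pi * (baxterE z v + Real.exp (2 * v (Fin.last m)) : ℝ) +
          a 0 * (∑ i, z i - ∑ i, v i : ℝ)) * Complex.exp (s * (∑ i, z i : ℝ)) := by
      rw [← Complex.exp_add, ← Complex.exp_add]; congr 1; push_cast; ring
    rw [mul_assoc (whit _ _ _), ← mul_assoc (Complex.exp _) (Complex.exp _) (whit _ _ _), this]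
    ring
  have i1 : Integrable (Function.uncurry fun z v : Fin (m + 1) → ℝ =>
      Complex.exp (-Real.pi * (todaE (Fin.snoc z 0 : Fin (m + 2) → ℝ) v : ℝ) +
        a 0 * (∑ i, (Fin.snoc z 0 : Fin (m + 2) → ℝ) i - ∑ i, v i : ℝ)) *
        whit (m + 1) (fun i => a i.succ) v *
        (whit (m + 1) a' z * Complex.exp (s * (∑ i, z i : ℝ)))) (volume.prod volume) := by
    refine integrable_prod_of_lintegral_ne_top (g := fun z v =>
      eexp (-Real.pi * todaE (Fin.snoc z 0 : Fin (m + 2) → ℝ) v +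
        (a 0).re * (∑ i, (Fin.snoc z 0 : Fin (m + 2) → ℝ) i - ∑ i, v i)) *
        lwhit (m + 1) (fun i => (a i.succ).re) v * (lwhit (m + 1) (fun i => (a' i).re) z *
        eexp (s.re * ∑ i, z i)))
      (by unfold Function.uncurry; fun_prop) (fun z v => ?_) ?_
    · rw [enorm_mul, enorm_mul, enorm_mul, enorm_cexp_kernel, enorm_cexp (s * _)]
      refine mul_le_mul' (mul_le_mul' le_rfl (enorm_whit_le _ _ _))
        (mul_le_mul' (enorm_whit_le _ _ _) (le_of_eq ?_))
      congr 1; simp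
    · have hfin := ne_top_of_mul_ne_top (two_pow_ne_zero (m + 1)) (lrsLt_ne_top (m + 1)
        (fun i => (a i).re) (fun i => (a' i).re) s.re hpos)
      refine ne_top_of_mul_ne_top (two_pow_ne_zero (m + 1)) ?_
      rw [← lintegral_const_mul' _ _ (by simp)]
      convert hfin using 3 with z
      conv_rhs => arg 1; rw [lwhit]
      rw [lintegral_mul_const _ (by fun_prop), mul_assoc]
  have e1 : ∀ z, rsLt (m + 1) a a' s z = 2 ^ (m + 1) * ∫ v : Fin (m + 1) → ℝ,
      Complex.exp (-Real.pi * (todaE (Fin.snoc z 0 : Fin (m + 2) → ℝ) v : ℝ) +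
        a 0 * (∑ i, (Fin.snoc z 0 : Fin (m + 2) → ℝ) i - ∑ i, v i : ℝ)) *
        whit (m + 1) (fun i => a i.succ) v *
        (whit (m + 1) a' z * Complex.exp (s * (∑ i, z i : ℝ))) :=
    fun z => by rw [rsLt, whit, mul_assoc, integral_mul_const]
  simp only [e1]
  rw [integral_const_mul, integral_integral_swap i1]
  simp only [e0]
  rw [mul_left_comm (∏ _, _)]
  congr 1
  rw [← integral_const_mul, ← integral_const_mul]
  refine integral_congr_ae (Filter.Eventually.of_forall fun v => ?_)
  dsimp only
  rw [integral_const_mul, mul_left_comm, integral_baxter _ _ _ _ (fun k => hpos 0 k), rsEq]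
  ring

/-- Each round of the induction splits off the row `j = 0` of the double product by
`integral_rsLt_succ`, then the column `k = 0` of what remains by `integral_rsEq`. -/
theorem integral_rsLt : ∀ (m : ℕ) (a : Fin (m + 1) → ℂ) (a' : Fin m → ℂ) (s : ℂ),
    (∀ j k, 0 < (s + a j + a' k).re) →
    2 ^ m * ∫ z, rsLt m a a' s z = ∏ j, ∏ k, Complex.Gammaℝ (s + a j + a' k)
  | 0, a, a', s, _ => by
    have h : ∀ x, whit (0 + 1) a x = Complex.exp (a 0 * x 0) := whit_one a
    have h0 : ∀ x : Fin 0 → ℝ, (Fin.snoc x 0 : Fin (0 + 1) → ℝ) 0 = 0 := fun x => rfl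
    simp only [rsLt, h, h0]
    simp [whit, measureReal_def, volume_univ_fin_zero]
  | m + 1, a, a', s, h => by
    rw [integral_rsLt_succ _ _ _ _ h, integral_rsEq _ _ _ _ (fun j k => h j.succ k),
      integral_rsLt m _ _ s (fun j k => h j.succ k.succ),
      Fin.prod_univ_succ (fun j => ∏ k, Complex.Gammaℝ (s + a j + a' k)),
      ← Finset.prod_mul_distrib]
    congr 1
    exact Finset.prod_congr rfl fun j _ =>
      (Fin.prod_univ_succ fun k => Complex.Gammaℝ (s + a j.succ + a' k)).symm

theorem integral_rsEq_eq_prod (m : ℕ) (a a' : Fin (m + 1) → ℂ) (s : ℂ)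
    (h : ∀ j k, 0 < (s + a j + a' k).re) :
    2 ^ (m + 1) * ∫ z, rsEq m a a' s z = ∏ j, ∏ k, Complex.Gammaℝ (s + a j + a' k) := by
  rw [integral_rsEq _ _ _ _ h, integral_rsLt m _ _ s (fun j k => h j k.succ),
    ← Finset.prod_mul_distrib]
  exact Finset.prod_congr rfl fun j _ =>
    (Fin.prod_univ_succ fun k => Complex.Gammaℝ (s + a j + a' k)).symm

/-! ### The exponential substitution -/

/-- The coordinatewise substitution `t_j = exp(c_j + k w_j)`. -/
def expMap {n : ℕ} (c : Fin n → ℝ) (k : ℝ) (w : Fin n → ℝ) : Fin n → ℝ :=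
  fun j => Real.exp (c j + k * w j)

/-- The derivative of the coordinatewise exponential substitution. -/
def expMapDeriv {n : ℕ} (c : Fin n → ℝ) (k : ℝ) (w : Fin n → ℝ) : (Fin n → ℝ) →L[ℝ] (Fin n → ℝ) :=
  ContinuousLinearMap.pi fun j =>
    ((expMap c k w j * k) • ContinuousLinearMap.id ℝ ℝ).comp (ContinuousLinearMap.proj j)

theorem hasFDerivAt_expMap {n : ℕ} (c : Fin n → ℝ) (k : ℝ) (w : Fin n → ℝ) :
    HasFDerivAt (expMap c k) (expMapDeriv c k w) w := by
  refine hasFDerivAt_pi.mpr fun j => ?_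
  have h1 : HasFDerivAt (fun w : Fin n → ℝ => w j) (ContinuousLinearMap.proj j) w :=
    (ContinuousLinearMap.proj (R := ℝ) (φ := fun _ : Fin n => ℝ) j).hasFDerivAt
  have h2 := ((h1.const_mul k).const_add (c j)).exp
  refine h2.congr_fderiv ?_
  ext v
  simp [expMap]
  ring

theorem abs_det_expMapDeriv {n : ℕ} (c : Fin n → ℝ) (k : ℝ) (w : Fin n → ℝ) :
    |(expMapDeriv c k w).det| = |k| ^ n * ∏ j, expMap c k w j := by
  rw [expMapDeriv, ContinuousLinearMap.det_pi, Finset.abs_prod]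
  have : ∀ j, |(((expMap c k w j * k) • ContinuousLinearMap.id ℝ ℝ : ℝ →L[ℝ] ℝ)).det| =
      |k| * expMap c k w j := fun j => by
    rw [ContinuousLinearMap.det, ContinuousLinearMap.toLinearMap_smul, LinearMap.det_smul]
    simp [abs_mul, expMap, mul_comm]
  rw [Finset.prod_congr rfl fun j _ => this j, Finset.prod_mul_distrib]
  simp

theorem injective_expMap {n : ℕ} (c : Fin n → ℝ) {k : ℝ} (hk : k ≠ 0) :
    Function.Injective (expMap c k) := fun v w h => by
  ext j
  have := Real.exp_injective (congrFun h j)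
  exact mul_left_cancel₀ hk (add_left_cancel this)

theorem image_expMap {n : ℕ} (c : Fin n → ℝ) {k : ℝ} (hk : k ≠ 0) :
    expMap c k '' Set.univ = {t : Fin n → ℝ | ∀ j, 0 < t j} := by
  ext t
  simp only [Set.mem_image, Set.mem_univ, true_and, Set.mem_ofPred_eq]
  refine ⟨fun ⟨w, hw⟩ j => hw ▸ Real.exp_pos _, fun ht =>
    ⟨fun j => (Real.log (t j) - c j) / k, ?_⟩⟩
  ext j
  rw [expMap, mul_div_cancel₀ _ hk, add_sub_cancel, Real.exp_log (ht j)]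

/-- The measure `∏ dt_j / t_j` becomes `|k|^n` times Lebesgue measure. With `k = -2` this yields the
powers of `2` in the recursion for `whit`. -/
theorem integral_pos_eq {n : ℕ} (c : Fin n → ℝ) {k : ℝ} (hk : k ≠ 0) (f : (Fin n → ℝ) → ℂ) :
    ∫ t in {t : Fin n → ℝ | ∀ j, 0 < t j}, f t * ∏ j, (1 / ((t j : ℝ) : ℂ)) =
      (|k| : ℝ) ^ n * ∫ w, f (expMap c k w) := by
  rw [← image_expMap c hk, integral_image_eq_integral_abs_det_fderiv_smul volume MeasurableSet.univ
    (fun w _ => (hasFDerivAt_expMap c k w).hasFDerivWithinAt) (injective_expMap c hk).injOn,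
    Measure.restrict_univ, ← integral_const_mul]
  congr 1
  ext w
  have : ∏ j, ((expMap c k w j : ℝ) : ℂ) ≠ 0 :=
    Finset.prod_ne_zero_iff.mpr fun j _ => by simp [expMap, Complex.exp_ne_zero]
  rw [abs_det_expMapDeriv, Complex.real_smul]
  simp only [one_div, Finset.prod_inv_distrib]
  push_cast
  field_simp

theorem lintegral_pos_eq {n : ℕ} (f : (Fin n → ℝ) → ENNReal) :
    ∫⁻ t in {t : Fin n → ℝ | ∀ j, 0 < t j}, f t =
      ∫⁻ w : Fin n → ℝ, eexp (∑ j, w j) * f (fun j => Real.exp (w j)) := by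
  rw [← image_expMap 0 one_ne_zero, lintegral_image_eq_lintegral_abs_det_fderiv_mul volume
    MeasurableSet.univ (fun w _ => (hasFDerivAt_expMap 0 1 w).hasFDerivWithinAt)
    (injective_expMap 0 one_ne_zero).injOn, Measure.restrict_univ]
  have h : ∀ w : Fin n → ℝ, expMap 0 1 w = fun j => Real.exp (w j) := fun w => by
    ext j; simp [expMap]
  refine lintegral_congr fun w => ?_
  rw [abs_det_expMapDeriv, h, eexp, Real.exp_sum]
  simp

theorem setIntegral_Ioi_eq_pi (f : ℝ → ℂ) :
    ∫ t in Set.Ioi (0 : ℝ), f t = ∫ t in {t : Fin 1 → ℝ | ∀ j, 0 < t j}, f (t 0) := by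
  have h := (volume_preserving_funUnique (Fin 1) ℝ).setIntegral_preimage_emb
    (MeasurableEquiv.measurableEmbedding _) f (Set.Ioi 0)
  rw [← h]
  have : (MeasurableEquiv.funUnique (Fin 1) ℝ) ⁻¹' Set.Ioi 0 =
      {t : Fin 1 → ℝ | ∀ j, 0 < t j} := by
    ext t; simp [MeasurableEquiv.funUnique, Fin.forall_fin_one]
  rw [this]
  rfl

/-! ### Comparison with the recursive integral formula -/

/-- The extra factors `e^{c(∑ x - ∑ w)}` telescope along the recursion. This undoes the shift by
`a_1/(n-1)` in `tildeParam`. -/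
theorem whit_add_const : ∀ (n : ℕ) (a : Fin n → ℂ) (c : ℂ) (x : Fin n → ℝ),
    whit n (fun i => a i + c) x = Complex.exp (c * (∑ i, x i : ℝ)) * whit n a x
  | 0, _, _, _ => by simp [whit]
  | n + 1, a, c, x => by
    simp only [whit]
    rw [mul_left_comm]
    congr 1
    rw [← integral_const_mul]
    congr 1
    ext w
    rw [whit_add_const n (fun i => a i.succ), ← mul_assoc, ← mul_assoc, ← Complex.exp_add,
      ← Complex.exp_add]
    congr 2; push_cast; ring

/-- Summation by parts, which turns the exponents of the `y_j = e^{x_j - x_{j+1}}` in the recursive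
formula into exponents of the torus entries. -/
theorem sum_abel : ∀ (M : ℕ) (x : Fin (M + 1) → ℂ),
    ∑ j : Fin M, ((M : ℂ) - (j : ℕ)) * (x j.castSucc - x j.succ) =
      M * x 0 - ∑ j : Fin M, x j.succ
  | 0, x => by simp
  | M + 1, x => by
    have h := sum_abel M (fun i => x i.succ)
    rw [Fin.sum_univ_succ, Fin.sum_univ_succ (fun j : Fin (M + 1) => x j.succ)]
    have e : ∀ i : Fin M, (((M + 1 : ℕ) : ℂ) - ((i.succ : Fin (M + 1)) : ℕ)) *
        (x i.succ.castSucc - x i.succ.succ) =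
        ((M : ℂ) - (i : ℕ)) * (x i.castSucc.succ - x i.succ.succ) := fun i => by
      rw [Fin.castSucc_succ]; simp
    rw [Finset.sum_congr rfl fun i _ => e i, h]
    simp only [Fin.castSucc_zero, Fin.succ_zero_eq_one, Fin.val_zero]
    push_cast; ring

theorem sum_sub_val : ∀ M : ℕ, ∑ j : Fin M, ((M : ℂ) - (j : ℕ)) = M * (M + 1) / 2
  | 0 => by simp
  | M + 1 => by
    rw [Fin.sum_univ_succ]
    have e : ∀ i : Fin M, ((M + 1 : ℕ) : ℂ) - ((i.succ : Fin (M + 1)) : ℕ) =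
      (M : ℂ) - (i : ℕ) := fun i => by simp
    rw [Finset.sum_congr rfl fun i _ => e i, sum_sub_val M]
    push_cast; simp; ring

theorem ofReal_exp_cpow (t : ℝ) (z : ℂ) : ((Real.exp t : ℝ) : ℂ) ^ z = Complex.exp (z * t) := by
  rw [Complex.cpow_def_of_ne_zero (by simp [Complex.exp_ne_zero]), ← Complex.ofReal_log
    (Real.exp_pos _).le, Real.log_exp, mul_comm]

theorem pi_mul_exp (t : ℝ) : Real.pi * Real.exp t = Real.exp (Real.log Real.pi + t) := by
  rw [Real.exp_add, Real.exp_log Real.pi_pos]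

/-- The Bessel integral under `t = e^{x_0 + x_1 - 2w}`; the Jacobian `2` cancels the factor `1/2` in
`besselK`. -/
theorem whit_two_eq (a : Fin 2 → ℂ) (x : Fin 2 → ℝ) :
    whit 2 a x = Complex.exp ((∑ i, a i) * x 1) *
      whittakerCore 1 a (fun _ => Real.exp (x 0 - x 1)) := by
  rw [whittakerCore, besselK, setIntegral_Ioi_eq_pi]
  have h := integral_pos_eq (fun _ : Fin 1 => x 0 + x 1) (by norm_num : (-2 : ℝ) ≠ 0) (fun t =>
    (Real.exp (-(2 * Real.pi * Real.exp (x 0 - x 1) / 2) * (t 0 + 1 / t 0)) : ℂ) *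
      (t 0 : ℂ) ^ ((a 0 - a 1) / 2))
  simp only [Finset.univ_unique, Fin.default_eq_zero, Finset.prod_singleton] at h
  rw [h, whit]
  simp only [whit_one, ofReal_exp_cpow, expMap, abs_neg, Nat.abs_ofNat, pow_one]
  rw [← mul_assoc (1 / 2 : ℂ), ← mul_assoc (2 * _), ← mul_assoc (Complex.exp _),
    ← integral_const_mul, ← integral_const_mul]
  congr 1
  ext w
  rw [Complex.ofReal_exp, ← Complex.exp_add, ← Complex.exp_add]
  have e : 2 * Real.pi * Real.exp (x 0 - x 1) / 2 * (Real.exp (x 0 + x 1 + -2 * w 0) +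
      1 / Real.exp (x 0 + x 1 + -2 * w 0)) = Real.pi * todaE x w := by
    have e1 : Real.exp (2 * (w 0 - x 1)) = Real.exp (x 0 - x 1) /
      Real.exp (x 0 + x 1 + -2 * w 0) := by rw [← Real.exp_sub]; ring_nf
    have e2 : Real.exp (2 * (x 0 - w 0)) = Real.exp (x 0 - x 1) *
      Real.exp (x 0 + x 1 + -2 * w 0) := by rw [← Real.exp_add]; ring_nf
    simp only [todaE, Finset.univ_unique, Fin.default_eq_zero, Finset.sum_singleton,
      Fin.castSucc_zero, Fin.succ_zero_eq_one, e1, e2]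
    ring
  rw [neg_mul (2 * Real.pi * _ / 2), e]
  have e3 : (1 / 2 : ℂ) * ((2 : ℝ) : ℂ) = 1 := by norm_num
  rw [e3, mul_one, mul_left_comm, mul_assoc 2, ← Complex.exp_add, ← Complex.exp_add]
  congr 2
  simp only [Finset.univ_unique, Fin.default_eq_zero, Finset.sum_singleton,
    Fin.sum_univ_succ (n := 1), Fin.succ_zero_eq_one]
  push_cast
  ring

/-- The substitution `π t_j = e^{2 x_{j+1} - 2 w_j}` turns `y_{j+1} √(t_{j+1}/t_j)` into `e^{w_j -
w_{j+1}}` and the exponents `-(π y_j)² t_j - 1/t_j` into `-π` times the terms of `todaE`. -/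
theorem whit_eq_whittakerCore : ∀ (N : ℕ) (a : Fin (N + 1) → ℂ) (x : Fin (N + 1) → ℝ),
    whit (N + 1) a x = Complex.exp ((∑ i, a i) * x (Fin.last N)) *
      whittakerCore N a (fun j => Real.exp (x j.castSucc - x j.succ))
  | 0, a, x => by
    have h : whit (0 + 1) a x = Complex.exp (a 0 * x 0) := whit_one a x
    simp [h, whittakerCore]
  | 1, a, x => by
    have h : (fun j : Fin 1 => Real.exp (x j.castSucc - x j.succ)) =
        fun _ => Real.exp (x 0 - x 1) := by
      ext j; fin_cases j; rfl
    rw [h]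
    exact whit_two_eq a x
  | N + 2, a, x => by
    have hcore : ∀ w : Fin (N + 2) → ℝ, whittakerCore (N + 1) (tildeParam a)
        (fun j => Real.exp (w j.castSucc - w j.succ)) =
        Complex.exp (-(∑ i, tildeParam a i) * w (Fin.last (N + 1)) +
          a 0 / ((N + 1 : ℕ) + 1) * (∑ i, w i : ℝ)) * whit (N + 2) (fun i => a i.succ) w := by
      intro w
      have h1 := whit_eq_whittakerCore (N + 1) (tildeParam a) w
      have h2 := whit_add_const (N + 2) (fun i => a i.succ) (a 0 / ((N + 1 : ℕ) + 1)) w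
      rw [Complex.exp_add, mul_assoc, ← h2]
      change _ = _ * whit (N + 2) (tildeParam a) w
      rw [h1, ← mul_assoc, ← Complex.exp_add, neg_mul, neg_add_cancel, Complex.exp_zero, one_mul]
    -- The `n - 1` shifts by `a_1/(n-1)` together restore the omitted `a_1`.
    have hsum : ∑ i, tildeParam a i = ∑ i, a i := by
      simp only [tildeParam, Finset.sum_add_distrib, Finset.sum_const, Finset.card_univ,
        Fintype.card_fin, nsmul_eq_mul]
      rw [Fin.sum_univ_succ a]
      have : ((N + 1 : ℕ) : ℂ) + 1 ≠ 0 := Nat.cast_add_one_ne_zero _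
      push_cast at this ⊢
      field_simp
      ring
    rw [whittakerCore, integral_pos_eq (fun j : Fin (N + 2) => 2 * x j.succ - Real.log Real.pi)
      (by norm_num : (-2 : ℝ) ≠ 0), whit, ← mul_assoc, ← integral_const_mul, ← integral_const_mul]
    congr 1
    ext w
    have hy : ∀ j : Fin (N + 1), Real.exp (x j.succ.castSucc - x j.succ.succ) *
        Real.sqrt (expMap (fun j : Fin (N + 2) => 2 * x j.succ - Real.log Real.pi) (-2) w j.succ /
          expMap (fun j : Fin (N + 2) => 2 * x j.succ - Real.log Real.pi) (-2) w j.castSucc) =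
        Real.exp (w j.castSucc - w j.succ) := fun j => by
      rw [expMap, expMap, ← Real.exp_sub, ← Real.exp_half, ← Real.exp_add, Fin.castSucc_succ]
      congr 1; ring
    have hE : ∀ j : Fin (N + 2), -((Real.pi * Real.exp (x j.castSucc - x j.succ)) ^ 2 *
        expMap (fun j : Fin (N + 2) => 2 * x j.succ - Real.log Real.pi) (-2) w j) -
        1 / expMap (fun j : Fin (N + 2) => 2 * x j.succ - Real.log Real.pi) (-2) w j =
        -Real.pi * (Real.exp (2 * (w j - x j.succ)) + Real.exp (2 * (x j.castSucc - w j))) := by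
      intro j
      have e : ∀ A B : ℝ, -Real.pi * (A + B) = -(Real.pi * B) - Real.pi * A := fun A B => by ring
      rw [e, expMap, one_div, ← Real.exp_neg, pi_mul_exp, pi_mul_exp, pi_mul_exp,
        ← Real.exp_nat_mul, ← Real.exp_add]
      push_cast
      ring_nf
    have hlast : Real.pi * expMap (fun j : Fin (N + 2) => 2 * x j.succ - Real.log Real.pi) (-2) w
        (Fin.last (N + 1)) = Real.exp (2 * x (Fin.last (N + 2)) - 2 * w (Fin.last (N + 1))) := by
      rw [expMap, pi_mul_exp, Fin.succ_last]; ring_nf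
    simp only [hy, hE, hlast, hcore, hsum]
    simp only [expMap, pi_mul_exp, ofReal_exp_cpow]
    simp only [Complex.ofReal_exp, ← Complex.exp_add]
    have hN : (N : ℂ) + 2 ≠ 0 := by
      have := Nat.cast_add_one_ne_zero (R := ℂ) (N + 1)
      push_cast at this; convert this using 1; ring
    -- The powers of `π` from the `y` factors and from the `t` factors cancel, by `sum_sub_val`.
    have key : ∑ j : Fin (N + 2), ((-Real.pi * (Real.exp (2 * (w j - x j.succ)) +
        Real.exp (2 * (x j.castSucc - w j))) : ℝ) +
        ((N : ℂ) + 3 - ((j : ℕ) + 1)) * a 0 / (N + 2) *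
          (Real.log Real.pi + (x j.castSucc - x j.succ) : ℝ) +
        ((N : ℂ) + 3) * a 0 / (2 * (N + 2)) *
          (2 * x j.succ - Real.log Real.pi + -2 * w j : ℝ)) =
        -Real.pi * (todaE x w : ℝ) + a 0 * ∑ i, (x i : ℂ) -
          ((N : ℂ) + 3) * a 0 / (N + 2) * ∑ i, (w i : ℂ) := by
      have h1 := sum_abel (N + 2) (fun i => (x i : ℂ))
      have h2 := sum_sub_val (N + 2)
      have e1 : ∀ j : Fin (N + 2), ((N : ℂ) + 3 - ((j : ℕ) + 1)) * a 0 / (N + 2) *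
          (Real.log Real.pi + (x j.castSucc - x j.succ) : ℝ) =
          a 0 / (N + 2) * Real.log Real.pi * (((N + 2 : ℕ) : ℂ) - (j : ℕ)) +
          a 0 / (N + 2) * ((((N + 2 : ℕ) : ℂ) - (j : ℕ)) * ((x j.castSucc : ℂ) - x j.succ)) :=
        fun j => by push_cast; ring
      have e2 : ∀ j : Fin (N + 2), ((N : ℂ) + 3) * a 0 / (2 * (N + 2)) *
          (2 * x j.succ - Real.log Real.pi + -2 * w j : ℝ) =
          ((N : ℂ) + 3) * a 0 / (N + 2) * x j.succ - ((N : ℂ) + 3) * a 0 / (N + 2) * w j -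
            ((N : ℂ) + 3) * a 0 / (2 * (N + 2)) * Real.log Real.pi :=
        fun j => by push_cast; field_simp; ring
      simp only [Finset.sum_add_distrib, e1, e2, Finset.sum_sub_distrib]
      rw [← Finset.mul_sum, ← Finset.mul_sum, ← Finset.mul_sum, ← Finset.mul_sum, h1, h2,
        ← Complex.ofReal_sum, ← Finset.mul_sum, ← todaE, Fin.sum_univ_succ (fun i => (x i : ℂ))]
      simp only [Finset.sum_const, Finset.card_univ, Fintype.card_fin, nsmul_eq_mul]
      push_cast
      field_simp
      ring
    rw [← Complex.exp_sum, key]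
    have h2 : ((|(-2 : ℝ)| : ℝ) : ℂ) = 2 := by norm_num
    have hw : ∀ A B C D E W : ℂ, A = B + C + D + E → 2 ^ (N + 2) * (Complex.exp A * W) =
        Complex.exp B * 2 ^ (N + 2) * (Complex.exp C * W * Complex.exp D * Complex.exp E) :=
      fun A B C D E W h => by simp only [h, Complex.exp_add]; ring
    have h3 : ((N + 1 : ℕ) : ℂ) + 1 = N + 2 := by push_cast; ring
    rw [h2, h3]
    apply hw
    push_cast
    field_simp
    ring

/-! ### Uniqueness of the Iwasawa decomposition -/

theorem IsUnipotentUpper.det_eq_one {n : ℕ} {x : Matrix (Fin n) (Fin n) ℝ}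
    (h : IsUnipotentUpper x) : x.det = 1 := by
  rw [Matrix.det_of_isUpperTriangular (fun i j hij => h.1 i j hij)]
  simp [h.2]

theorem IsUnipotentUpper.isUnit_det {n : ℕ} {x : Matrix (Fin n) (Fin n) ℝ}
    (h : IsUnipotentUpper x) : IsUnit x.det := by
  rw [h.det_eq_one]; exact isUnit_one

/-- The decomposition of a positive definite matrix as `x d xᵀ`, with `x` unipotent and `d`
diagonal, is unique. -/
theorem IsUnipotentUpper.ldl_unique {n : ℕ} {x x' : Matrix (Fin n) (Fin n) ℝ} {d d' : Fin n → ℝ}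
    (hx : IsUnipotentUpper x) (hx' : IsUnipotentUpper x') (hd : ∀ i, d i ≠ 0)
    (h : x * diagonal d * xᵀ = x' * diagonal d' * x'ᵀ) : x = x' ∧ d = d' := by
  have hy' : IsUnipotentUpper x'⁻¹ := hx'.inv (Matrix.mul_nonsing_inv _ hx'.isUnit_det)
  have hu : IsUnipotentUpper (x'⁻¹ * x) := hy'.mul hx
  have hv : IsUnipotentUpper (x'⁻¹ * x)⁻¹ := hu.inv (Matrix.mul_nonsing_inv _ hu.isUnit_det)
  -- The left side is upper triangular and the right side lower triangular, so the unipotent matrix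
  -- `x'⁻¹ * x` must be `1`.
  have key : x'⁻¹ * x * diagonal d = diagonal d' * ((x'⁻¹ * x)⁻¹)ᵀ := by
    have h1 : x'⁻¹ * x * diagonal d * (x'⁻¹ * x)ᵀ = diagonal d' := by
      rw [Matrix.transpose_mul]
      calc _ = x'⁻¹ * (x * diagonal d * xᵀ) * x'⁻¹ᵀ := by simp only [Matrix.mul_assoc]
        _ = (x'⁻¹ * x') * diagonal d' * (x'⁻¹ * x')ᵀ := by
          rw [h, Matrix.transpose_mul]; simp only [Matrix.mul_assoc]
        _ = _ := by
          rw [Matrix.nonsing_inv_mul _ hx'.isUnit_det]; simp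
    rw [← h1, Matrix.mul_assoc _ (x'⁻¹ * x)ᵀ, ← Matrix.transpose_mul,
      Matrix.nonsing_inv_mul _ hu.isUnit_det]
    simp
  have hent : ∀ i j, (x'⁻¹ * x) i j * d j = d' i * (x'⁻¹ * x)⁻¹ j i := fun i j => by
    have := congrFun (congrFun key i) j
    rwa [Matrix.mul_diagonal, Matrix.diagonal_mul, Matrix.transpose_apply] at this
  have hone : x'⁻¹ * x = 1 := by
    ext i j
    rcases lt_trichotomy i j with hij | hij | hij
    · have := hent i j
      rw [hv.1 j i hij, mul_zero] at this
      rw [Matrix.one_apply_ne hij.ne]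
      exact (mul_eq_zero.mp this).resolve_right (hd j)
    · rw [hij, hu.2, Matrix.one_apply_eq]
    · rw [hu.1 i j hij, Matrix.one_apply_ne hij.ne']
  refine ⟨?_, ?_⟩
  · calc x = x' * (x'⁻¹ * x) := by
          rw [← Matrix.mul_assoc, Matrix.mul_nonsing_inv _ hx'.isUnit_det, Matrix.one_mul]
      _ = x' := by rw [hone, Matrix.mul_one]
  · ext i
    have := hent i i
    rwa [hu.2, hv.2, one_mul, mul_one] at this

theorem IsIwasawa.mul_transpose {n : ℕ} {g : GLR n} {x k : Matrix (Fin n) (Fin n) ℝ}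
    {t : Fin n → ℝ} (h : IsIwasawa g x t k) :
    (g : Matrix (Fin n) (Fin n) ℝ) * (g : Matrix (Fin n) (Fin n) ℝ)ᵀ =
      x * diagonal (fun i => t i ^ 2) * xᵀ := by
  have hk : k * kᵀ = 1 := (Matrix.mem_orthogonalGroup_iff (Fin n) ℝ).mp h.2.2.1
  rw [h.2.2.2, Matrix.transpose_mul, Matrix.transpose_mul, Matrix.diagonal_transpose]
  calc _ = x * diagonal t * (k * kᵀ) * diagonal t * xᵀ := by simp only [Matrix.mul_assoc]
    _ = _ := by
      rw [hk, Matrix.mul_one, Matrix.mul_assoc x, Matrix.diagonal_mul_diagonal]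
      simp only [sq]

theorem isIwasawa_iwasawa {n : ℕ} (g : GLR n) : ∃ k, IsIwasawa g (iwasawaX g) (iwasawaT g) k :=
  (exists_isIwasawa g).choose_spec.choose_spec

theorem iwasawaT_pos {n : ℕ} (g : GLR n) (i : Fin n) : 0 < iwasawaT g i :=
  (isIwasawa_iwasawa g).choose_spec.2.1 i

theorem IsIwasawa.unique {n : ℕ} {g g' : GLR n} {x k x' k' : Matrix (Fin n) (Fin n) ℝ}
    {t t' : Fin n → ℝ} (h : IsIwasawa g x t k) (h' : IsIwasawa g' x' t' k')
    (hg : (g : Matrix (Fin n) (Fin n) ℝ) * (g : Matrix (Fin n) (Fin n) ℝ)ᵀ =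
      (g' : Matrix (Fin n) (Fin n) ℝ) * (g' : Matrix (Fin n) (Fin n) ℝ)ᵀ) : x = x' ∧ t = t' := by
  rw [h.mul_transpose, h'.mul_transpose] at hg
  obtain ⟨h1, h2⟩ := h.1.ldl_unique h'.1 (fun i => (pow_pos (h.2.1 i) 2).ne') hg
  refine ⟨h1, funext fun i => ?_⟩
  exact (pow_left_inj₀ (h.2.1 i).le (h'.2.1 i).le two_ne_zero).mp (congrFun h2 i)

theorem IsIwasawa.eq {n : ℕ} {g : GLR n} {x k : Matrix (Fin n) (Fin n) ℝ}
    {t : Fin n → ℝ} (h : IsIwasawa g x t k) : iwasawaX g = x ∧ iwasawaT g = t := by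
  obtain ⟨k', h'⟩ := isIwasawa_iwasawa g
  exact h'.unique h rfl

theorem iwasawaT_unip_mul {n : ℕ} {u : GLR n} (hu : u ∈ unip n) (g : GLR n) :
    iwasawaT (u * g) = iwasawaT g := by
  obtain ⟨k, h⟩ := isIwasawa_iwasawa g
  have : IsIwasawa (u * g) ((u : Matrix (Fin n) (Fin n) ℝ) * iwasawaX g) (iwasawaT g) k := by
    refine ⟨IsUnipotentUpper.mul hu h.1, h.2.1, h.2.2.1, ?_⟩
    rw [Units.val_mul, h.2.2.2]
    simp only [Matrix.mul_assoc]
  exact this.eq.2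

theorem abs_det_eq_prod_iwasawaT {n : ℕ} (g : GLR n) :
    |(g : Matrix (Fin n) (Fin n) ℝ).det| = ∏ i, iwasawaT g i := by
  obtain ⟨k, h⟩ := isIwasawa_iwasawa g
  have hk : k.det * k.det = 1 := by
    have := congrArg Matrix.det ((Matrix.mem_orthogonalGroup_iff (Fin n) ℝ).mp h.2.2.1)
    rwa [Matrix.det_mul, Matrix.det_transpose, Matrix.det_one] at this
  have hk' : |k.det| = 1 := by
    rcases mul_self_eq_one_iff.mp hk with h1 | h1 <;> simp [h1]
  rw [h.2.2.2, Matrix.det_mul, Matrix.det_mul, h.1.det_eq_one, Matrix.det_diagonal, one_mul,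
    abs_mul, hk', mul_one, abs_of_pos (Finset.prod_pos fun i _ => h.2.1 i)]

/-- The last row of a unipotent `x` is `e_n`, so `e_n g` is `t_n` times a unit row of the orthogonal
factor. -/
theorem gaussian_lastVec_vecMul {m : ℕ} (g : GLR (m + 1)) :
    gaussian (lastVec (m + 1) ᵥ* (g : Matrix (Fin (m + 1)) (Fin (m + 1)) ℝ)) =
      (Real.exp (-Real.pi * iwasawaT g (Fin.last m) ^ 2) : ℂ) := by
  obtain ⟨k, h⟩ := isIwasawa_iwasawa g
  have hlast : lastVec (m + 1) = Pi.single (Fin.last m) 1 := by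
    ext i
    simp only [lastVec, Pi.single_apply, Fin.ext_iff, Fin.val_last, add_left_inj]
  have hrow : ∀ j, (lastVec (m + 1) ᵥ* (g : Matrix (Fin (m + 1)) (Fin (m + 1)) ℝ)) j =
      iwasawaT g (Fin.last m) * k (Fin.last m) j := fun j => by
    rw [hlast, Matrix.single_one_vecMul, h.2.2.2, Matrix.row_apply, Matrix.mul_apply,
      Finset.sum_eq_single (Fin.last m)]
    · rw [Matrix.mul_diagonal, h.1.2, one_mul]
    · intro i _ hi
      rw [Matrix.mul_diagonal, h.1.1 _ _ (lt_of_le_of_ne (Fin.le_last i) hi), zero_mul, zero_mul]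
    · simp
  have hk : ∑ j, k (Fin.last m) j * k (Fin.last m) j = 1 := by
    have := congrFun (congrFun ((Matrix.mem_orthogonalGroup_iff (Fin (m + 1)) ℝ).mp h.2.2.1)
      (Fin.last m)) (Fin.last m)
    simpa [Matrix.mul_apply] using this
  have hs : ∑ j, (iwasawaT g (Fin.last m) * k (Fin.last m) j) ^ 2 =
      iwasawaT g (Fin.last m) ^ 2 := by
    calc _ = iwasawaT g (Fin.last m) ^ 2 * ∑ j, k (Fin.last m) j * k (Fin.last m) j := by
          rw [Finset.mul_sum]; exact Finset.sum_congr rfl fun j _ => by ring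
      _ = _ := by rw [hk, mul_one]
  simp only [gaussian, hrow, hs]

/-! ### The embedding of `GL_m` in `GL_{m+1}` -/

/-- The matrix `diag(M, 1)`. -/
def blockOne {m : ℕ} (M : Matrix (Fin m) (Fin m) ℝ) : Matrix (Fin (m + 1)) (Fin (m + 1)) ℝ :=
  Matrix.reindex finSumFinEquiv finSumFinEquiv
    (Matrix.fromBlocks M 0 0 (1 : Matrix (Fin 1) (Fin 1) ℝ))

theorem finSumFinEquiv_symm_last' (m : ℕ) :
    (finSumFinEquiv (m := m) (n := 1)).symm (Fin.last m) = Sum.inr 0 :=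
  finSumFinEquiv_symm_apply_natAdd (0 : Fin 1)

@[simp] theorem blockOne_castSucc_castSucc {m : ℕ} (M : Matrix (Fin m) (Fin m) ℝ) (i j : Fin m) :
    blockOne M i.castSucc j.castSucc = M i j := by
  simp [blockOne]

@[simp] theorem blockOne_castSucc_last {m : ℕ} (M : Matrix (Fin m) (Fin m) ℝ) (i : Fin m) :
    blockOne M i.castSucc (Fin.last m) = 0 := by
  simp [blockOne, finSumFinEquiv_symm_last', -finSumFinEquiv_symm_last]

@[simp] theorem blockOne_last_castSucc {m : ℕ} (M : Matrix (Fin m) (Fin m) ℝ) (i : Fin m) :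
    blockOne M (Fin.last m) i.castSucc = 0 := by
  simp [blockOne, finSumFinEquiv_symm_last', -finSumFinEquiv_symm_last]

@[simp] theorem blockOne_last_last {m : ℕ} (M : Matrix (Fin m) (Fin m) ℝ) :
    blockOne M (Fin.last m) (Fin.last m) = 1 := by
  simp [blockOne, finSumFinEquiv_symm_last', -finSumFinEquiv_symm_last]

theorem blockOne_mul {m : ℕ} (M N : Matrix (Fin m) (Fin m) ℝ) :
    blockOne (M * N) = blockOne M * blockOne N := by
  ext i j
  rw [Matrix.mul_apply, Fin.sum_univ_castSucc]
  refine Fin.lastCases ?_ (fun i => ?_) i <;> refine Fin.lastCases ?_ (fun j => ?_) j <;>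
    simp [Matrix.mul_apply]

theorem blockOne_transpose {m : ℕ} (M : Matrix (Fin m) (Fin m) ℝ) :
    blockOne Mᵀ = (blockOne M)ᵀ := by
  ext i j
  refine Fin.lastCases ?_ (fun i => ?_) i <;> refine Fin.lastCases ?_ (fun j => ?_) j <;> simp

theorem blockOne_diagonal {m : ℕ} (t : Fin m → ℝ) :
    blockOne (diagonal t) = diagonal (Fin.snoc t 1 : Fin (m + 1) → ℝ) := by
  ext i j
  refine Fin.lastCases ?_ (fun i => ?_) i <;> refine Fin.lastCases ?_ (fun j => ?_) j <;>
    simp [Matrix.diagonal_apply, Fin.castSucc_ne_last, (Fin.castSucc_ne_last _).symm]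

theorem blockOne_one (m : ℕ) : blockOne (1 : Matrix (Fin m) (Fin m) ℝ) = 1 := by
  rw [← Matrix.diagonal_one, blockOne_diagonal, ← Matrix.diagonal_one]
  congr 1
  ext i
  refine Fin.lastCases ?_ (fun i => ?_) i <;> simp

theorem coe_blockEmbed {m : ℕ} (g : GLR m) :
    (blockEmbed 1 g : Matrix (Fin (m + 1)) (Fin (m + 1)) ℝ) =
      blockOne (g : Matrix (Fin m) (Fin m) ℝ) := rfl

theorem isIwasawa_blockEmbed {m : ℕ} {g : GLR m} {x k : Matrix (Fin m) (Fin m) ℝ}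
    {t : Fin m → ℝ} (h : IsIwasawa g x t k) :
    IsIwasawa (blockEmbed 1 g) (blockOne x) (Fin.snoc t 1 : Fin (m + 1) → ℝ) (blockOne k) := by
  refine ⟨⟨fun i j => ?_, fun i => ?_⟩, fun i => ?_, ?_, ?_⟩
  · refine Fin.lastCases ?_ (fun i => ?_) i <;> refine Fin.lastCases ?_ (fun j => ?_) j
    · simp
    · simp
    · simp
    · simpa using h.1.1 i j
  · refine Fin.lastCases ?_ (fun i => ?_) i <;> simp [h.1.2]
  · refine Fin.lastCases ?_ (fun i => ?_) i <;> simp [h.2.1]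
  · have hk : k * kᵀ = 1 := (Matrix.mem_orthogonalGroup_iff (Fin m) ℝ).mp h.2.2.1
    refine (Matrix.mem_orthogonalGroup_iff (Fin (m + 1)) ℝ).mpr ?_
    rw [← blockOne_transpose, ← blockOne_mul, hk, blockOne_one]
  · rw [coe_blockEmbed, h.2.2.2, blockOne_mul, blockOne_mul, blockOne_diagonal]

theorem iwasawaT_blockEmbed {m : ℕ} (g : GLR m) :
    iwasawaT (blockEmbed 1 g) = (Fin.snoc (iwasawaT g) 1 : Fin (m + 1) → ℝ) :=
  (isIwasawa_blockEmbed (isIwasawa_iwasawa g).choose_spec).eq.2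

/-- The unipotent part of `diag(g, 1)` is `diag(x(g), 1)`, whose one new superdiagonal entry is `0`.
-/
theorem psi_iwasawaX_blockEmbed {m : ℕ} (g : GLR m) :
    psi (iwasawaX (blockEmbed 1 g)) = psi (iwasawaX g) := by
  have h : iwasawaX (blockEmbed 1 g) = blockOne (iwasawaX g) :=
    (isIwasawa_blockEmbed (isIwasawa_iwasawa g).choose_spec).eq.1
  have h0 : ∀ x : Fin m, m ≠ (x : ℕ) := fun x => x.isLt.ne'
  rw [h, psi, psi]
  simp only [Fin.sum_univ_castSucc (n := m), Fin.val_castSucc, Fin.val_last,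
    blockOne_castSucc_castSucc, blockOne_castSucc_last, blockOne_last_castSucc, ite_self, add_zero,
    Nat.succ_ne_self, if_false, Finset.sum_const_zero]

/-! ### Polar coordinates -/

/-- The area of the unit sphere in `ℝ^n`. -/
def sphereArea (n : ℕ) : ENNReal := n * volume (Metric.ball (0 : EuclideanSpace ℝ (Fin n)) 1)

theorem lintegral_norm_eq (n : ℕ) {K : ℝ → ENNReal} (hK : Measurable K) :
    ∫⁻ x : EuclideanSpace ℝ (Fin (n + 1)), K ‖x‖ =
      sphereArea (n + 1) * ∫⁻ t in Set.Ioi (0 : ℝ), ENNReal.ofReal (t ^ n) * K t := by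
  let μ : Measure (EuclideanSpace ℝ (Fin (n + 1))) := volume
  have hdim : Module.finrank ℝ (EuclideanSpace ℝ (Fin (n + 1))) - 1 = n := by simp
  have h1 : ∫⁻ x, K ‖x‖ ∂μ = ∫⁻ x : ({0}ᶜ : Set (EuclideanSpace ℝ (Fin (n + 1)))),
      K ‖x.1‖ ∂(μ.comap Subtype.val) := by
    rw [lintegral_subtype_comap (measurableSet_singleton _).compl fun x => K ‖x‖,
      restrict_compl_singleton]
  have h2 := μ.measurePreserving_homeomorphUnitSphereProd.lintegral_comp_emb
    (Homeomorph.measurableEmbedding _) (fun p => K p.2.1)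
  simp only [homeomorphUnitSphereProd_apply_snd_coe] at h2
  have hfst : ∫⁻ p, K p.2.1 ∂(μ.toSphere.prod (Measure.volumeIoiPow n)) =
      (∫⁻ _, 1 ∂μ.toSphere) * ∫⁻ t, K t.1 ∂(Measure.volumeIoiPow n) := by
    rw [← lintegral_prod_mul (by fun_prop) (by fun_prop)]
    simp only [one_mul]
  change ∫⁻ x, K ‖x‖ ∂μ = _
  rw [h1, h2, hdim, hfst, lintegral_one, μ.toSphere_apply_univ, Measure.volumeIoiPow,
    lintegral_withDensity_eq_lintegral_mul _ (by fun_prop) (by fun_prop)]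
  simp only [Pi.mul_apply]
  rw [lintegral_subtype_comap measurableSet_Ioi (fun t => ENNReal.ofReal (t ^ n) * K t)]
  simp [sphereArea, μ]

/-! ### Gram-Schmidt orthogonalization of rows -/

/-- The coefficient of `v` along `u j`. -/
def rowCoef {d k : ℕ} (u : Fin k → EuclideanSpace ℝ (Fin d)) (v : EuclideanSpace ℝ (Fin d))
    (j : Fin k) : ℝ := inner ℝ (u j) v / ‖u j‖ ^ 2

/-- The component of `v` orthogonal to all `u j`. -/
def rowPerp {d k : ℕ} (u : Fin k → EuclideanSpace ℝ (Fin d)) (v : EuclideanSpace ℝ (Fin d)) :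
    EuclideanSpace ℝ (Fin d) := v - ∑ j, rowCoef u v j • u j

/-- The Gram-Schmidt orthogonalization of a family of vectors, from the last one to the first. -/
def gs {d : ℕ} : (k : ℕ) → (Fin k → EuclideanSpace ℝ (Fin d)) → Fin k → EuclideanSpace ℝ (Fin d)
  | 0, r => r
  | k + 1, r => Fin.cons (rowPerp (gs k fun i => r i.succ) (r 0)) (gs k fun i => r i.succ)

section
variable {d : ℕ}

theorem gs_zero {k : ℕ} (r : Fin (k + 1) → EuclideanSpace ℝ (Fin d)) :
    gs (k + 1) r 0 = rowPerp (gs k fun i => r i.succ) (r 0) := rfl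

theorem gs_succ {k : ℕ} (r : Fin (k + 1) → EuclideanSpace ℝ (Fin d)) (i : Fin k) :
    gs (k + 1) r i.succ = gs k (fun i => r i.succ) i := rfl

theorem inner_rowPerp {k : ℕ} {u : Fin k → EuclideanSpace ℝ (Fin d)}
    (hu : ∀ i j, i ≠ j → inner ℝ (u i) (u j) = 0) (v : EuclideanSpace ℝ (Fin d)) (i : Fin k) :
    inner ℝ (u i) (rowPerp u v) = 0 := by
  rw [rowPerp, inner_sub_right, inner_sum, Finset.sum_eq_single i]
  · rw [inner_smul_right, rowCoef, real_inner_self_eq_norm_sq]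
    -- A zero `u i` is allowed; its coefficient is `0` by the convention for division.
    by_cases h : u i = 0
    · simp [h]
    · have := norm_ne_zero_iff.mpr h
      field_simp
      ring
  · intro j _ hj
    rw [inner_smul_right, hu i j hj.symm, mul_zero]
  · simp

theorem gs_orthogonal : ∀ (k : ℕ) (r : Fin k → EuclideanSpace ℝ (Fin d)) (i j : Fin k), i ≠ j →
    inner ℝ (gs k r i) (gs k r j) = 0
  | 0, _, i, _ => i.elim0
  | k + 1, r, i, j => by
    have ih := gs_orthogonal k (fun i => r i.succ)
    refine Fin.cases ?_ (fun i => ?_) i <;> refine Fin.cases ?_ (fun j => ?_) j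
    · simp
    · intro _
      rw [gs_zero, gs_succ, real_inner_comm, inner_rowPerp ih]
    · intro _
      rw [gs_zero, gs_succ, inner_rowPerp ih]
    · intro h
      rw [gs_succ, gs_succ]
      exact ih i j fun h' => h (by rw [h'])

theorem gs_mem_span : ∀ (k : ℕ) (r : Fin k → EuclideanSpace ℝ (Fin d)) (i : Fin k),
    gs k r i ∈ Submodule.span ℝ (Set.range r)
  | 0, _, i => i.elim0
  | k + 1, r, i => by
    have ih : ∀ i, gs k (fun i => r i.succ) i ∈ Submodule.span ℝ (Set.range r) := fun i =>
      Submodule.span_mono (Set.range_comp_subset_range Fin.succ r) (gs_mem_span k _ i)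
    refine Fin.cases ?_ (fun i => ?_) i
    · rw [gs_zero, rowPerp]
      exact Submodule.sub_mem _ (Submodule.subset_span ⟨0, rfl⟩)
        (Submodule.sum_mem _ fun j _ => Submodule.smul_mem _ _ (ih j))
    · rw [gs_succ]; exact ih i

theorem gs_ne_zero : ∀ {k : ℕ} {r : Fin k → EuclideanSpace ℝ (Fin d)}, LinearIndependent ℝ r →
    ∀ i, gs k r i ≠ 0
  | 0, _, _, i => i.elim0
  | k + 1, r, h, i => by
    have h' : LinearIndependent ℝ (Fin.cons (r 0) (fun i => r i.succ) :
        Fin (k + 1) → EuclideanSpace ℝ (Fin d)) := by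
      convert h using 1
      exact Fin.cons_self_tail r
    rw [linearIndependent_finCons] at h'
    refine Fin.cases ?_ (fun i => ?_) i
    · rw [gs_zero, rowPerp, sub_ne_zero]
      intro h0
      refine h'.2 ?_
      rw [h0]
      exact Submodule.sum_mem _ fun j _ => Submodule.smul_mem _ _ (gs_mem_span k _ j)
    · rw [gs_succ]; exact gs_ne_zero h'.1 i

@[fun_prop]
theorem measurable_rowCoef {α : Type*} [MeasurableSpace α] {k : ℕ}
    {u : α → Fin k → EuclideanSpace ℝ (Fin d)} {v : α → EuclideanSpace ℝ (Fin d)}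
    (hu : Measurable u) (hv : Measurable v) (j : Fin k) :
    Measurable fun x => rowCoef (u x) (v x) j := by
  unfold rowCoef
  fun_prop

@[fun_prop]
theorem measurable_rowPerp {α : Type*} [MeasurableSpace α] {k : ℕ}
    {u : α → Fin k → EuclideanSpace ℝ (Fin d)} {v : α → EuclideanSpace ℝ (Fin d)}
    (hu : Measurable u) (hv : Measurable v) :
    Measurable fun x => rowPerp (u x) (v x) := by
  unfold rowPerp
  fun_prop

@[fun_prop]
theorem measurable_gs : ∀ k : ℕ, Measurable (gs (d := d) k)
  | 0 => measurable_id
  | k + 1 => by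
    have ih := measurable_gs k
    refine measurable_pi_iff.mpr fun i => ?_
    refine Fin.cases ?_ (fun i => ?_) i
    · simp only [gs_zero]; fun_prop
    · simp only [gs_succ]; fun_prop

/-- The families whose orthogonalization has no zeros, with coefficients in `[0, 1)`. -/
def gsSet (k : ℕ) : Set (Fin k → EuclideanSpace ℝ (Fin d)) :=
  {r | (∀ i, gs k r i ≠ 0) ∧ ∀ i j, i < j → rowCoef (gs k r) (r i) j ∈ Set.Ico (0 : ℝ) 1}

theorem measurableSet_gsSet (k : ℕ) : MeasurableSet (gsSet (d := d) k) := by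
  refine MeasurableSet.inter (s₁ := {r | ∀ i, gs k r i ≠ 0})
    (s₂ := {r | ∀ i j, i < j → rowCoef (gs k r) (r i) j ∈ Set.Ico (0 : ℝ) 1}) ?_ ?_
  · have : {r : Fin k → EuclideanSpace ℝ (Fin d) | ∀ i, gs k r i ≠ 0} =
        ⋂ i, (fun r => gs k r i) ⁻¹' {0}ᶜ := by ext; simp
    rw [this]
    exact MeasurableSet.iInter fun i => (by fun_prop : Measurable fun r => gs k r i)
      (measurableSet_singleton 0).compl
  · have : {r : Fin k → EuclideanSpace ℝ (Fin d) | ∀ i j, i < j →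
        rowCoef (gs k r) (r i) j ∈ Set.Ico (0 : ℝ) 1} =
        ⋂ i, ⋂ j, ⋂ (_ : i < j), (fun r => rowCoef (gs k r) (r i) j) ⁻¹' Set.Ico (0 : ℝ) 1 := by
      ext; simp
    rw [this]
    exact MeasurableSet.iInter fun i => MeasurableSet.iInter fun j => MeasurableSet.iInter fun _ =>
      (by fun_prop : Measurable fun r => rowCoef (gs k r) (r i) j) measurableSet_Ico

/-- The vectors with nonzero orthogonal component and coefficients in `[0, 1)`. -/
def rowSet {k : ℕ} (u : Fin k → EuclideanSpace ℝ (Fin d)) : Set (EuclideanSpace ℝ (Fin d)) :=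
  {v | rowPerp u v ≠ 0 ∧ ∀ j, rowCoef u v j ∈ Set.Ico (0 : ℝ) 1}

theorem rowCoef_cons_succ {k : ℕ} (x : EuclideanSpace ℝ (Fin d))
    (u : Fin k → EuclideanSpace ℝ (Fin d)) (v : EuclideanSpace ℝ (Fin d)) (j : Fin k) :
    rowCoef (Fin.cons x u : Fin (k + 1) → EuclideanSpace ℝ (Fin d)) v j.succ = rowCoef u v j := rfl

/-- Orthogonalization starts from the last row, so a new first row does not affect the others. This
allows integration row by row. -/
theorem cons_mem_gsSet {k : ℕ} (v : EuclideanSpace ℝ (Fin d))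
    (r : Fin k → EuclideanSpace ℝ (Fin d)) :
    (Fin.cons v r : Fin (k + 1) → EuclideanSpace ℝ (Fin d)) ∈ gsSet (k + 1) ↔
      r ∈ gsSet k ∧ v ∈ rowSet (gs k r) := by
  have h : gs (k + 1) (Fin.cons v r : Fin (k + 1) → EuclideanSpace ℝ (Fin d)) =
      Fin.cons (rowPerp (gs k r) v) (gs k r) := rfl
  simp only [gsSet, rowSet, Set.mem_ofPred_eq, h, Fin.forall_fin_succ, Fin.cons_zero, Fin.cons_succ,
    rowCoef_cons_succ, Fin.succ_lt_succ_iff, Fin.succ_pos, Fin.not_lt_zero,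
    false_imp_iff, true_and, true_imp_iff]
  tauto

/-- Complete the normalized `u j` to an orthonormal basis; `φ` takes coordinates in it, separated
into those along the `u j` and the rest. -/
theorem exists_split {k e : ℕ} (hd : e + 1 + k = d) {u : Fin k → EuclideanSpace ℝ (Fin d)}
    (hu : ∀ i j, i ≠ j → inner ℝ (u i) (u j) = 0) (hu0 : ∀ i, u i ≠ 0) :
    ∃ φ : EuclideanSpace ℝ (Fin d) → (Fin k → ℝ) × EuclideanSpace ℝ (Fin (e + 1)),
      MeasurePreserving φ volume (volume.prod volume) ∧
      (∀ v j, rowCoef u v j = (φ v).1 j / ‖u j‖) ∧ ∀ v, ‖rowPerp u v‖ = ‖(φ v).2‖ := by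
  let w : Fin k ⊕ Fin (e + 1) → EuclideanSpace ℝ (Fin d) :=
    Sum.elim (fun j => ‖u j‖⁻¹ • u j) (fun _ => 0)
  have hw : Orthonormal ℝ ((Set.range Sum.inl).domRestrict w) := by
    constructor
    · rintro ⟨_, j, rfl⟩
      simp only [Set.domRestrict_apply, w, Sum.elim_inl]
      rw [norm_smul, norm_inv, norm_norm, inv_mul_cancel₀ (norm_ne_zero_iff.mpr (hu0 j))]
    · rintro ⟨_, i, rfl⟩ ⟨_, j, rfl⟩ hij
      simp only [Set.domRestrict_apply, w, Sum.elim_inl]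
      rw [inner_smul_left, inner_smul_right, hu i j fun h => hij (by rw [h])]
      simp
  obtain ⟨b, hb⟩ := hw.exists_orthonormalBasis_extension_of_card_eq (by simp; omega)
  have hbl : ∀ j, b (Sum.inl j) = ‖u j‖⁻¹ • u j := fun j => hb _ ⟨j, rfl⟩
  have hcoef : ∀ v j, rowCoef u v j = b.repr v (Sum.inl j) / ‖u j‖ := fun v j => by
    rw [b.repr_apply_apply, hbl, inner_smul_left, rowCoef]
    have := norm_ne_zero_iff.mpr (hu0 j)
    simp
    field_simp
  have hmp := ((MeasurePreserving.id volume).prod (PiLp.volume_preserving_toLp (Fin (e + 1)))).comp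
    ((volume_measurePreserving_sumPiEquivProdPi (fun _ : Fin k ⊕ Fin (e + 1) => ℝ)).comp
      ((PiLp.volume_preserving_ofLp (Fin k ⊕ Fin (e + 1))).comp b.measurePreserving_repr))
  refine ⟨fun v => (fun j => b.repr v (Sum.inl j), WithLp.toLp 2 fun i => b.repr v (Sum.inr i)),
    hmp, hcoef, fun v => ?_⟩
  have hrepr : ∀ i, b.repr (rowPerp u v) i =
      Sum.elim (fun _ => 0) (fun i => b.repr v (Sum.inr i)) i := by
    have hP : rowPerp u v = v - ∑ j, b.repr v (Sum.inl j) • b (Sum.inl j) := by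
      rw [rowPerp]
      congr 1
      refine Finset.sum_congr rfl fun j _ => ?_
      rw [hcoef, hbl, smul_smul, div_eq_mul_inv]
    intro i
    rw [b.repr_apply_apply, hP, inner_sub_right, inner_sum]
    rcases i with i | i
    · rw [Finset.sum_eq_single i]
      · rw [inner_smul_right, real_inner_self_eq_norm_sq, b.orthonormal.1, b.repr_apply_apply]
        simp
      · intro j _ hj
        rw [inner_smul_right, b.orthonormal.2 (fun h => hj (Sum.inl_injective h).symm), mul_zero]
      · simp
    · rw [Finset.sum_eq_zero, sub_zero, ← b.repr_apply_apply, Sum.elim_inr]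
      intro j _
      rw [inner_smul_right, b.orthonormal.2 (by simp), mul_zero]
  rw [← b.repr.norm_map, EuclideanSpace.norm_eq, EuclideanSpace.norm_eq, Fintype.sum_sum_type]
  simp [hrepr]

/-- Along `u j` the coordinate runs over an interval of length `‖u j‖`; on the orthogonal
complement, of dimension `e + 1`, polar coordinates apply. -/
theorem lintegral_rowSet {k e : ℕ} (hd : e + 1 + k = d) {u : Fin k → EuclideanSpace ℝ (Fin d)}
    (hu : ∀ i j, i ≠ j → inner ℝ (u i) (u j) = 0) (hu0 : ∀ i, u i ≠ 0) {K : ℝ → ENNReal}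
    (hK : Measurable K) :
    ∫⁻ v, (rowSet u).indicator (fun v => K ‖rowPerp u v‖) v =
      (∏ j, ENNReal.ofReal ‖u j‖) * (sphereArea (e + 1) *
        ∫⁻ t in Set.Ioi (0 : ℝ), ENNReal.ofReal (t ^ e) * K t) := by
  obtain ⟨φ, hφ, h1, h2⟩ := exists_split hd hu hu0
  let B : Set (Fin k → ℝ) := Set.univ.pi fun j => Set.Ico 0 ‖u j‖
  let K' : ℝ → ENNReal := ({0}ᶜ : Set ℝ).indicator K
  have hB : MeasurableSet B := MeasurableSet.univ_pi fun j => measurableSet_Ico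
  have hK' : Measurable K' := hK.indicator (measurableSet_singleton _).compl
  have hmem : ∀ v, v ∈ rowSet u ↔ (φ v).1 ∈ B ∧ ‖(φ v).2‖ ∈ ({0}ᶜ : Set ℝ) := fun v => by
    have hj : ∀ j, rowCoef u v j ∈ Set.Ico (0 : ℝ) 1 ↔ (φ v).1 j ∈ Set.Ico 0 ‖u j‖ := fun j => by
      have := norm_pos_iff.mpr (hu0 j)
      rw [h1, Set.mem_Ico, Set.mem_Ico, le_div_iff₀ this, zero_mul, div_lt_one this]
    simp only [rowSet, Set.mem_ofPred_eq, hj, B, Set.mem_univ_pi, Set.mem_compl_iff,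
      Set.mem_singleton_iff, ← h2, norm_eq_zero]
    tauto
  have hint : ∀ v, (rowSet u).indicator (fun v => K ‖rowPerp u v‖) v =
      (fun p : (Fin k → ℝ) × EuclideanSpace ℝ (Fin (e + 1)) => B.indicator 1 p.1 * K' ‖p.2‖)
        (φ v) := fun v => by
    by_cases hv : v ∈ rowSet u
    · obtain ⟨hb, hc⟩ := (hmem v).mp hv
      simp only [K', Set.indicator_of_mem hv, Set.indicator_of_mem hb, Set.indicator_of_mem hc, h2,
        Pi.one_apply, one_mul]
    · rw [Set.indicator_of_notMem hv]
      rcases not_and_or.mp (fun h => hv ((hmem v).mpr h)) with h | h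
      · simp only [Set.indicator_of_notMem h, zero_mul]
      · simp only [K', Set.indicator_of_notMem h, mul_zero]
  have hm1 : Measurable (B.indicator (1 : (Fin k → ℝ) → ENNReal)) := measurable_one.indicator hB
  refine (lintegral_congr hint).trans ((hφ.lintegral_comp (f := fun p => B.indicator 1 p.1 *
    K' ‖p.2‖) (by fun_prop)).trans ?_)
  rw [lintegral_prod_mul (f := B.indicator (1 : (Fin k → ℝ) → ENNReal))
    (g := fun y : EuclideanSpace ℝ (Fin (e + 1)) => K' ‖y‖)
    (by fun_prop) (by fun_prop), lintegral_indicator_one hB, lintegral_norm_eq _ hK',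
    Real.volume_pi_Ico]
  congr 1
  · simp
  · congr 1
    refine setLIntegral_congr_fun measurableSet_Ioi fun t ht => ?_
    simp only [K', Set.indicator_apply, Set.mem_compl_iff, Set.mem_singleton_iff, (ne_of_gt ht.out),
      not_false_iff, if_true]

theorem lintegral_fin_cons {k : ℕ} {E : Type*} [MeasureSpace E]
    [SigmaFinite (volume : Measure E)] {f : (Fin (k + 1) → E) → ENNReal} (hf : Measurable f) :
    ∫⁻ r, f r = ∫⁻ r : Fin k → E, ∫⁻ v : E, f (Fin.cons v r : Fin (k + 1) → E) := by
  have h := (volume_preserving_piFinSuccAbove (fun _ : Fin (k + 1) => E) 0).symm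
  have hc : ∀ p : E × (Fin k → E),
      (MeasurableEquiv.piFinSuccAbove (fun _ : Fin (k + 1) => E) 0).symm p =
        (Fin.cons p.1 p.2 : Fin (k + 1) → E) := fun p => by
    change Fin.insertNth (α := fun _ => E) 0 p.1 p.2 = _
    exact Fin.insertNth_zero' p.1 p.2
  rw [← h.lintegral_comp hf, Measure.volume_eq_prod, lintegral_prod_symm]
  · simp only [hc]
  · exact (hf.comp h.measurable).aemeasurable

theorem measurable_fin_cons {α : Type*} [MeasurableSpace α] {k : ℕ} {f : α → ℝ}
    {g : α → Fin k → ℝ} (hf : Measurable f) (hg : Measurable g) :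
    Measurable fun x => (Fin.cons (f x) (g x) : Fin (k + 1) → ℝ) := by
  refine measurable_pi_iff.mpr fun i => ?_
  refine Fin.cases ?_ (fun i => ?_) i
  · simpa using hf
  · simp only [Fin.cons_succ]; fun_prop

theorem measurableSet_pos (k : ℕ) : MeasurableSet {t : Fin k → ℝ | ∀ j, 0 < t j} := by
  have : {t : Fin k → ℝ | ∀ j, 0 < t j} = Set.univ.pi fun _ => Set.Ioi 0 := by ext; simp
  rw [this]
  exact MeasurableSet.univ_pi fun _ => measurableSet_Ioi

theorem setLIntegral_pos_fin_cons {k : ℕ} {f : (Fin (k + 1) → ℝ) → ENNReal} (hf : Measurable f) :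
    ∫⁻ t in {t : Fin (k + 1) → ℝ | ∀ j, 0 < t j}, f t =
      ∫⁻ t in {t : Fin k → ℝ | ∀ j, 0 < t j}, ∫⁻ x in Set.Ioi (0 : ℝ),
        f (Fin.cons x t : Fin (k + 1) → ℝ) := by
  rw [← lintegral_indicator (measurableSet_pos _), ← lintegral_indicator (measurableSet_pos _),
    lintegral_fin_cons (hf.indicator (measurableSet_pos _))]
  refine lintegral_congr fun t => ?_
  by_cases ht : t ∈ {t : Fin k → ℝ | ∀ j, 0 < t j}
  · rw [Set.indicator_of_mem ht, ← lintegral_indicator measurableSet_Ioi]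
    refine lintegral_congr fun x => ?_
    simp only [Set.indicator_apply, Set.mem_ofPred_eq, Fin.forall_fin_succ, Fin.cons_zero,
      Fin.cons_succ, Set.mem_Ioi, ht.out, implies_true, and_true]
  · rw [Set.indicator_of_notMem ht]
    refine (lintegral_congr fun x => ?_).trans lintegral_zero
    refine Set.indicator_of_notMem (fun h => ht ?_) _
    exact fun j => by simpa using h.out j.succ

/-- The distribution of the lengths of the orthogonalized rows, on the set where the coefficients
of the orthogonalization lie in `[0, 1)`. -/
theorem lintegral_gsSet : ∀ (k e : ℕ), e + k = d → ∀ H : (Fin k → ℝ) → ENNReal, Measurable H →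
    ∫⁻ r, (gsSet k).indicator (fun r : Fin k → EuclideanSpace ℝ (Fin d) =>
        H fun i => ‖gs k r i‖) r =
      (∏ i : Fin k, sphereArea (e + i + 1)) * ∫⁻ t in {t : Fin k → ℝ | ∀ j, 0 < t j},
        ENNReal.ofReal (∏ i : Fin k, t i ^ (e + 2 * i)) * H t
  | 0, e, hd, H, hH => by
    have h1 : ∀ r : Fin 0 → EuclideanSpace ℝ (Fin d), r ∈ gsSet 0 := fun r =>
      ⟨fun i => i.elim0, fun i => i.elim0⟩
    have h2 : {t : Fin 0 → ℝ | ∀ j, 0 < t j} = Set.univ := by ext; simp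
    simp only [Set.indicator_of_mem (h1 _), h2, Measure.restrict_univ]
    rw [lintegral_unique, lintegral_unique]
    simp [volume_pi]
    congr 1
    exact Subsingleton.elim _ _
  | k + 1, e, hd, H, hH => by
    have hm : Measurable ((gsSet (k + 1)).indicator
        (fun r : Fin (k + 1) → EuclideanSpace ℝ (Fin d) => H fun i => ‖gs (k + 1) r i‖)) :=
      (hH.comp (by fun_prop)).indicator (measurableSet_gsSet _)
    -- The result of integrating out the first row. In the end `t i` carries `e + i` from its own
    -- polar coordinates and one more power from each of the `i` rows above it, in all `e + 2i`.
    let H' : (Fin k → ℝ) → ENNReal := fun t => (∏ j, ENNReal.ofReal (t j)) * (sphereArea (e + 1) *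
      ∫⁻ x in Set.Ioi (0 : ℝ), ENNReal.ofReal (x ^ e) * H (Fin.cons x t : Fin (k + 1) → ℝ))
    have hin : Measurable fun p : (Fin k → ℝ) × ℝ =>
        ENNReal.ofReal (p.2 ^ e) * H (Fin.cons p.2 p.1 : Fin (k + 1) → ℝ) :=
      Measurable.mul (by fun_prop) (hH.comp (measurable_fin_cons measurable_snd measurable_fst))
    have hH' : Measurable H' :=
      Measurable.mul (by fun_prop) (Measurable.const_mul hin.lintegral_prod_right' _)
    have hstep : ∀ r : Fin k → EuclideanSpace ℝ (Fin d), ∫⁻ v, (gsSet (k + 1)).indicator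
        (fun r : Fin (k + 1) → EuclideanSpace ℝ (Fin d) => H fun i => ‖gs (k + 1) r i‖)
        (Fin.cons v r : Fin (k + 1) → EuclideanSpace ℝ (Fin d)) =
        (gsSet k).indicator (fun r => H' fun i => ‖gs k r i‖) r := fun r => by
      by_cases hr : r ∈ gsSet k
      · rw [Set.indicator_of_mem hr]
        dsimp only [H']
        have hK : Measurable fun x => H (Fin.cons x (fun i => ‖gs k r i‖) : Fin (k + 1) → ℝ) :=
          hH.comp (measurable_fin_cons measurable_id measurable_const)
        rw [← lintegral_rowSet (by omega) (gs_orthogonal k r) hr.1 hK]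
        refine lintegral_congr fun v => ?_
        have : (fun i => ‖gs (k + 1) (Fin.cons v r : Fin (k + 1) → EuclideanSpace ℝ (Fin d)) i‖) =
            (Fin.cons ‖rowPerp (gs k r) v‖ (fun i => ‖gs k r i‖) : Fin (k + 1) → ℝ) := by
          ext i
          refine Fin.cases rfl (fun i => rfl) i
        by_cases hv : v ∈ rowSet (gs k r)
        · rw [Set.indicator_of_mem hv,
            Set.indicator_of_mem ((cons_mem_gsSet v r).mpr ⟨hr, hv⟩), this]
        · rw [Set.indicator_of_notMem hv,
            Set.indicator_of_notMem fun h => hv ((cons_mem_gsSet v r).mp h).2]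
      · rw [Set.indicator_of_notMem hr]
        refine (lintegral_congr fun v => ?_).trans lintegral_zero
        exact Set.indicator_of_notMem (fun h => hr ((cons_mem_gsSet v r).mp h).1) _
    have hF : Measurable fun t : Fin (k + 1) → ℝ =>
        ENNReal.ofReal (∏ i : Fin (k + 1), t i ^ (e + 2 * (i : ℕ))) * H t :=
      Measurable.mul (by fun_prop) hH
    rw [lintegral_fin_cons hm, lintegral_congr hstep, lintegral_gsSet k (e + 1) (by omega) H' hH',
      setLIntegral_pos_fin_cons hF, Fin.prod_univ_succ,
      mul_comm (sphereArea _), mul_assoc]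
    congr 1
    · refine Finset.prod_congr rfl fun i _ => ?_
      rw [Fin.val_succ]; congr 1; ring
    · rw [← lintegral_const_mul]
      · refine setLIntegral_congr_fun (measurableSet_pos _) fun t ht => ?_
        simp only [H']
        rw [← mul_assoc, mul_left_comm, ← lintegral_const_mul']
        · congr 2
          ext x
          rw [← ENNReal.ofReal_prod_of_nonneg (fun i _ => (ht.out i).le),
            ← ENNReal.ofReal_mul (Finset.prod_nonneg fun i _ => pow_nonneg (ht.out i).le _),
            ← mul_assoc, ← ENNReal.ofReal_mul (by
              have := ht.out
              exact mul_nonneg (Finset.prod_nonneg fun i _ => pow_nonneg (this i).le _)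
                (Finset.prod_nonneg fun i _ => (this i).le)),
            ← Finset.prod_mul_distrib, Fin.prod_univ_succ]
          congr 2
          rw [mul_comm]
          simp only [Fin.val_zero, mul_zero, add_zero, Fin.cons_zero, Fin.cons_succ, Fin.val_succ]
          congr 1
          refine Finset.prod_congr rfl fun i _ => ?_
          rw [← pow_succ]; congr 1; ring
        · exact ENNReal.mul_ne_top (by simp) (ENNReal.prod_ne_top fun _ _ => by simp)
      · exact Measurable.lintegral_prod_right' (f := fun p : (Fin k → ℝ) × ℝ =>
          ENNReal.ofReal (∏ i : Fin (k + 1), (Fin.cons p.2 p.1 : Fin (k + 1) → ℝ) i ^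
            (e + 2 * (i : ℕ))) * H (Fin.cons p.2 p.1 : Fin (k + 1) → ℝ))
          (hF.comp (measurable_fin_cons measurable_snd measurable_fst))

end

/-! ### The Iwasawa decomposition by orthogonalization of the rows -/

theorem gs_decomp {d : ℕ} : ∀ (k : ℕ) (r : Fin k → EuclideanSpace ℝ (Fin d)) (i : Fin k),
    r i = gs k r i + ∑ j, if i < j then rowCoef (gs k r) (r i) j • gs k r j else 0
  | 0, _, i => i.elim0
  | k + 1, r, i => by
    refine Fin.cases ?_ (fun i => ?_) i
    · rw [Fin.sum_univ_succ, gs_zero, rowPerp]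
      simp only [lt_self_iff_false, if_false, Fin.succ_pos, if_true, zero_add, gs_succ]
      exact (sub_add_cancel _ _).symm
    · have h := gs_decomp k (fun i => r i.succ) i
      rw [Fin.sum_univ_succ, gs_succ]
      simp only [Fin.not_lt_zero, if_false, zero_add, Fin.succ_lt_succ_iff, gs_succ]
      exact h

/-- The rows of a matrix, as vectors of the Euclidean space. -/
def rowsOf {n : ℕ} (M : Fin n → Fin n → ℝ) (i : Fin n) : EuclideanSpace ℝ (Fin n) :=
  WithLp.toLp 2 (M i)

/-- The unipotent factor found by orthogonalization of the rows. -/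
def gsX {n : ℕ} (M : Fin n → Fin n → ℝ) : Matrix (Fin n) (Fin n) ℝ :=
  Matrix.of fun i j => if i = j then 1 else if i < j then
    rowCoef (gs n (rowsOf M)) (rowsOf M i) j else 0

theorem gs_iwasawa {n : ℕ} {M : Fin n → Fin n → ℝ} (h : ∀ i, gs n (rowsOf M) i ≠ 0) :
    ∃ k ∈ Matrix.orthogonalGroup (Fin n) ℝ, IsUnipotentUpper (gsX M) ∧
      Matrix.of M = gsX M * Matrix.diagonal (fun i => ‖gs n (rowsOf M) i‖) * k := by
  have hpos : ∀ i, ‖gs n (rowsOf M) i‖ ≠ 0 := fun i => norm_ne_zero_iff.mpr (h i)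
  refine ⟨Matrix.of fun i j => ‖gs n (rowsOf M) i‖⁻¹ * gs n (rowsOf M) i j, ?_,
    ⟨fun i j hij => ?_, fun i => ?_⟩, ?_⟩
  · rw [Matrix.mem_orthogonalGroup_iff]
    ext i j
    have hin : inner ℝ (gs n (rowsOf M) i) (gs n (rowsOf M) j) =
        ∑ l, gs n (rowsOf M) i l * gs n (rowsOf M) j l := by
      simp [PiLp.inner_apply, mul_comm]
    have : ∀ l, ‖gs n (rowsOf M) i‖⁻¹ * gs n (rowsOf M) i l *
        (‖gs n (rowsOf M) j‖⁻¹ * gs n (rowsOf M) j l) =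
        ‖gs n (rowsOf M) i‖⁻¹ * ‖gs n (rowsOf M) j‖⁻¹ *
          (gs n (rowsOf M) i l * gs n (rowsOf M) j l) := fun l => by ring
    simp only [Matrix.mul_apply, Matrix.transpose_apply, Matrix.of_apply, this]
    rw [← Finset.mul_sum, ← hin]
    by_cases hij : i = j
    · subst hij
      rw [real_inner_self_eq_norm_sq, Matrix.one_apply_eq]
      have := hpos i
      field_simp
    · rw [gs_orthogonal _ _ _ _ hij, Matrix.one_apply_ne hij, mul_zero]
  · simp [gsX, hij.ne', hij.le]
  · simp [gsX]
  · ext i l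
    have hd := congrArg (fun v : EuclideanSpace ℝ (Fin n) => v l) (gs_decomp n (rowsOf M) i)
    simp only [PiLp.add_apply, WithLp.ofLp_sum, Finset.sum_apply] at hd
    rw [Matrix.of_apply, Matrix.mul_apply]
    change M i l = _ at hd
    rw [hd]
    have hterm : ∀ j, (gsX M * Matrix.diagonal fun i => ‖gs n (rowsOf M) i‖) i j *
        (Matrix.of fun i j => ‖gs n (rowsOf M) i‖⁻¹ * gs n (rowsOf M) i j) j l =
        (if i = j then gs n (rowsOf M) j l else 0) +
          (if i < j then rowCoef (gs n (rowsOf M)) (rowsOf M i) j • gs n (rowsOf M) j else 0 :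
            EuclideanSpace ℝ (Fin n)) l := by
      intro j
      have := hpos j
      rw [Matrix.mul_diagonal]
      by_cases hij : i = j
      · subst hij; simp [gsX]; field_simp
      · by_cases hlt : i < j <;> simp [gsX, hij, hlt]
        field_simp
    rw [Finset.sum_congr rfl fun j _ => hterm j, Finset.sum_add_distrib]
    simp

theorem det_ne_zero_of_gs_ne_zero {n : ℕ} {M : Fin n → Fin n → ℝ}
    (h : ∀ i, gs n (rowsOf M) i ≠ 0) : (Matrix.of M).det ≠ 0 := by
  obtain ⟨k, hk, hX, hM⟩ := gs_iwasawa h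
  have hk' : k.det * kᵀ.det = 1 := by
    rw [← Matrix.det_mul]
    have : k * kᵀ = 1 := (Matrix.mem_orthogonalGroup_iff (Fin n) ℝ).mp hk
    rw [this, Matrix.det_one]
  rw [hM, Matrix.det_mul, Matrix.det_mul, hX.det_eq_one, Matrix.det_diagonal, one_mul]
  exact mul_ne_zero (Finset.prod_ne_zero_iff.mpr fun i _ => norm_ne_zero_iff.mpr (h i))
    (left_ne_zero_of_mul_eq_one hk')

theorem gs_entries_ne_zero {n : ℕ} (g : GLR n) (i : Fin n) : gs n (rowsOf (entries n g)) i ≠ 0 := by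
  refine gs_ne_zero ?_ i
  have h1 : LinearIndependent ℝ (fun i => (g : Matrix (Fin n) (Fin n) ℝ) i) :=
    Matrix.linearIndependent_rows_of_isUnit g.isUnit
  exact h1.map' (WithLp.linearEquiv 2 ℝ (Fin n → ℝ)).symm.toLinearMap (LinearEquiv.ker _)

/-- By uniqueness, the factors obtained by choice are the explicit ones, which gives their
measurability and their distribution. -/
theorem iwasawa_eq_gs {n : ℕ} (g : GLR n) : iwasawaX g = gsX (entries n g) ∧
    iwasawaT g = fun i => ‖gs n (rowsOf (entries n g)) i‖ := by
  obtain ⟨k, hk, hX, hM⟩ := gs_iwasawa (gs_entries_ne_zero g)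
  exact IsIwasawa.eq ⟨hX, fun i => norm_pos_iff.mpr (gs_entries_ne_zero g i), hk, hM⟩

/-- The fundamental domain used for the invariant measure on `X_n(ℝ) \ GL_n(ℝ)`. -/
def unipBox (n : ℕ) : Set (GLR n) :=
  {g | ∀ i j, i < j → 0 ≤ iwasawaX g i j ∧ iwasawaX g i j < 1}

theorem mem_unipBox {n : ℕ} (g : GLR n) : g ∈ unipBox n ↔ rowsOf (entries n g) ∈ gsSet n := by
  have h : ∀ i j, i < j → iwasawaX g i j =
      rowCoef (gs n (rowsOf (entries n g))) (rowsOf (entries n g) i) j := fun i j hij => by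
    rw [(iwasawa_eq_gs g).1]; simp [gsX, hij.ne, hij]
  constructor
  · intro hg
    refine ⟨gs_entries_ne_zero g, fun i j hij => ?_⟩
    rw [← h i j hij]; exact hg i j hij
  · intro hg i j hij
    rw [h i j hij]; exact hg.2 i j hij

/-! ### Measurability -/

/-- Inversion is continuous on invertible matrices, so the topology of the unit group is the one
induced by the entries; the range is where the determinant is nonzero. -/
theorem measurableEmbedding_entries (n : ℕ) : MeasurableEmbedding (entries n) := by
  have hc : ContinuousOn (fun M : Matrix (Fin n) (Fin n) ℝ => M⁻¹) {M | IsUnit M} := by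
    intro M hM
    have hdet : M.det ≠ 0 := ((Matrix.isUnit_iff_isUnit_det M).mp hM).ne_zero
    refine ContinuousAt.continuousWithinAt ?_
    simp only [Matrix.inv_def, Ring.inverse_eq_inv']
    exact (ContinuousAt.inv₀ (continuous_id.matrix_det.continuousAt) hdet).smul
      continuous_id.matrix_adjugate.continuousAt
  have he : Topology.IsEmbedding (Units.val : GLR n → Matrix (Fin n) (Fin n) ℝ) :=
    Units.isEmbedding_val_mk' hc fun u => (Matrix.coe_units_inv u).symm
  have hr : MeasurableSet (Set.range (entries n)) := by
    have : Set.range (entries n) = {M : Fin n → Fin n → ℝ | (Matrix.of M).det ≠ 0} := by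
      ext M
      constructor
      · rintro ⟨g, rfl⟩
        exact (Matrix.isUnits_det_units g).ne_zero
      · intro h
        exact ⟨Matrix.GeneralLinearGroup.mkOfDetNeZero (Matrix.of M) h, rfl⟩
    rw [this]
    have hm : Continuous fun M : Fin n → Fin n → ℝ => (Matrix.of M).det :=
      Continuous.matrix_det continuous_id
    exact hm.measurable (measurableSet_singleton (0 : ℝ)).compl
  have he' : Topology.IsEmbedding (entries n) := he
  exact he'.measurableEmbedding hr

theorem measurePreserving_rowsOf (n : ℕ) :
    MeasurePreserving (rowsOf (n := n)) volume volume :=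
  volume_preserving_pi fun _ : Fin n => PiLp.volume_preserving_toLp (Fin n)

@[fun_prop]
theorem measurable_rowsOf (n : ℕ) : Measurable (rowsOf (n := n)) :=
  (measurePreserving_rowsOf n).measurable

theorem measurable_rowsOf_entries (n : ℕ) : Measurable fun g : GLR n => rowsOf (entries n g) :=
  (measurable_rowsOf n).comp (measurableEmbedding_entries n).measurable

theorem measurableSet_unipBox (n : ℕ) : MeasurableSet (unipBox n) := by
  have : unipBox n = (fun g : GLR n => rowsOf (entries n g)) ⁻¹' gsSet n := by
    ext g; exact mem_unipBox g
  rw [this]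
  exact measurable_rowsOf_entries n (measurableSet_gsSet n)

theorem measurable_iwasawaT (n : ℕ) : Measurable (iwasawaT (n := n)) := by
  have : (iwasawaT : GLR n → Fin n → ℝ) = fun g i => ‖gs n (rowsOf (entries n g)) i‖ :=
    funext fun g => (iwasawa_eq_gs g).2
  rw [this]
  exact measurable_pi_iff.mpr fun i => ((measurable_pi_apply i).comp
    ((measurable_gs n).comp (measurable_rowsOf_entries n))).norm

/-! ### The Haar measure in Iwasawa coordinates -/

theorem sphereArea_succ (j : ℕ) :
    sphereArea (j + 1) = ENNReal.ofReal (2 * Real.pi ^ (((j + 1 : ℕ) : ℝ) / 2) /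
      Real.Gamma (((j + 1 : ℕ) : ℝ) / 2)) := by
  have hp : (0 : ℝ) < ((j + 1 : ℕ) : ℝ) / 2 := by positivity
  have hG := Real.Gamma_pos_of_pos hp
  rw [sphereArea, EuclideanSpace.volume_ball, ENNReal.ofReal_one, one_pow, one_mul,
    ← ENNReal.ofReal_natCast, ← ENNReal.ofReal_mul (by positivity), Fintype.card_fin,
    Real.Gamma_add_one hp.ne', Real.sqrt_eq_rpow, ← Real.rpow_natCast (Real.pi ^ (1 / 2 : ℝ)),
    ← Real.rpow_mul Real.pi_pos.le]
  congr 1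
  rw [show 1 / 2 * ((j + 1 : ℕ) : ℝ) = ((j + 1 : ℕ) : ℝ) / 2 by ring]
  field_simp

/-- The constant `π^{-j/2} Γ(j/2)` of the Haar measure times the area of the unit sphere in `ℝ^j` is
`2`. -/
theorem ofReal_const_mul_prod_sphereArea (n : ℕ) :
    ENNReal.ofReal (∏ j ∈ Finset.Icc 1 n, Real.pi ^ (-(j : ℝ) / 2) * Real.Gamma ((j : ℝ) / 2)) *
      ∏ i : Fin n, sphereArea (i + 1) = 2 ^ n := by
  have h : ∏ j ∈ Finset.Icc 1 n, Real.pi ^ (-(j : ℝ) / 2) * Real.Gamma ((j : ℝ) / 2) =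
      ∏ i : Fin n, (Real.pi ^ (-((i + 1 : ℕ) : ℝ) / 2) * Real.Gamma (((i + 1 : ℕ) : ℝ) / 2)) := by
    rw [Fin.prod_univ_eq_prod_range (fun i : ℕ => Real.pi ^ (-((i + 1 : ℕ) : ℝ) / 2) *
      Real.Gamma (((i + 1 : ℕ) : ℝ) / 2)), Finset.range_eq_Ico, Finset.prod_Ico_add'
      (fun i : ℕ => Real.pi ^ (-(i : ℝ) / 2) * Real.Gamma ((i : ℝ) / 2))]
    rfl
  have hG : ∀ i : ℕ, 0 < Real.Gamma (((i + 1 : ℕ) : ℝ) / 2) := fun i =>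
    Real.Gamma_pos_of_pos (by positivity)
  have hnn : ∀ i ∈ (Finset.univ : Finset (Fin n)), 0 ≤ Real.pi ^ (-((i + 1 : ℕ) : ℝ) / 2) *
      Real.Gamma (((i + 1 : ℕ) : ℝ) / 2) := fun i _ =>
    mul_nonneg (Real.rpow_nonneg Real.pi_pos.le _) (hG i).le
  rw [h, ENNReal.ofReal_prod_of_nonneg hnn, ← Finset.prod_mul_distrib]
  have h2 : ∀ i : Fin n, ENNReal.ofReal (Real.pi ^ (-((i + 1 : ℕ) : ℝ) / 2) *
      Real.Gamma (((i + 1 : ℕ) : ℝ) / 2)) * sphereArea (i + 1) = 2 := fun i => by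
    rw [sphereArea_succ, ← ENNReal.ofReal_mul (mul_nonneg (Real.rpow_nonneg Real.pi_pos.le _)
      (hG i).le), neg_div, Real.rpow_neg Real.pi_pos.le]
    have := (hG i).ne'
    have := (Real.rpow_pos_of_pos Real.pi_pos (((i + 1 : ℕ) : ℝ) / 2)).ne'
    rw [← ENNReal.ofReal_ofNat]
    congr 1
    field_simp
  rw [Finset.prod_congr rfl fun i _ => h2 i, Finset.prod_const, Finset.card_univ, Fintype.card_fin]

theorem lintegral_haarGL_eq_gsSet (n : ℕ) {H : (Fin n → ℝ) → ENNReal} (hH : Measurable H) :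
    ∫⁻ g in unipBox n, H (iwasawaT g) ∂(haarGL n) =
      ENNReal.ofReal (∏ j ∈ Finset.Icc 1 n,
        Real.pi ^ (-(j : ℝ) / 2) * Real.Gamma ((j : ℝ) / 2)) *
      ∫⁻ r : Fin n → EuclideanSpace ℝ (Fin n), (gsSet n).indicator
        (fun r : Fin n → EuclideanSpace ℝ (Fin n) =>
          ENNReal.ofReal (((∏ i, ‖gs n r i‖) ^ n)⁻¹) * H fun i => ‖gs n r i‖) r := by
  have hHT : Measurable fun g : GLR n => H (iwasawaT g) := hH.comp (measurable_iwasawaT n)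
  have hdet : Measurable fun g : GLR n =>
      ENNReal.ofReal ((|(g : Matrix (Fin n) (Fin n) ℝ).det| ^ n)⁻¹) := by
    simp only [abs_det_eq_prod_iwasawaT]
    have : ∀ i, Measurable fun g : GLR n => iwasawaT g i := fun i =>
      (measurable_pi_apply i).comp (measurable_iwasawaT n)
    fun_prop
  let Θ : (Fin n → EuclideanSpace ℝ (Fin n)) → ENNReal :=
    (gsSet n).indicator fun r => ENNReal.ofReal (((∏ i, ‖gs n r i‖) ^ n)⁻¹) *
      H fun i => ‖gs n r i‖
  have hΘ : Measurable Θ :=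
    Measurable.indicator (Measurable.mul (by fun_prop) (hH.comp (by fun_prop)))
      (measurableSet_gsSet n)
  rw [← lintegral_indicator (measurableSet_unipBox n), haarGL, lintegral_smul_measure,
    lintegral_withDensity_eq_lintegral_mul _ hdet (hHT.indicator (measurableSet_unipBox n)),
    smul_eq_mul]
  congr 1
  have h1 : ∀ g : GLR n, ((fun g : GLR n =>
      ENNReal.ofReal ((|(g : Matrix (Fin n) (Fin n) ℝ).det| ^ n)⁻¹)) *
      (unipBox n).indicator fun g => H (iwasawaT g)) g = Θ (rowsOf (entries n g)) := fun g => by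
    simp only [Pi.mul_apply, Θ]
    by_cases hg : g ∈ unipBox n
    · rw [Set.indicator_of_mem hg, Set.indicator_of_mem ((mem_unipBox g).mp hg),
        abs_det_eq_prod_iwasawaT, (iwasawa_eq_gs g).2]
    · rw [Set.indicator_of_notMem hg, Set.indicator_of_notMem fun h => hg ((mem_unipBox g).mpr h),
        mul_zero]
  have hemb := measurableEmbedding_entries n
  rw [lintegral_congr h1, ← hemb.lintegral_map (fun M => Θ (rowsOf M)), hemb.map_comap,
    ← lintegral_indicator hemb.measurableSet_range]
  refine Eq.trans (lintegral_congr fun M => ?_) ((measurePreserving_rowsOf n).lintegral_comp hΘ)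
  by_cases hM : M ∈ Set.range (entries n)
  · rw [Set.indicator_of_mem hM]
  · rw [Set.indicator_of_notMem hM]
    -- Singular matrices contribute nothing, because nonzero orthogonalized rows force a nonzero
    -- determinant.
    refine (Set.indicator_of_notMem (fun h => hM ?_) _).symm
    exact ⟨Matrix.GeneralLinearGroup.mkOfDetNeZero (Matrix.of M)
      (det_ne_zero_of_gs_ne_zero h.1), rfl⟩

/-- Integration over `GL_n(ℝ)` modulo `X_n(ℝ)` of a function on the torus, in logarithmic Iwasawa
coordinates. -/
theorem lintegral_haarGL (n : ℕ) {H : (Fin n → ℝ) → ENNReal} (hH : Measurable H) :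
    ∫⁻ g in unipBox n, H (iwasawaT g) ∂(haarGL n) =
      2 ^ n * ∫⁻ w : Fin n → ℝ, eexp (∑ i : Fin n, (2 * (i : ℕ) + 1 - n : ℝ) * w i) *
        H fun i => Real.exp (w i) := by
  rw [lintegral_haarGL_eq_gsSet n hH, lintegral_gsSet n 0 (zero_add n)
    (fun t => ENNReal.ofReal (((∏ i, t i) ^ n)⁻¹) * H t) (Measurable.mul (by fun_prop) hH),
    lintegral_pos_eq, ← mul_assoc]
  simp only [zero_add]
  rw [ofReal_const_mul_prod_sphereArea]
  congr 1
  refine lintegral_congr fun w => ?_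
  rw [← mul_assoc, ← mul_assoc]
  congr 1
  -- The exponent `2i + 1 - n` is composed of `2i` from the orthogonalization, `-n` from the power
  -- of the determinant and `1` from `dt = e^w dw`.
  have e1 : ENNReal.ofReal (∏ i : Fin n, Real.exp (w i) ^ (2 * (i : ℕ))) =
      eexp (∑ i : Fin n, 2 * (i : ℕ) * w i) := by
    rw [eexp, Real.exp_sum]
    congr 1
    refine Finset.prod_congr rfl fun i _ => ?_
    rw [← Real.exp_nat_mul]; push_cast; rfl
  have e2 : ENNReal.ofReal (((∏ i, Real.exp (w i)) ^ n)⁻¹) = eexp (-(n * ∑ i, w i)) := by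
    rw [eexp, ← Real.exp_sum, ← Real.exp_nat_mul, Real.exp_neg]
  rw [e1, e2, ← eexp_add, ← eexp_add]
  congr 1
  simp only [sub_mul, add_mul, one_mul, Finset.sum_sub_distrib, Finset.sum_add_distrib,
    ← Finset.mul_sum]
  ring

/-- The logarithmic coordinates of the torus part of the Iwasawa decomposition. -/
def logT {n : ℕ} (g : GLR n) (i : Fin n) : ℝ := Real.log (iwasawaT g i)

theorem exp_logT {n : ℕ} (g : GLR n) (i : Fin n) : Real.exp (logT g i) = iwasawaT g i :=
  Real.exp_log (iwasawaT_pos g i)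

@[fun_prop]
theorem measurable_logT (n : ℕ) : Measurable (logT (n := n)) :=
  measurable_pi_iff.mpr fun i =>
    ((measurable_pi_apply i).comp (measurable_iwasawaT n)).log

theorem map_logT (n : ℕ) : Measure.map logT ((haarGL n).restrict (unipBox n)) =
    (2 ^ n : ENNReal) • (volume : Measure (Fin n → ℝ)).withDensity
      (fun w => eexp (∑ i : Fin n, (2 * (i : ℕ) + 1 - n : ℝ) * w i)) := by
  ext s hs
  have hl : Measurable fun t : Fin n → ℝ => fun i => Real.log (t i) := by fun_prop
  have h := lintegral_haarGL n (H := fun t => s.indicator 1 fun i => Real.log (t i))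
    ((measurable_one.indicator hs).comp hl)
  simp only [Real.log_exp] at h
  rw [Measure.map_apply (measurable_logT n) hs, ← lintegral_indicator_one (measurable_logT n hs),
    Measure.smul_apply, withDensity_apply _ hs, ← lintegral_indicator hs, smul_eq_mul]
  refine Eq.trans (Eq.trans ?_ h) ?_
  · rfl
  · congr 1
    refine lintegral_congr fun w => ?_
    by_cases hw : w ∈ s
    · rw [Set.indicator_of_mem hw, Set.indicator_of_mem hw, Pi.one_apply, mul_one]
    · rw [Set.indicator_of_notMem hw, Set.indicator_of_notMem hw, mul_zero]

/-! ### Integration over the quotient -/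

theorem logT_unip_mul {n : ℕ} {u : GLR n} (hu : u ∈ unip n) (g : GLR n) :
    logT (u * g) = logT g := by
  funext i
  simp only [logT, iwasawaT_unip_mul hu]

/-- `descend` evaluates at a chosen representative; left invariance under `X_n(ℝ)` makes the choice
irrelevant. -/
theorem logT_out {n : ℕ} (g : GLR n) :
    logT (Quotient.mk (QuotientGroup.rightRel (unip n)) g).out = logT g := by
  have h := Quotient.exact (Quotient.out_eq (Quotient.mk (QuotientGroup.rightRel (unip n)) g))
  have h' := QuotientGroup.rightRel_apply.mp h
  rw [← logT_unip_mul h', inv_mul_cancel_right]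

/-- The exponent of the modular character of the torus, in logarithmic coordinates. -/
def modExp {n : ℕ} (w : Fin n → ℝ) : ℝ := ∑ i : Fin n, (2 * (i : ℕ) + 1 - n : ℝ) * w i

@[fun_prop]
theorem measurable_modExp (n : ℕ) : Measurable (modExp (n := n)) := by
  unfold modExp; fun_prop

theorem measurable_quotient_mk (n : ℕ) :
    Measurable (Quotient.mk (QuotientGroup.rightRel (unip n))) := measurable_quotient_mk''

/-- The integral is pushed forward along `logT`, and the density in `map_logT` cancels the factor
`e^{-modExp}`. -/
theorem integral_descend {n : ℕ} {f : GLR n → ℂ} {F : (Fin n → ℝ) → ℂ} (hF : Measurable F)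
    (hf : ∀ g, f g = Complex.exp (-(modExp (logT g) : ℝ)) * F (logT g)) :
    (Integrable F → Integrable (descend f) (quotientMeasure n)) ∧
      ∫ q, descend f q ∂(quotientMeasure n) = 2 ^ n * ∫ w, F w := by
  let G : (Fin n → ℝ) → ℂ := fun w => Complex.exp (-(modExp w : ℝ)) * F w
  have hG : Measurable G := by fun_prop
  have hq : ∀ g, descend f (Quotient.mk _ g) = G (logT g) := fun g => by
    rw [descend, hf, logT_out]
  have hmk := measurable_quotient_mk n
  have hd : Measurable (descend f) := by
    refine measurable_from_quotient.mpr ?_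
    have : descend f ∘ Quotient.mk'' = fun g : GLR n => G (logT g) := funext hq
    rw [this]
    exact hG.comp (measurable_logT n)
  have hcomp : descend f ∘ Quotient.mk _ = G ∘ logT := funext hq
  have hm : Measurable fun w : Fin n → ℝ => eexp (modExp w) := by fun_prop
  have hfin : ∀ᵐ w : Fin n → ℝ, eexp (modExp w) < ⊤ := .of_forall fun w =>
    (eexp_ne_top _).lt_top
  have hGF : ∀ w, (eexp (modExp w)).toReal • G w = F w := fun w => by
    simp only [G]
    rw [eexp, ENNReal.toReal_ofReal (Real.exp_pos _).le, Complex.real_smul, ← mul_assoc,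
      Complex.ofReal_exp, ← Complex.exp_add, add_neg_cancel, Complex.exp_zero, one_mul]
  have hmap := map_logT n
  change Measure.map logT ((haarGL n).restrict (unipBox n)) =
    (2 ^ n : ENNReal) • volume.withDensity (fun w => eexp (modExp w)) at hmap
  have hqm : quotientMeasure n =
    Measure.map (Quotient.mk (QuotientGroup.rightRel (unip n)))
      ((haarGL n).restrict (unipBox n)) := rfl
  constructor
  · intro hI
    rw [hqm, integrable_map_measure hd.aestronglyMeasurable hmk.aemeasurable, hcomp,
      ← integrable_map_measure hG.aestronglyMeasurable (measurable_logT n).aemeasurable, hmap]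
    refine Integrable.smul_measure ?_ (ENNReal.pow_ne_top ENNReal.ofNat_ne_top)
    rw [integrable_withDensity_iff_integrable_smul' hm hfin]
    simpa only [hGF] using hI
  · rw [hqm, integral_map hmk.aemeasurable hd.aestronglyMeasurable]
    simp only [hq]
    rw [← integral_map (measurable_logT n).aemeasurable hG.aestronglyMeasurable, hmap,
      integral_smul_measure, integral_withDensity_eq_integral_toReal_smul₀ hm.aemeasurable hfin]
    simp only [hGF]
    simp [Complex.real_smul]

/-! ### The radial parts -/

/-- Summation by parts with `(i + 1)(N - i) - i(N + 1 - i) = N - 2i`; it expresses `y^ρ` through the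
torus entries. -/
theorem sum_abel_modulus {N : ℕ} (x : Fin (N + 1) → ℂ) :
    ∑ j : Fin N, ((j : ℕ) + 1 : ℂ) * (N - (j : ℕ)) * (x j.castSucc - x j.succ) =
      ∑ i : Fin (N + 1), ((N : ℂ) - 2 * (i : ℕ)) * x i := by
  have h1 : ∑ j : Fin N, ((j : ℕ) + 1 : ℂ) * (N - (j : ℕ)) * x j.castSucc =
      ∑ i : Fin (N + 1), ((i : ℕ) + 1 : ℂ) * (N - (i : ℕ)) * x i := by
    rw [Fin.sum_univ_castSucc]; simp
  have h2 : ∑ j : Fin N, ((j : ℕ) + 1 : ℂ) * (N - (j : ℕ)) * x j.succ =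
      ∑ i : Fin (N + 1), ((i : ℕ) : ℂ) * (N + 1 - (i : ℕ)) * x i := by
    rw [Fin.sum_univ_succ]
    simp only [Fin.val_zero, Nat.cast_zero, zero_mul, zero_add, Fin.val_succ, Nat.cast_add,
      Nat.cast_one]
    exact Finset.sum_congr rfl fun j _ => by ring
  simp only [mul_sub _ (x _) (x _)]
  rw [Finset.sum_sub_distrib, h1, h2, ← Finset.sum_sub_distrib]
  exact Finset.sum_congr rfl fun i _ => by ring

theorem whittakerRadial_iwasawaY {N : ℕ} (a : Fin (N + 1) → ℂ) (g : GLR (N + 1)) :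
    whittakerRadial (N + 1) a (iwasawaY g) =
      Complex.exp (∑ i : Fin (N + 1), ((N : ℂ) - 2 * (i : ℕ)) / 2 * logT g i) *
        whit (N + 1) a (logT g) := by
  have hl : iwasawaY g (Fin.last N) = Real.exp (logT g (Fin.last N)) := by
    simp [iwasawaY, exp_logT]
  have hc : ∀ j : Fin N, iwasawaY g j.castSucc =
      Real.exp (logT g j.castSucc - logT g j.succ) := fun j => by
    rw [Real.exp_sub, exp_logT, exp_logT, iwasawaY, dif_pos (by simp)]
    rfl
  rw [whittakerRadial, whittakerHat, whit_eq_whittakerCore, hl, ofReal_exp_cpow]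
  simp only [hc]
  congr 1
  rw [Fin.prod_univ_castSucc]
  simp only [hc, ← Real.exp_mul, Fin.val_last, Nat.cast_add, Nat.cast_one, sub_self, mul_zero,
    zero_div, Real.rpow_zero, mul_one, Fin.val_castSucc]
  rw [← Real.exp_sum, Complex.ofReal_exp]
  congr 1
  have h := sum_abel_modulus (fun i => (logT g i : ℂ))
  have h' : ∑ i : Fin (N + 1), ((N : ℂ) - 2 * (i : ℕ)) / 2 * logT g i =
      (∑ i : Fin (N + 1), ((N : ℂ) - 2 * (i : ℕ)) * logT g i) / 2 := by
    rw [Finset.sum_div]; exact Finset.sum_congr rfl fun i _ => by ring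
  rw [h', ← h, Finset.sum_div]
  push_cast
  exact Finset.sum_congr rfl fun i _ => by ring

theorem abs_det_cpow {n : ℕ} (g : GLR n) (s : ℂ) :
    ((|(g : Matrix (Fin n) (Fin n) ℝ).det| : ℝ) : ℂ) ^ s =
      Complex.exp (s * (∑ i, logT g i : ℝ)) := by
  rw [abs_det_eq_prod_iwasawaT, ← ofReal_exp_cpow, Real.exp_sum]
  simp only [exp_logT]

theorem psi_ne_zero {n : ℕ} (x : Matrix (Fin n) (Fin n) ℝ) : psi x ≠ 0 := Complex.exp_ne_zero _

/-- The characters cancel, and the two equal factors `y^ρ` multiply to `e^{-modExp}`. -/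
theorem integrandEq_whittaker {m : ℕ} (a a' : Fin (m + 1) → ℂ) (s : ℂ) (g : GLR (m + 1)) :
    integrandEq s (whittaker (m + 1) a) (whittakerBar (m + 1) a') g =
      Complex.exp (-(modExp (logT g) : ℝ)) * rsEq m a a' s (logT g) := by
  have hψ := psi_ne_zero (iwasawaX g)
  rw [integrandEq, whittaker, whittakerBar, whittakerRadial_iwasawaY, whittakerRadial_iwasawaY,
    gaussian_lastVec_vecMul, abs_det_cpow, rsEq]
  have hδ : Complex.exp (-(modExp (logT g) : ℝ)) =
      Complex.exp (∑ i : Fin (m + 1), ((m : ℂ) - 2 * (i : ℕ)) / 2 * logT g i) *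
      Complex.exp (∑ i : Fin (m + 1), ((m : ℂ) - 2 * (i : ℕ)) / 2 * logT g i) := by
    rw [← Complex.exp_add, modExp]
    congr 1
    push_cast
    rw [← Finset.sum_add_distrib, ← Finset.sum_neg_distrib]
    exact Finset.sum_congr rfl fun i _ => by ring
  have hg : (Real.exp (-Real.pi * iwasawaT g (Fin.last m) ^ 2) : ℂ) =
      Complex.exp (-Real.pi * (Real.exp (2 * logT g (Fin.last m)) : ℝ)) := by
    rw [← exp_logT, ← Real.exp_nat_mul]
    push_cast
    rfl
  rw [hδ, hg, Complex.exp_add]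
  field_simp

theorem logT_blockEmbed {m : ℕ} (g : GLR m) :
    logT (blockEmbed 1 g) = (Fin.snoc (logT g) 0 : Fin (m + 1) → ℝ) := by
  funext i
  rw [logT, iwasawaT_blockEmbed]
  refine Fin.lastCases ?_ (fun i => ?_) i
  · simp
  · simp [logT]

/-- The factors `y^ρ` now come from different ranks. The shift by `1/2` corrects this: `(m + 1 -
2i)/2 + (m - 2i)/2 - 1/2 = m - 2i`. -/
theorem integrandLt_whittaker {m : ℕ} (a : Fin (m + 2) → ℂ) (a' : Fin (m + 1) → ℂ) (s : ℂ)
    (g : GLR (m + 1)) :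
    integrandLt (k := 1) s (whittaker (m + 2) a) (whittakerBar (m + 1) a') g =
      Complex.exp (-(modExp (logT g) : ℝ)) * rsLt (m + 1) a a' s (logT g) := by
  have hψ := psi_ne_zero (iwasawaX g)
  rw [integrandLt, whittaker, whittakerBar, whittakerRadial_iwasawaY, whittakerRadial_iwasawaY,
    abs_det_cpow, psi_iwasawaX_blockEmbed, logT_blockEmbed, rsLt]
  have hδ : Complex.exp (∑ i : Fin (m + 2), (((m + 1 : ℕ) : ℂ) - 2 * (i : ℕ)) / 2 *
        ((Fin.snoc (logT g) 0 : Fin (m + 2) → ℝ) i : ℝ)) *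
      Complex.exp (∑ i : Fin (m + 1), ((m : ℂ) - 2 * (i : ℕ)) / 2 * logT g i) *
      Complex.exp ((s - (1 : ℕ) / 2) * (∑ i, logT g i : ℝ)) =
      Complex.exp (-(modExp (logT g) : ℝ)) * Complex.exp (s * (∑ i, logT g i : ℝ)) := by
    rw [← Complex.exp_add, ← Complex.exp_add, ← Complex.exp_add, modExp, Fin.sum_univ_castSucc]
    simp only [Fin.snoc_castSucc, Fin.snoc_last, Fin.val_castSucc]
    congr 1
    push_cast
    rw [sub_mul, Finset.mul_sum (a := (1 : ℂ) / 2), mul_zero, add_zero, add_sub_left_comm,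
      ← Finset.sum_add_distrib, ← Finset.sum_sub_distrib, ← Finset.sum_neg_distrib, add_comm]
    congr 1
    exact Finset.sum_congr rfl fun i _ => by ring
  linear_combination (psi (iwasawaX g) * (psi (iwasawaX g))⁻¹ *
    whit (m + 2) a (Fin.snoc (logT g) 0) * whit (m + 1) a' (logT g)) * hδ +
    (Complex.exp (-(modExp (logT g) : ℝ)) * Complex.exp (s * (∑ i, logT g i : ℝ)) *
    whit (m + 2) a (Fin.snoc (logT g) 0) * whit (m + 1) a' (logT g)) * mul_inv_cancel₀ hψ

end RankinSelberg

end

theorem theorem2p1 :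
    (∀ (m : ℕ), 1 ≤ m → ∀ (a : Fin (m + 1) → ℂ) (a' : Fin m → ℂ) (s : ℂ),
      (∀ j k, 0 < (s + a j + a' k).re) →
        RankinSelberg.ZetaLtConverges s (RankinSelberg.whittaker (m + 1) a)
          (RankinSelberg.whittakerBar m a') ∧
        RankinSelberg.zetaLt s (RankinSelberg.whittaker (m + 1) a)
          (RankinSelberg.whittakerBar m a') = ∏ j, ∏ k, Complex.Gammaℝ (s + a j + a' k)) ∧
    (∀ (n : ℕ), 1 ≤ n → ∀ (a a' : Fin n → ℂ) (s : ℂ),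
      (∀ j k, 0 < (s + a j + a' k).re) →
        RankinSelberg.ZetaEqConverges s (RankinSelberg.whittaker n a)
          (RankinSelberg.whittakerBar n a') ∧
        RankinSelberg.zetaEq s (RankinSelberg.whittaker n a)
          (RankinSelberg.whittakerBar n a') = ∏ j, ∏ k, Complex.Gammaℝ (s + a j + a' k)) := by
  open RankinSelberg in
  constructor
  · intro m hm a a' s hs
    -- The rank is written as a successor because the comparison with `whit` uses the last torus
    -- coordinate.
    obtain ⟨m, rfl⟩ := Nat.exists_eq_add_of_le' hm
    obtain ⟨hI, h⟩ := integral_descend (measurable_rsLt (m + 1) a a' s)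
      (integrandLt_whittaker a a' s)
    exact ⟨hI (integrable_rsLt hs), h.trans (integral_rsLt (m + 1) a a' s hs)⟩
  · intro n hn a a' s hs
    obtain ⟨m, rfl⟩ := Nat.exists_eq_add_of_le' hn
    obtain ⟨hI, h⟩ := integral_descend (measurable_rsEq m a a' s) (integrandEq_whittaker a a' s)
    exact ⟨hI (integrable_rsEq hs), h.trans (integral_rsEq_eq_prod m a a' s hs)⟩
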